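/- **Setting.** Identify $\mathbb T$ with $[0,1)$ and let $\mathcal D$ be the set of all dyadic intervals $I=[k2^{-j},(k+1)2^{-j})$, $j\in\mathbb N_0$, $0\le k<2^j$ (so $\mathbb T\in\mathcal D$); $\mathcal R=\{I\times J: I,J\in\mathcal D\}$. Functions are scalar-valued (real or complex). Let $h_I=|I|^{-1/2}(\chi_{I^+}-\chi_{I^-})$, where $I^+,I^-$ are the right and left halves of $I$; for $R=I\times J$ let $h_R(s,t)=h_I(s)h_J(t)$, $f_R=\langle f,h_R\rangle$, and let $m_Rf$ be the mean of $f$ over $R$. $L^2_0(\mathbb T^2)$ consists of the $f\in L^2(\mathbb T^2)$ with $\int_{\mathbb T} f(s,t)\,dt=0$ for a.e. $s$ and $\int_{\mathbb T} f(s,t)\,ds=0$ for a.e. $t$. For $f\in L^2(\mathbb T^2)$ put $$\|f\|_{\mathrm{BMO}^d}=\sup_{\Omega}\Big(\frac1{|\Omega|}\sum_{R\in\mathcal R,\,R\subseteq\Omega}|f_R|^2\Big)^{1/2}\in[0,\infty],$$ the supremum being over nonempty open $\Omega\subseteq\mathbb T^2$, and $\mathrm{BMO}^d(\mathbb T^2)=\{f\in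 L^2_0(\mathbb T^2):\|f\|_{\mathrm{BMO}^d}<\infty\}$. For $j=(j_1,j_2)\in\mathbb N_0^2$ let $$Q_jf=\sum_{k_1\ge j_1,\,k_2\ge j_2}\ \sum_{|I|=2^{-k_1},\,|J|=2^{-k_2}}f_{I\times J}\,h_{I\times J}.$$ A function $\phi\in L^2(\mathbb T^2)$ is in $\mathrm{LMO}^d(\mathbb T^2)$ if there is $C<\infty$ with $\|Q_j\phi\|_{\mathrm{BMO}^d}\le \frac{C}{(j_1+1)(j_2+1)}$ for all $j\in\mathbb N_0^2$; $\|\phi\|_{\mathrm{LMO}^d}$ is the infimum of such $C$ ($\infty$ if there are none). For $\phi\in L^2(\mathbb T^2)$ the main paraproduct is $\Pi_\phi f=\sum_{R\in\mathcal R}h_R\,\phi_R\,m_Rf$. It is bounded on $\mathrm{BMO}^d(\mathbb T^2)$ if there is $C<\infty$ such that for every $f\in\mathrm{BMO}^d(\mathbb T^2)$ the series converges unconditionally in $L^2(\mathbb T^2)$, its sum lies in $\mathrm{BMO}^d(\mathbb T^2)$, and $\|\Pi_\phi f\|_{\mathrm{BMO}^d}\le C\|f\|_{\mathrm{BMO}^d}$;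 $\|\Pi_\phi\|_{\mathrm{BMO}\to\mathrm{BMO}}$ is the infimum of such $C$ ($\infty$ if there are none). **Theorem.** There are absolute constants $c,C>0$ such that for every $\phi\in L^2(\mathbb T^2)$: 1. $\Pi_\phi$ is bounded on $\mathrm{BMO}^d(\mathbb T^2)$ if and only if $Q_{(1,1)}\phi\in\mathrm{LMO}^d(\mathbb T^2)$, and $c\,\|Q_{(1,1)}\phi\|_{\mathrm{LMO}^d}\le\|\Pi_\phi\|_{\mathrm{BMO}\to\mathrm{BMO}}\le C\,\|Q_{(1,1)}\phi\|_{\mathrm{LMO}^d}$. 2. If $\phi\in\mathrm{LMO}^d(\mathbb T^2)$, then $\Pi_\phi$ is bounded on $\mathrm{BMO}^d(\mathbb T^2)$; moreover $\|\Pi_\phi\|_{\mathrm{BMO}\to\mathrm{BMO}}\le C\,\|\phi\|_{\mathrm{LMO}^d}$. 3. If $\phi_{I\times J}=0$ whenever $I=\mathbb T$ or $J=\mathbb T$, then $\Pi_\phi$ is bounded on $\mathrm{BMO}^d(\mathbb T^2)$ if and only if $\phi\in\mathrm{LMO}^d(\mathbb T^2)$, and $c\,\|\phi\|_{\mathrm{LMO}^d}\le\|\Pi_\phi\|_{\mathrm{BMO}\to\mathrm{BMO}}\le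 C\,\|\phi\|_{\mathrm{LMO}^d}$. -/

import Mathlib

open MeasureTheory Set
open scoped ENNReal NNReal

noncomputable section

namespace DyadicBMO

/-- The torus `𝕋²`, with `𝕋 = ℝ / ℤ`; its `volume` is the normalised Lebesgue measure. -/
abbrev Torus2 : Type := UnitAddCircle × UnitAddCircle

/-- The identification of `𝕋` with `[0, 1)`. -/
def coord (x : UnitAddCircle) : ℝ := (AddCircle.equivIco (1 : ℝ) 0 x : ℝ)

lemma measurable_coord : Measurable coord :=
  measurable_subtype_coe.comp (AddCircle.measurableEquivIco (1 : ℝ) 0).measurable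

/-- The part of `𝕋` that corresponds to `[a, b) ⊆ [0, 1)`. -/
def arc (a b : ℝ) : Set UnitAddCircle := coord ⁻¹' Ico a b

lemma measurableSet_arc (a b : ℝ) : MeasurableSet (arc a b) :=
  measurable_coord measurableSet_Ico

/-- Dyadic intervals: the pair `⟨j, k⟩` stands for `[k / 2 ^ j, (k + 1) / 2 ^ j)`, `0 ≤ k < 2 ^ j`. -/
abbrev DyadicInterval : Type := Σ j : ℕ, Fin (2 ^ j)

/-- Dyadic rectangles `R = I × J`, given by the pair `(I, J)`. -/
abbrev DyadicRect : Type := DyadicInterval × DyadicInterval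

/-- The dyadic interval as a subset of `𝕋`. -/
def DyadicInterval.toSet (I : DyadicInterval) : Set UnitAddCircle :=
  arc ((I.2.val : ℝ) / 2 ^ I.1) (((I.2.val : ℝ) + 1) / 2 ^ I.1)

/-- The left half of a dyadic interval. -/
def DyadicInterval.left (I : DyadicInterval) : Set UnitAddCircle :=
  arc ((I.2.val : ℝ) / 2 ^ I.1) (((I.2.val : ℝ) + 1 / 2) / 2 ^ I.1)

/-- The right half of a dyadic interval. -/
def DyadicInterval.right (I : DyadicInterval) : Set UnitAddCircle :=
  arc (((I.2.val : ℝ) + 1 / 2) / 2 ^ I.1) (((I.2.val : ℝ) + 1) / 2 ^ I.1)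

/-- The dyadic rectangle as a subset of `𝕋²`. -/
def DyadicRect.toSet (R : DyadicRect) : Set Torus2 :=
  DyadicInterval.toSet R.1 ×ˢ DyadicInterval.toSet R.2

/-- The Haar function `h_I = |I|^{-1/2} (χ_{I⁺} - χ_{I⁻})`, with `I⁺`, `I⁻` the right and left
halves of `I`; here `|I| = 2 ^ (-j)` for `I = ⟨j, k⟩`. -/
def haar1 (I : DyadicInterval) (x : UnitAddCircle) : ℝ :=
  Real.sqrt (2 ^ I.1) *
    ((DyadicInterval.right I).indicator 1 x - (DyadicInterval.left I).indicator 1 x)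

lemma measurable_haar1 (I : DyadicInterval) : Measurable (haar1 I) :=
  ((measurable_one.indicator (measurableSet_arc _ _)).sub
    (measurable_one.indicator (measurableSet_arc _ _))).const_mul _

lemma abs_haar1_le (I : DyadicInterval) (x : UnitAddCircle) :
    |haar1 I x| ≤ Real.sqrt (2 ^ I.1) := by
  unfold haar1
  rw [abs_mul, abs_of_nonneg (Real.sqrt_nonneg _)]
  refine mul_le_of_le_one_right (Real.sqrt_nonneg _) ?_
  by_cases h1 : x ∈ DyadicInterval.right I <;> by_cases h2 : x ∈ DyadicInterval.left I <;>
    simp [h1, h2]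

variable {𝕜 : Type*} [RCLike 𝕜]

variable (𝕜) in
/-- The product Haar function `h_R (s, t) = h_I (s) h_J (t)`, `R = I × J`, with values in `𝕜`. -/
def haarFun (R : DyadicRect) (p : Torus2) : 𝕜 := ((haar1 R.1 p.1 * haar1 R.2 p.2 : ℝ) : 𝕜)

variable (𝕜) in
lemma memLp_haarFun (R : DyadicRect) :
    MemLp (haarFun 𝕜 R) 2 (volume : Measure Torus2) := by
  refine MemLp.of_bound (C := Real.sqrt (2 ^ R.1.1) * Real.sqrt (2 ^ R.2.1)) ?_ ?_
  · exact (RCLike.measurable_ofReal.comp (((measurable_haar1 R.1).comp measurable_fst).mul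
      ((measurable_haar1 R.2).comp measurable_snd))).aestronglyMeasurable
  · refine Filter.Eventually.of_forall fun p => ?_
    rw [haarFun, RCLike.norm_ofReal, abs_mul]
    exact mul_le_mul (abs_haar1_le _ _) (abs_haar1_le _ _) (abs_nonneg _) (Real.sqrt_nonneg _)

variable (𝕜) in
/-- The space `L²(𝕋²)` of `𝕜`-valued functions, `𝕜 = ℝ` or `ℂ`. -/
abbrev L2T : Type _ := Lp 𝕜 2 (volume : Measure Torus2)

variable (𝕜) in
/-- The product Haar function as an element of `L²(𝕋²)`. -/
def haar (R : DyadicRect) : L2T 𝕜 := (memLp_haarFun 𝕜 R).toLp (haarFun 𝕜 R)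

/-- The Haar coefficient `f_R = ⟨f, h_R⟩ = ∫ f h_R` (Mathlib's inner product is linear in its
second argument). -/
def coef (f : L2T 𝕜) (R : DyadicRect) : 𝕜 := inner 𝕜 (haar 𝕜 R) f

/-- The mean `m_R f` of `f` over the rectangle `R`. -/
def mean (f : L2T 𝕜) (R : DyadicRect) : 𝕜 := ⨍ p in DyadicRect.toSet R, f p

/-- Membership in `L²₀(𝕋²)`: vanishing integral in each variable separately. -/
def MemL20 (f : L2T 𝕜) : Prop :=
  (∀ᵐ s : UnitAddCircle, ∫ t : UnitAddCircle, f (s, t) = 0) ∧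
    ∀ᵐ t : UnitAddCircle, ∫ s : UnitAddCircle, f (s, t) = 0

/-- The dyadic product BMO norm
`sup_Ω (|Ω|⁻¹ ∑_{R ⊆ Ω} |f_R|²)^{1/2}` over all open `Ω ⊆ 𝕋²`, with values in `[0, ∞]`
(the empty set contributes `0`). -/
def bmoNorm (f : L2T 𝕜) : ℝ≥0∞ :=
  (⨆ (Ω : Set Torus2) (_ : IsOpen Ω),
    (volume Ω)⁻¹ * ∑' R : {R : DyadicRect // DyadicRect.toSet R ⊆ Ω}, ‖coef f R.1‖ₑ ^ 2) ^
      (1 / 2 : ℝ)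

/-- Membership in `BMO^d(𝕋²)`. -/
def MemBMO (f : L2T 𝕜) : Prop := MemL20 f ∧ bmoNorm f < ∞

/-- The product martingale difference `Δ_j f = ∑_{R ∈ R_j} f_R h_R`, where `R_j` consists of the
rectangles `I × J` with `|I| = 2 ^ (-j₁)` and `|J| = 2 ^ (-j₂)`. -/
def martDiff (j : ℕ × ℕ) (f : L2T 𝕜) : L2T 𝕜 :=
  ∑ k : Fin (2 ^ j.1) × Fin (2 ^ j.2),
    coef f (⟨j.1, k.1⟩, ⟨j.2, k.2⟩) • haar 𝕜 (⟨j.1, k.1⟩, ⟨j.2, k.2⟩)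

/-- `Q_j f = ∑_{k ≥ j} Δ_k f`, the sum being over all `k` with `k₁ ≥ j₁` and `k₂ ≥ j₂`; the series
is orthogonal and converges in `L²(𝕋²)`. -/
def Q (j : ℕ × ℕ) (f : L2T 𝕜) : L2T 𝕜 := ∑' k : {k : ℕ × ℕ // j ≤ k}, martDiff k.1 f

/-- `C` is an admissible constant in the definition of `LMO^d(𝕋²)`. -/
def LMOBound (φ : L2T 𝕜) (C : ℝ≥0) : Prop :=
  ∀ j : ℕ × ℕ, bmoNorm (Q j φ) ≤ C * (((j.1 : ℝ≥0∞) + 1) * ((j.2 : ℝ≥0∞) + 1))⁻¹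

/-- Membership in `LMO^d(𝕋²)`. -/
def MemLMO (φ : L2T 𝕜) : Prop := ∃ C : ℝ≥0, LMOBound φ C

/-- The `LMO^d` norm: the infimum of the admissible constants (`∞` if there are none). -/
def lmoNorm (φ : L2T 𝕜) : ℝ≥0∞ := ⨅ (C : ℝ≥0) (_ : LMOBound φ C), (C : ℝ≥0∞)

/-- The term `h_R φ_R m_R f` of the main paraproduct. -/
def paraTerm (φ f : L2T 𝕜) (R : DyadicRect) : L2T 𝕜 := (coef φ R * mean f R) • haar 𝕜 R

/-- The main paraproduct `Π_φ f = ∑_R h_R φ_R m_R f`, as a sum in `L²(𝕋²)`. -/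
def paraproduct (φ f : L2T 𝕜) : L2T 𝕜 := ∑' R : DyadicRect, paraTerm φ f R

/-- `Π_φ` maps `BMO^d(𝕋²)` to itself with norm at most `C`: for every `f ∈ BMO^d(𝕋²)`, the series
for `Π_φ f` converges in `L²(𝕋²)`, and its sum is in `BMO^d(𝕋²)` with `‖Π_φ f‖ ≤ C ‖f‖`. -/
def ParaproductBound (φ : L2T 𝕜) (C : ℝ≥0) : Prop :=
  ∀ f : L2T 𝕜, MemBMO f → Summable (paraTerm φ f) ∧ MemBMO (paraproduct φ f) ∧
    bmoNorm (paraproduct φ f) ≤ C * bmoNorm f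

/-- `Π_φ : BMO^d(𝕋²) → BMO^d(𝕋²)` is bounded. -/
def ParaproductBounded (φ : L2T 𝕜) : Prop := ∃ C : ℝ≥0, ParaproductBound φ C

/-- The operator norm of `Π_φ` on `BMO^d(𝕋²)` (`∞` if `Π_φ` is not bounded). -/
def paraproductNorm (φ : L2T 𝕜) : ℝ≥0∞ := ⨅ (C : ℝ≥0) (_ : ParaproductBound φ C), (C : ℝ≥0∞)

end DyadicBMO

end

noncomputable section

namespace DyadicBMO

/-! ### Dyadic intervals and rectangles containing a point -/

/-! For `f` in `L²₀` the mean over `R` is the sum of `f_S h_S(x)` over the `S ∋ x` that are strictly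
longer than `R` in both directions (`MemL20.mean_eq`). It vanishes if a side of `R` is the whole
circle, so only `Q (1, 1) φ` matters.

Sufficiency. With `g_S = |S|^{-1/2} |f_S|`, the mean is at most the double sum of `g` over these
larger `S`, and `g` is a Carleson sequence with constant `‖f‖²`. Group the `R ⊆ Ω` into blocks where
the two scales lie in `[2 ^ a, 2 ^ (a + 1))` and `[2 ^ b, 2 ^ (b + 1))`. On a block the coefficients
of `φ` have Carleson constant at most `C² 4^{-a} 4^{-b}`, and `carleson_embedding` reduces the claim
to `lintegral_weighted_sums_le`: the integral, over `x`, of the sum over admissible blocks of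
`4^{-a} 4^{-b}` times the squared double sum of `g` is at most a constant times `‖f‖² |Ω|`.

For fixed `x`, the admissible blocks form an up-set `B`, contained in the up-set `S` of an
enlargement `Ω'` of `Ω`. Each row of `B` is compared with a corner `(α, β)` of `S`, at which the
double sum is cut into four pieces (`tsum_upset_le`). The piece below the corner in both scales uses
only `g² ≤ ‖f‖²`; the two mixed pieces are controlled by one-parameter Carleson estimates; the piece
beyond the corner involves only rectangles in `Ω'`. The first piece carries the weight `2^{-(b -
β)}`, and its sum over rows is integrable by a Journé type argument: where `R` cannot be lengthened
in the second variable inside `Ω'`, at least half of `R` cannot be lengthened inside `Ω`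
(`volume_isFirstL_diff_le`). Only the first variable has to be enlarged.

Necessity. Test on a tensor product of two logarithmic functions with Haar coefficients `|R| h_R(x)`
for the `R ∋ x` of scales below `j`. Its BMO norm is at most `2`, independently of `j`, while its
mean is `j₁ j₂` on every subrectangle of the rectangle of scale `j` around `x`. Thus the
coefficients of `φ` inside that rectangle gain the factor `(j₁ j₂)^{-1}`; adding over the disjoint
rectangles of scale `j` gives the LMO bound. -/

lemma coord_nonneg (s : UnitAddCircle) : 0 ≤ coord s := (AddCircle.equivIco (1 : ℝ) 0 s).2.1

lemma coord_lt_one (s : UnitAddCircle) : coord s < 1 :=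
  (AddCircle.equivIco (1 : ℝ) 0 s).2.2.trans_eq (zero_add 1)

lemma floor_coord_lt (k : ℕ) (s : UnitAddCircle) : ⌊coord s * 2 ^ k⌋₊ < 2 ^ k := by
  rw [Nat.floor_lt (mul_nonneg (coord_nonneg s) (by positivity))]
  push_cast
  exact mul_lt_of_lt_one_left (by positivity) (coord_lt_one s)

/-- The dyadic interval of length `2 ^ (-k)` that contains `s`. -/
def idx (k : ℕ) (s : UnitAddCircle) : DyadicInterval := ⟨k, ⟨⌊coord s * 2 ^ k⌋₊, floor_coord_lt k s⟩⟩

@[simp] lemma idx_fst (k : ℕ) (s : UnitAddCircle) : (idx k s).1 = k := rfl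

lemma idx_eq_mk_iff {k : ℕ} {s : UnitAddCircle} {m : Fin (2 ^ k)} :
    idx k s = ⟨k, m⟩ ↔ ⌊coord s * 2 ^ k⌋₊ = m.val := by
  constructor
  · intro h
    have := (Sigma.mk.inj_iff.1 h).2
    rw [heq_iff_eq] at this
    rw [← this]
  · intro h
    unfold idx
    congr 1
    exact Fin.ext h

lemma idx_eq_idx_iff {k : ℕ} {s t : UnitAddCircle} :
    idx k s = idx k t ↔ ⌊coord s * 2 ^ k⌋₊ = ⌊coord t * 2 ^ k⌋₊ := idx_eq_mk_iff

lemma mem_arc_iff {k m : ℕ} {s : UnitAddCircle} :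
    s ∈ arc ((m : ℝ) / 2 ^ k) (((m : ℝ) + 1) / 2 ^ k) ↔ ⌊coord s * 2 ^ k⌋₊ = m := by
  have h2 : (0 : ℝ) < 2 ^ k := by positivity
  rw [Nat.floor_eq_iff (mul_nonneg (coord_nonneg s) h2.le)]
  simp only [arc, mem_preimage, mem_Ico, div_le_iff₀ h2, lt_div_iff₀ h2]

lemma mem_toSet_iff {I : DyadicInterval} {s : UnitAddCircle} : s ∈ I.toSet ↔ idx I.1 s = I := by
  obtain ⟨k, m⟩ := I
  rw [idx_eq_mk_iff]
  exact mem_arc_iff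

lemma mem_toSet_idx (k : ℕ) (s : UnitAddCircle) : s ∈ (idx k s).toSet := mem_toSet_iff.2 rfl

lemma mem_toSet_idx_iff {k : ℕ} {s t : UnitAddCircle} : t ∈ (idx k s).toSet ↔ idx k t = idx k s :=
  mem_toSet_iff

/-- Passing to the coarser scale drops the last `d` binary digits, which is integer division of the
floor by `2 ^ d`. -/
lemma idx_eq_of_le {k l : ℕ} (h : k ≤ l) {s t : UnitAddCircle} (e : idx l s = idx l t) :
    idx k s = idx k t := by
  obtain ⟨d, rfl⟩ := Nat.exists_eq_add_of_le h
  rw [idx_eq_idx_iff] at e ⊢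
  have key : ∀ u : UnitAddCircle, ⌊coord u * 2 ^ k⌋₊ = ⌊coord u * 2 ^ (k + d)⌋₊ / 2 ^ d := by
    intro u
    rw [← Nat.floor_div_natCast]
    congr 1
    push_cast
    rw [pow_add]
    field_simp
  rw [key, key, e]

lemma toSet_idx_subset {k l : ℕ} (h : k ≤ l) (s : UnitAddCircle) :
    (idx l s).toSet ⊆ (idx k s).toSet := fun _ ht =>
  mem_toSet_idx_iff.2 (idx_eq_of_le h (mem_toSet_idx_iff.1 ht))

lemma measurableSet_toSet (I : DyadicInterval) : MeasurableSet I.toSet := measurableSet_arc _ _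

instance : MeasurableSpace DyadicInterval := ⊤

instance : DiscreteMeasurableSpace DyadicInterval := ⟨fun _ => trivial⟩

lemma measurable_idx (k : ℕ) : Measurable (idx k) := by
  refine measurable_to_countable' fun I => ?_
  by_cases h : I.1 = k
  · subst h
    convert measurableSet_toSet I using 1
    ext s
    exact mem_toSet_iff.symm
  · convert MeasurableSet.empty using 1
    ext s
    simp only [mem_preimage, mem_singleton_iff, mem_empty_iff_false, iff_false]
    rintro rfl
    exact h rfl

lemma volume_arc {a b : ℝ} (ha : 0 ≤ a) (hb : b ≤ 1) : volume (arc a b) = ENNReal.ofReal (b - a) := by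
  rw [← (UnitAddCircle.measurePreserving_mk 0).measure_preimage
    (measurableSet_arc a b).nullMeasurableSet]
  -- The quotient map is measure preserving on `Ioc 0 1`, whereas `coord` takes values in `Ico 0 1`;
  -- the two differ by a null set.
  rw [Measure.restrict_congr_set (Ico_ae_eq_Ioc (μ := volume) (a := (0:ℝ)) (b := 0 + 1)).symm]
  rw [Measure.restrict_apply' measurableSet_Ico, ← Real.volume_Ico]
  congr 1
  ext x
  simp only [mem_inter_iff, mem_preimage, arc, mem_Ico, zero_add]
  constructor
  · rintro ⟨h, hx⟩
    have : coord (x : UnitAddCircle) = x := by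
      unfold coord
      rw [AddCircle.equivIco_coe_eq (by simpa using hx)]
    rwa [this] at h
  · intro h
    have hx : x ∈ Ico (0 : ℝ) (0 + 1) := ⟨by linarith [h.1], by linarith [h.2]⟩
    have : coord (x : UnitAddCircle) = x := by
      unfold coord
      rw [AddCircle.equivIco_coe_eq hx]
    rw [this]
    exact ⟨h, by simpa using hx⟩

lemma volume_toSet_interval (I : DyadicInterval) : volume I.toSet = ((2 : ℝ≥0∞) ^ I.1)⁻¹ := by
  have h2 : (0 : ℝ) < 2 ^ I.1 := by positivity
  have h1 : ((I.2.val : ℝ) + 1) ≤ 2 ^ I.1 := by exact_mod_cast I.2.2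
  unfold DyadicInterval.toSet
  rw [volume_arc (by positivity) (by rw [div_le_one h2]; exact h1), ← sub_div, add_sub_cancel_left,
    one_div, ENNReal.ofReal_inv_of_pos h2, ENNReal.ofReal_pow (by norm_num)]
  simp

/-- The scale of a dyadic rectangle. -/
def DyadicRect.scale (R : DyadicRect) : ℕ × ℕ := (R.1.1, R.2.1)

/-- The dyadic rectangle of scale `k` that contains `x`. -/
def rect (k : ℕ × ℕ) (x : Torus2) : DyadicRect := (idx k.1 x.1, idx k.2 x.2)

@[simp] lemma scale_rect (k : ℕ × ℕ) (x : Torus2) : (rect k x).scale = k := rfl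

lemma mem_rect_iff {R : DyadicRect} {x : Torus2} : x ∈ R.toSet ↔ rect R.scale x = R := by
  simp only [DyadicRect.toSet, mem_prod, mem_toSet_iff, rect, DyadicRect.scale, Prod.ext_iff]

lemma mem_toSet_rect (k : ℕ × ℕ) (x : Torus2) : x ∈ (rect k x).toSet := mem_rect_iff.2 rfl

lemma mem_toSet_rect_iff {k : ℕ × ℕ} {x y : Torus2} :
    y ∈ (rect k x).toSet ↔ rect k y = rect k x := mem_rect_iff

lemma rect_eq_of_le {k l : ℕ × ℕ} (h : k ≤ l) {x y : Torus2} (e : rect l x = rect l y) :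
    rect k x = rect k y := by
  simp only [rect, Prod.ext_iff] at e ⊢
  exact ⟨idx_eq_of_le h.1 e.1, idx_eq_of_le h.2 e.2⟩

lemma toSet_rect_subset {k l : ℕ × ℕ} (h : k ≤ l) (x : Torus2) :
    (rect l x).toSet ⊆ (rect k x).toSet := fun _ ht =>
  mem_toSet_rect_iff.2 (rect_eq_of_le h (mem_toSet_rect_iff.1 ht))

lemma measurableSet_rect (R : DyadicRect) : MeasurableSet R.toSet :=
  (measurableSet_toSet _).prod (measurableSet_toSet _)

instance : DiscreteMeasurableSpace DyadicRect := by
  unfold DyadicRect; infer_instance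

lemma measurable_rect (k : ℕ × ℕ) : Measurable (rect k) :=
  ((measurable_idx _).comp measurable_fst).prodMk ((measurable_idx _).comp measurable_snd)

lemma volume_rect' (R : DyadicRect) :
    volume R.toSet = volume R.1.toSet * volume R.2.toSet := Measure.prod_prod _ _

lemma volume_rect (R : DyadicRect) : volume R.toSet = ((2 : ℝ≥0∞) ^ (R.1.1 + R.2.1))⁻¹ := by
  rw [volume_rect', volume_toSet_interval, volume_toSet_interval, pow_add,
    ENNReal.mul_inv (Or.inl (by positivity)) (Or.inl (by simp))]

lemma volume_interval_ne_zero (I : DyadicInterval) : volume I.toSet ≠ 0 := by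
  rw [volume_toSet_interval]; simp

lemma volume_interval_ne_top (I : DyadicInterval) : volume I.toSet ≠ ∞ := by
  rw [volume_toSet_interval]; simp

lemma volume_rect_ne_zero (R : DyadicRect) : volume R.toSet ≠ 0 := by
  rw [volume_rect]; simp

lemma volume_rect_ne_top (R : DyadicRect) : volume R.toSet ≠ ∞ := by
  rw [volume_rect]; simp

lemma interval_nonempty (I : DyadicInterval) : I.toSet.Nonempty :=
  nonempty_of_measure_ne_zero (volume_interval_ne_zero I)

lemma rect_nonempty (R : DyadicRect) : R.toSet.Nonempty :=
  nonempty_of_measure_ne_zero (volume_rect_ne_zero R)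

/-- A sum over dyadic rectangles as an integral of a sum over scales. -/
lemma lintegral_tsum_rect (F : DyadicRect → ℝ≥0∞) :
    ∫⁻ x, ∑' k, F (rect k x) = ∑' R, volume R.toSet * F R := by
  -- Exactly one rectangle of each scale contains `x`, so a sum over scales is a sum over the
  -- rectangles through `x`.
  have h : ∀ x : Torus2, ∑' k, F (rect k x) = ∑' R : DyadicRect, R.toSet.indicator (fun _ => F R) x := by
    intro x
    have hinj : Function.Injective (fun k => rect k x) := fun k l h => by
      have := congrArg DyadicRect.scale h
      simpa using this
    rw [← hinj.tsum_eq (f := fun R : DyadicRect => R.toSet.indicator (fun _ => F R) x)]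
    · refine tsum_congr fun k => ?_
      rw [indicator_of_mem (mem_toSet_rect k x)]
    · intro R hR
      rw [Function.mem_support] at hR
      have : x ∈ R.toSet := by
        by_contra hx
        exact hR (indicator_of_notMem hx _)
      exact ⟨R.scale, mem_rect_iff.1 this⟩
  simp_rw [h]
  rw [lintegral_tsum fun R => (measurable_const.indicator (measurableSet_rect R)).aemeasurable]
  refine tsum_congr fun R => ?_
  rw [lintegral_indicator_const (measurableSet_rect R), mul_comm]

/-- Integrals over a union of atoms of a countable partition can be compared atom by atom. -/
lemma setLIntegral_le_of_fiber {X Y : Type*} [MeasurableSpace X] [MeasurableSpace Y] [Countable Y]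
    [MeasurableSingletonClass Y] {μ : Measure X} {π : X → Y} (hπ : Measurable π) (P : Y → Prop)
    (F G : X → ℝ≥0∞)
    (h : ∀ y, P y → ∫⁻ x in π ⁻¹' {y}, F x ∂μ ≤ ∫⁻ x in π ⁻¹' {y}, G x ∂μ) :
    ∫⁻ x in {x | P (π x)}, F x ∂μ ≤ ∫⁻ x in {x | P (π x)}, G x ∂μ := by
  have e : {x | P (π x)} = ⋃ y : {y // P y}, π ⁻¹' {y.1} := by
    ext x; simp
  have hd : Pairwise (Function.onFun Disjoint fun y : {y // P y} => π ⁻¹' {y.1}) := by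
    intro y z hyz
    refine Disjoint.preimage π ?_
    simpa using fun h => hyz (Subtype.ext h)
  rw [e, lintegral_iUnion (fun y => hπ (measurableSet_singleton _)) hd,
    lintegral_iUnion (fun y => hπ (measurableSet_singleton _)) hd]
  exact ENNReal.tsum_le_tsum fun y => h y.1 y.2

lemma rect_preimage (k : ℕ × ℕ) (R : DyadicRect) (h : R.scale = k) : rect k ⁻¹' {R} = R.toSet := by
  subst h
  ext x
  exact mem_rect_iff.symm

lemma rect_preimage_of_ne (k : ℕ × ℕ) (R : DyadicRect) (h : R.scale ≠ k) : rect k ⁻¹' {R} = ∅ := by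
  ext x
  simp only [mem_preimage, mem_singleton_iff, mem_empty_iff_false, iff_false]
  rintro rfl
  exact h rfl

lemma setLIntegral_le_of_rect (k : ℕ × ℕ) (P : DyadicRect → Prop) (F G : Torus2 → ℝ≥0∞)
    (h : ∀ R : DyadicRect, R.scale = k → P R → ∫⁻ x in R.toSet, F x ≤ ∫⁻ x in R.toSet, G x) :
    ∫⁻ x in {x | P (rect k x)}, F x ≤ ∫⁻ x in {x | P (rect k x)}, G x := by
  refine setLIntegral_le_of_fiber (measurable_rect k) P F G fun R hR => ?_
  by_cases hk : R.scale = k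
  · rw [rect_preimage k R hk]
    exact h R hk hR
  · rw [rect_preimage_of_ne k R hk]
    simp

/-! ### A summation lemma for up-sets of scales -/

open Classical in
/-- The value `v` if `P` holds, and `0` otherwise. -/
def iv (P : Prop) (v : ℝ≥0∞) : ℝ≥0∞ := if P then v else 0

lemma iv_pos {P : Prop} (h : P) (v : ℝ≥0∞) : iv P v = v := if_pos h

lemma iv_neg {P : Prop} (h : ¬ P) (v : ℝ≥0∞) : iv P v = 0 := if_neg h

lemma iv_le (P : Prop) (v : ℝ≥0∞) : iv P v ≤ v := by
  by_cases h : P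
  · rw [iv_pos h]
  · rw [iv_neg h]; exact zero_le

lemma iv_le_of {P : Prop} {v w : ℝ≥0∞} (h : P → v ≤ w) : iv P v ≤ w := by
  by_cases hP : P
  · rw [iv_pos hP]; exact h hP
  · rw [iv_neg hP]; exact zero_le

lemma mul_iv (P : Prop) (c v : ℝ≥0∞) : c * iv P v = iv P (c * v) := by
  by_cases h : P
  · rw [iv_pos h, iv_pos h]
  · rw [iv_neg h, iv_neg h, mul_zero]

lemma iv_iv (P Q : Prop) (v : ℝ≥0∞) : iv P (iv Q v) = iv (P ∧ Q) v := by
  by_cases hP : P <;> by_cases hQ : Q <;> simp [iv, hP, hQ]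

lemma iv_mono {P Q : Prop} {v w : ℝ≥0∞} (h : P → Q ∧ v ≤ w) : iv P v ≤ iv Q w :=
  iv_le_of fun hP => by rw [iv_pos (h hP).1]; exact (h hP).2

/-- The number `1 / 2` in `[0, ∞]`. -/
def half : ℝ≥0∞ := 2⁻¹

lemma half_le_one : half ≤ 1 := by simp [half]

lemma half_pow_anti {m n : ℕ} (h : m ≤ n) : half ^ n ≤ half ^ m :=
  pow_le_pow_right_of_le_one' half_le_one h

lemma half_pow_mul_two_pow {m n : ℕ} (h : m ≤ n) : half ^ n * 2 ^ m = half ^ (n - m) := by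
  obtain ⟨d, rfl⟩ := Nat.exists_eq_add_of_le h
  rw [pow_add, Nat.add_sub_cancel_left, mul_right_comm, ← mul_pow,
    half, ENNReal.inv_mul_cancel (by simp) (by simp), one_pow, one_mul]

lemma tsum_half_pow : ∑' n : ℕ, half ^ n = 2 := by
  rw [ENNReal.tsum_geometric, half, ENNReal.one_sub_inv_two, inv_inv]

lemma tsum_half_pow_shift (n₀ : ℕ) : ∑' n : ℕ, iv (n₀ ≤ n) (half ^ (n - n₀)) = 2 := by
  rw [← tsum_half_pow, ← (add_left_injective n₀).tsum_eq]
  · refine tsum_congr fun n => ?_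
    rw [iv_pos (Nat.le_add_left _ _), Nat.add_sub_cancel]
  · intro n hn
    by_cases h : n₀ ≤ n
    · exact ⟨n - n₀, Nat.sub_add_cancel h⟩
    · exact absurd (iv_neg h _) hn

lemma tsum_half_pow_below (n₀ : ℕ) : ∑' n : ℕ, iv (n < n₀) (half ^ (n₀ - n - 1)) ≤ 2 := by
  have h : ∑' n : ℕ, iv (n < n₀) (half ^ (n₀ - n - 1)) =
      ∑ n ∈ Finset.range n₀, half ^ (n₀ - 1 - n) := by
    rw [tsum_eq_sum (s := Finset.range n₀) fun n hn => iv_neg (by simpa using hn) _]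
    refine Finset.sum_congr rfl fun n hn => ?_
    rw [iv_pos (by simpa using hn), Nat.sub_right_comm]
  rw [h, Finset.sum_range_reflect (fun n => half ^ n) n₀, ← tsum_half_pow]
  exact ENNReal.sum_le_tsum _

/-- Writing `n + 1` as a sum of ones over `m ≤ n` and exchanging the sums gives the square of the
geometric series. The factor `n + 1` later counts the rows `β ≤ b` that may contain the corner. -/
lemma tsum_half_pow_succ_mul : ∑' n : ℕ, half ^ n * (n + 1) ≤ 4 := by
  have h : ∀ n : ℕ, half ^ n * ((n : ℝ≥0∞) + 1) = ∑' m : ℕ, iv (m ≤ n) (half ^ (n - m) * half ^ m) := by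
    intro n
    rw [tsum_eq_sum (s := Finset.range (n + 1))
      fun m hm => iv_neg (by simpa [Nat.lt_succ_iff] using hm) _]
    rw [Finset.sum_congr rfl (g := fun _ => half ^ n)]
    · simp [mul_comm]
    · intro m hm
      have : m ≤ n := by simpa [Nat.lt_succ_iff] using hm
      rw [iv_pos this, ← pow_add, Nat.sub_add_cancel this]
  simp_rw [h]
  rw [ENNReal.tsum_comm]
  calc ∑' m : ℕ, ∑' n : ℕ, iv (m ≤ n) (half ^ (n - m) * half ^ m)
      = ∑' m : ℕ, half ^ m * 2 := by
        refine tsum_congr fun m => ?_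
        rw [← tsum_half_pow_shift m, ← ENNReal.tsum_mul_left]
        exact tsum_congr fun n => by rw [mul_iv, mul_comm]
    _ ≤ 4 := by rw [ENNReal.tsum_mul_right, tsum_half_pow]; norm_num

lemma add_sq_le_two (a b : ℝ≥0∞) : (a + b) ^ 2 ≤ 2 * (a ^ 2 + b ^ 2) := by
  have := ENNReal.rpow_add_le_mul_rpow_add_rpow a b (p := 2) (by norm_num)
  norm_num at this
  exact_mod_cast this

lemma sq_sum_le {ι : Type*} (s : Finset ι) (f : ι → ℝ≥0∞) :
    (∑ i ∈ s, f i) ^ 2 ≤ s.card * ∑ i ∈ s, f i ^ 2 := by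
  have := ENNReal.rpow_sum_le_const_mul_sum_rpow s f (p := 2) (by norm_num)
  norm_num at this
  exact_mod_cast this

lemma sq_sum_sum_le (s t : Finset ℕ) (f : ℕ → ℕ → ℝ≥0∞) :
    (∑ k ∈ s, ∑ l ∈ t, f k l) ^ 2 ≤ s.card * t.card * ∑ k ∈ s, ∑ l ∈ t, f k l ^ 2 := by
  rw [← Finset.sum_product', ← Finset.sum_product' (f := fun k l => f k l ^ 2)]
  refine (sq_sum_le _ _).trans_eq ?_
  rw [Finset.card_product, Nat.cast_mul]

/-- The first scale that is beyond the block `[2 ^ a, 2 ^ (a + 1))`. -/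
def blockEnd (a : ℕ) : ℕ := 2 ^ (a + 1)

lemma blockEnd_mono {a b : ℕ} (h : a ≤ b) : blockEnd a ≤ blockEnd b :=
  Nat.pow_le_pow_right (by norm_num) (Nat.succ_le_succ h)

lemma cast_blockEnd (a : ℕ) : (blockEnd a : ℝ≥0∞) = 2 * 2 ^ a := by
  unfold blockEnd; push_cast; rw [pow_succ, mul_comm]

/-- `a` is the least first coordinate of a point of `S` with second coordinate `b`. -/
def IsFirstL (S : ℕ → ℕ → Prop) (a b : ℕ) : Prop := S a b ∧ ∀ a' < a, ¬ S a' b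

/-- `b` is the least second coordinate of a point of `S` with first coordinate `a`. -/
def IsFirstR (S : ℕ → ℕ → Prop) (a b : ℕ) : Prop := S a b ∧ ∀ b' < b, ¬ S a b'

lemma exists_isFirstL {S : ℕ → ℕ → Prop} {a b : ℕ} (h : S a b) : ∃ a' ≤ a, IsFirstL S a' b := by
  classical
  have hex : ∃ a', S a' b := ⟨a, h⟩
  exact ⟨Nat.find hex, Nat.find_min' hex h, Nat.find_spec hex, fun _ h' => Nat.find_min hex h'⟩

lemma exists_isFirstR {S : ℕ → ℕ → Prop} {a b : ℕ} (h : S a b) : ∃ b' ≤ b, IsFirstR S a b' := by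
  classical
  have hex : ∃ b', S a b' := ⟨b, h⟩
  exact ⟨Nat.find hex, Nat.find_min' hex h, Nat.find_spec hex, fun _ h' => Nat.find_min hex h'⟩

lemma IsFirstL.unique {S : ℕ → ℕ → Prop} {a a' b : ℕ} (h : IsFirstL S a b) (h' : IsFirstL S a' b) :
    a = a' := by
  rcases lt_trichotomy a a' with h1 | h1 | h1
  · exact absurd h.1 (h'.2 _ h1)
  · exact h1
  · exact absurd h'.1 (h.2 _ h1)

lemma IsFirstR.unique {S : ℕ → ℕ → Prop} {a b b' : ℕ} (h : IsFirstR S a b) (h' : IsFirstR S a b') :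
    b = b' := by
  rcases lt_trichotomy b b' with h1 | h1 | h1
  · exact absurd h.1 (h'.2 _ h1)
  · exact h1
  · exact absurd h'.1 (h.2 _ h1)

lemma four_term_sq_le (p₁ p₂ p₃ p₄ : ℝ≥0∞) :
    ((p₁ + p₂) + (p₃ + p₄)) ^ 2 ≤ 4 * (p₁ ^ 2 + p₂ ^ 2 + p₃ ^ 2 + p₄ ^ 2) := by
  calc ((p₁ + p₂) + (p₃ + p₄)) ^ 2 ≤ 2 * ((p₁ + p₂) ^ 2 + (p₃ + p₄) ^ 2) := add_sq_le_two _ _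
    _ ≤ 2 * (2 * (p₁ ^ 2 + p₂ ^ 2) + 2 * (p₃ ^ 2 + p₄ ^ 2)) := by
        gcongr <;> exact add_sq_le_two _ _
    _ = _ := by ring

lemma sum_range_split (f : ℕ → ℝ≥0∞) {m n : ℕ} (h : m ≤ n) :
    ∑ k ∈ Finset.range n, f k = ∑ k ∈ Finset.range m, f k + ∑ k ∈ Finset.Ico m n, f k :=
  (Finset.sum_range_add_sum_Ico f h).symm

lemma sum_Ico_le_tsum (f : ℕ → ℝ≥0∞) (m n : ℕ) :
    ∑ k ∈ Finset.Ico m n, f k ≤ ∑' k, iv (m ≤ k) (f k) := by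
  refine le_trans (Finset.sum_le_sum fun k hk => ?_) (ENNReal.sum_le_tsum (Finset.Ico m n))
  rw [iv_pos (Finset.mem_Ico.1 hk).1]

/-- Splitting a partial double sum at a point `(α, β)`. -/
lemma sq_double_sum_le (D : ℕ → ℕ → ℝ≥0∞) {A : ℝ≥0∞} (hD : ∀ k l, D k l ^ 2 ≤ A)
    {α β a b : ℕ} (hα : α ≤ a) (hβ : β ≤ b) :
    (∑ k ∈ Finset.range (blockEnd a), ∑ l ∈ Finset.range (blockEnd b), D k l) ^ 2 ≤
      4 * ((blockEnd α * blockEnd β) ^ 2 * A +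
        blockEnd α * blockEnd b *
          ∑ k ∈ Finset.range (blockEnd α), ∑' l, iv (blockEnd β ≤ l) (D k l ^ 2) +
        blockEnd a * blockEnd β *
          ∑ l ∈ Finset.range (blockEnd β), ∑' k, iv (blockEnd α ≤ k) (D k l ^ 2) +
        blockEnd a * blockEnd b *
          ∑' k, ∑' l, iv (blockEnd α ≤ k) (iv (blockEnd β ≤ l) (D k l ^ 2))) := by
  have hα' := blockEnd_mono hα
  have hβ' := blockEnd_mono hβ
  have e : ∑ k ∈ Finset.range (blockEnd a), ∑ l ∈ Finset.range (blockEnd b), D k l =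
      (∑ k ∈ Finset.range (blockEnd α), ∑ l ∈ Finset.range (blockEnd β), D k l +
        ∑ k ∈ Finset.range (blockEnd α), ∑ l ∈ Finset.Ico (blockEnd β) (blockEnd b), D k l) +
      (∑ k ∈ Finset.Ico (blockEnd α) (blockEnd a), ∑ l ∈ Finset.range (blockEnd β), D k l +
        ∑ k ∈ Finset.Ico (blockEnd α) (blockEnd a),
          ∑ l ∈ Finset.Ico (blockEnd β) (blockEnd b), D k l) := by
    rw [sum_range_split _ hα', ← Finset.sum_add_distrib, ← Finset.sum_add_distrib]
    congr 1 <;> exact Finset.sum_congr rfl fun k _ => sum_range_split _ hβ'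
  rw [e]
  -- All four pieces use Cauchy–Schwarz, which costs the lengths of the two ranges. In the near
  -- piece every term is then bounded by `A`; the other three keep their square sums.
  refine (four_term_sq_le _ _ _ _).trans ?_
  have hcard : ∀ m n : ℕ, (Finset.Ico m n).card ≤ n := fun m n => by
    rw [Nat.card_Ico]; exact Nat.sub_le _ _
  gcongr
  · refine (sq_sum_sum_le _ _ _).trans ?_
    rw [Finset.card_range, Finset.card_range, sq (_ * _), mul_assoc (_ * _)]
    refine mul_le_mul_right ?_ _
    calc _ ≤ ∑ k ∈ Finset.range (blockEnd α), ∑ l ∈ Finset.range (blockEnd β), A :=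
          Finset.sum_le_sum fun k _ => Finset.sum_le_sum fun l _ => hD k l
      _ = _ := by simp [mul_assoc]
  · refine (sq_sum_sum_le _ _ _).trans ?_
    rw [Finset.card_range]
    gcongr
    · exact hcard _ _
    · exact sum_Ico_le_tsum _ _ _
  · refine (sq_sum_sum_le _ _ _).trans ?_
    rw [Finset.card_range, Finset.sum_comm]
    gcongr
    · exact hcard _ _
    · exact sum_Ico_le_tsum (fun k => D k _ ^ 2) _ _
  · refine (sq_sum_sum_le _ _ _).trans ?_
    gcongr
    · exact hcard _ _
    · exact hcard _ _
    · refine (sum_Ico_le_tsum _ _ _).trans (ENNReal.tsum_le_tsum fun k => ?_)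
      refine iv_le_of fun h => ?_
      simp_rw [iv_pos h]
      exact sum_Ico_le_tsum _ _ _

/-- Either `β = 0`, or `c = β - 1` is outside `S` and its term equals the left side. This trades the
gap to the corner, which depends on the point, for a sum of indicators that can be integrated. -/
lemma half_pow_gap_le {S : ℕ → ℕ → Prop} {a β b : ℕ} (h : IsFirstR S a β) (hβ : β ≤ b) :
    half ^ (b - β) ≤ half ^ b + ∑' c, iv (c < b ∧ ¬ S a c) (half ^ (b - c - 1)) := by
  rcases Nat.eq_zero_or_pos β with rfl | hpos
  · simp
  · refine le_add_left (le_trans ?_ (ENNReal.le_tsum (β - 1)))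
    rw [iv_pos ⟨by omega, h.2 _ (by omega)⟩, show b - (β - 1) - 1 = b - β by omega]

/-- For `(a, b) ∈ S` of the form `(a, b)` with `a ≥ a₀`, the weighted squares of the partial sums
are controlled by the data at a corner of `S`. -/
lemma tsum_row_le (D : ℕ → ℕ → ℝ≥0∞) {A V : ℝ≥0∞} (hD : ∀ k l, D k l ^ 2 ≤ A)
    {S : ℕ → ℕ → Prop} (hS₂ : ∀ a a' b, a ≤ a' → S a b → S a' b)
    (hV : ∀ α β, S α β →
      ∑' k, ∑' l, iv (blockEnd α ≤ k) (iv (blockEnd β ≤ l) (D k l ^ 2)) ≤ V)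
    {a₀ b : ℕ} (h₀ : S a₀ b) :
    ∑' a, iv (a₀ ≤ a) (half ^ (2 * a) * half ^ (2 * b) *
      (∑ k ∈ Finset.range (blockEnd a), ∑ l ∈ Finset.range (blockEnd b), D k l) ^ 2) ≤
    128 * A * (half ^ b + ∑' c, iv (c < b ∧ ¬ S a₀ c) (half ^ (b - c - 1))) +
    32 * (half ^ b * ∑' β, iv (β ≤ b) (∑' α, iv (IsFirstL S α β) (half ^ α *
      ∑ k ∈ Finset.range (blockEnd α), ∑' l, iv (blockEnd β ≤ l) (D k l ^ 2)))) +
    32 * (∑' α, ∑' β, iv (β ≤ b) (half ^ (b - β) * iv (IsFirstR S α β) (half ^ α * half ^ β *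
      ∑ l ∈ Finset.range (blockEnd β), ∑' k, iv (blockEnd α ≤ k) (D k l ^ 2)))) +
    32 * (half ^ b * V) := by
  -- The corner: go down from `(a₀, b)` as far as `S` allows, then left.
  obtain ⟨β, hβb, hβ⟩ := exists_isFirstR h₀
  obtain ⟨α, hαa, hα⟩ := exists_isFirstL hβ.1
  -- Since `S` is stable under increasing the first coordinate and `α ≤ a₀`, a lower point of `S` in
  -- column `α` would give one in column `a₀`. So `(α, β)` is extremal in both directions.
  have hβ' : IsFirstR S α β := ⟨hα.1, fun b' hb' h => hβ.2 b' hb' (hS₂ _ _ _ hαa h)⟩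
  set V2 := ∑ k ∈ Finset.range (blockEnd α), ∑' l, iv (blockEnd β ≤ l) (D k l ^ 2) with hV2
  set V3 := ∑ l ∈ Finset.range (blockEnd β), ∑' k, iv (blockEnd α ≤ k) (D k l ^ 2) with hV3
  -- Each piece of the split decays geometrically in `a - a₀` because `α ≤ a₀ ≤ a`; hence the whole
  -- row costs only a factor `2`.
  have hrow : ∀ a, a₀ ≤ a → half ^ (2 * a) * half ^ (2 * b) *
      (∑ k ∈ Finset.range (blockEnd a), ∑ l ∈ Finset.range (blockEnd b), D k l) ^ 2 ≤
      half ^ (a - a₀) * (64 * A * half ^ (b - β) + 16 * (half ^ b * (half ^ α * V2)) +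
        16 * (half ^ (b - β) * (half ^ α * half ^ β * V3)) + 16 * (half ^ b * V)) := by
    intro a ha
    have key := sq_double_sum_le D hD (hαa.trans ha) hβb
    have c1 : ∀ {m n : ℕ}, m ≤ n → half ^ n * 2 ^ m = half ^ (n - m) := half_pow_mul_two_pow
    have hb2 : half ^ (2 * b) * 2 ^ b = half ^ b := by
      rw [c1 (by omega)]; congr 1; omega
    have ha2 : half ^ (2 * a) * 2 ^ a = half ^ a := by
      rw [c1 (by omega)]; congr 1; omega
    have t1 : half ^ (2 * a) * half ^ (2 * b) * ((blockEnd α * blockEnd β) ^ 2 * A) ≤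
        16 * (half ^ (a - a₀) * (half ^ (b - β) * A)) := by
      have h1 : half ^ (2 * a) * 2 ^ (2 * α) ≤ half ^ (a - a₀) := by
        rw [c1 (by omega)]; exact half_pow_anti (by omega)
      have h2 : half ^ (2 * b) * 2 ^ (2 * β) ≤ half ^ (b - β) := by
        rw [c1 (by omega)]; exact half_pow_anti (by omega)
      calc _ = 16 * ((half ^ (2 * a) * 2 ^ (2 * α)) * ((half ^ (2 * b) * 2 ^ (2 * β)) * A)) := by
            rw [cast_blockEnd, cast_blockEnd]; ring
        _ ≤ _ := by gcongr
    have t2 : half ^ (2 * a) * half ^ (2 * b) * (blockEnd α * blockEnd b * V2) ≤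
        4 * (half ^ (a - a₀) * (half ^ b * (half ^ α * V2))) := by
      have h1 : half ^ (2 * a) * 2 ^ α ≤ half ^ (a - a₀) * half ^ α := by
        rw [c1 (by omega), ← pow_add]; exact half_pow_anti (by omega)
      calc _ = 4 * ((half ^ (2 * a) * 2 ^ α) * ((half ^ (2 * b) * 2 ^ b) * V2)) := by
            rw [cast_blockEnd, cast_blockEnd]; ring
        _ ≤ 4 * ((half ^ (a - a₀) * half ^ α) * (half ^ b * V2)) := by rw [hb2]; gcongr
        _ = _ := by ring
    have t3 : half ^ (2 * a) * half ^ (2 * b) * (blockEnd a * blockEnd β * V3) ≤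
        4 * (half ^ (a - a₀) * (half ^ (b - β) * (half ^ α * half ^ β * V3))) := by
      have h1 : half ^ a ≤ half ^ (a - a₀) * half ^ α := by
        rw [← pow_add]; exact half_pow_anti (by omega)
      have h2 : half ^ (2 * b) * 2 ^ β ≤ half ^ (b - β) * half ^ β := by
        rw [c1 (by omega), ← pow_add]; exact half_pow_anti (by omega)
      calc _ = 4 * ((half ^ (2 * a) * 2 ^ a) * ((half ^ (2 * b) * 2 ^ β) * V3)) := by
            rw [cast_blockEnd, cast_blockEnd]; ring
        _ ≤ 4 * ((half ^ (a - a₀) * half ^ α) * ((half ^ (b - β) * half ^ β) * V3)) := by rw [ha2]; gcongr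
        _ = _ := by ring
    have t4 : half ^ (2 * a) * half ^ (2 * b) * (blockEnd a * blockEnd b *
        ∑' k, ∑' l, iv (blockEnd α ≤ k) (iv (blockEnd β ≤ l) (D k l ^ 2))) ≤
        4 * (half ^ (a - a₀) * (half ^ b * V)) := by
      calc _ ≤ half ^ (2 * a) * half ^ (2 * b) * (blockEnd a * blockEnd b * V) := by
            gcongr; exact hV _ _ hα.1
        _ = 4 * ((half ^ (2 * a) * 2 ^ a) * ((half ^ (2 * b) * 2 ^ b) * V)) := by
            rw [cast_blockEnd, cast_blockEnd]; ring
        _ ≤ 4 * (half ^ (a - a₀) * (half ^ b * V)) := by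
            rw [ha2, hb2]; gcongr 4 * (?_ * _); exact half_pow_anti (by omega)
    calc _ ≤ half ^ (2 * a) * half ^ (2 * b) * _ := mul_le_mul_right key _
      _ = 4 * (half ^ (2 * a) * half ^ (2 * b) * ((blockEnd α * blockEnd β) ^ 2 * A) +
          half ^ (2 * a) * half ^ (2 * b) * (blockEnd α * blockEnd b * V2) +
          half ^ (2 * a) * half ^ (2 * b) * (blockEnd a * blockEnd β * V3) +
          half ^ (2 * a) * half ^ (2 * b) * (blockEnd a * blockEnd b *
            ∑' k, ∑' l, iv (blockEnd α ≤ k) (iv (blockEnd β ≤ l) (D k l ^ 2)))) := by ring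
      _ ≤ 4 * (16 * (half ^ (a - a₀) * (half ^ (b - β) * A)) +
          4 * (half ^ (a - a₀) * (half ^ b * (half ^ α * V2))) +
          4 * (half ^ (a - a₀) * (half ^ (b - β) * (half ^ α * half ^ β * V3))) +
          4 * (half ^ (a - a₀) * (half ^ b * V))) := by gcongr
      _ = _ := by ring
  have hsum : ∑' a, iv (a₀ ≤ a) (half ^ (2 * a) * half ^ (2 * b) *
      (∑ k ∈ Finset.range (blockEnd a), ∑ l ∈ Finset.range (blockEnd b), D k l) ^ 2) ≤
      2 * (64 * A * half ^ (b - β) + 16 * (half ^ b * (half ^ α * V2)) +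
        16 * (half ^ (b - β) * (half ^ α * half ^ β * V3)) + 16 * (half ^ b * V)) := by
    rw [← tsum_half_pow_shift a₀, ← ENNReal.tsum_mul_right]
    refine ENNReal.tsum_le_tsum fun a => iv_le_of fun h => ?_
    rw [iv_pos h]
    exact hrow a h
  refine hsum.trans ?_
  -- The corner varies with the point, so its contribution is dominated by a sum over all possible
  -- corners, restricted by indicators.
  have s2 : half ^ α * V2 ≤ ∑' β, iv (β ≤ b) (∑' α, iv (IsFirstL S α β) (half ^ α *
      ∑ k ∈ Finset.range (blockEnd α), ∑' l, iv (blockEnd β ≤ l) (D k l ^ 2))) := by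
    refine le_trans ?_ (ENNReal.le_tsum β)
    rw [iv_pos hβb]
    refine le_trans ?_ (ENNReal.le_tsum α)
    rw [iv_pos hα]
  have s3 : half ^ (b - β) * (half ^ α * half ^ β * V3) ≤ ∑' α, ∑' β, iv (β ≤ b) (half ^ (b - β) *
      iv (IsFirstR S α β) (half ^ α * half ^ β *
      ∑ l ∈ Finset.range (blockEnd β), ∑' k, iv (blockEnd α ≤ k) (D k l ^ 2))) := by
    refine le_trans ?_ (ENNReal.le_tsum α)
    refine le_trans ?_ (ENNReal.le_tsum β)
    rw [iv_pos hβb, iv_pos hβ']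
  calc _ = 128 * A * half ^ (b - β) + 32 * (half ^ b * (half ^ α * V2)) +
        32 * (half ^ (b - β) * (half ^ α * half ^ β * V3)) + 32 * (half ^ b * V) := by ring
    _ ≤ _ := by gcongr; exact half_pow_gap_le hβ hβb

/-- The summation lemma for a set `B` of scales contained in an up-set `S`. -/
lemma tsum_upset_le (D : ℕ → ℕ → ℝ≥0∞) {A V : ℝ≥0∞} (hD : ∀ k l, D k l ^ 2 ≤ A)
    {B S : ℕ → ℕ → Prop} (hBS : ∀ a b, B a b → S a b)
    (hS : ∀ a a' b, a ≤ a' → S a b → S a' b)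
    (hV : ∀ α β, S α β →
      ∑' k, ∑' l, iv (blockEnd α ≤ k) (iv (blockEnd β ≤ l) (D k l ^ 2)) ≤ V) :
    ∑' b, ∑' a, iv (B a b) (half ^ (2 * a) * half ^ (2 * b) *
      (∑ k ∈ Finset.range (blockEnd a), ∑ l ∈ Finset.range (blockEnd b), D k l) ^ 2) ≤
    128 * A * (∑' b, ∑' a, iv (IsFirstL B a b)
      (half ^ b + ∑' c, iv (c < b ∧ ¬ S a c) (half ^ (b - c - 1)))) +
    32 * (∑' b, half ^ b * ∑' β, iv (β ≤ b) (∑' α, iv (IsFirstL S α β) (half ^ α *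
      ∑ k ∈ Finset.range (blockEnd α), ∑' l, iv (blockEnd β ≤ l) (D k l ^ 2)))) +
    64 * (∑' α, ∑' β, iv (IsFirstR S α β) (half ^ α * half ^ β *
      ∑ l ∈ Finset.range (blockEnd β), ∑' k, iv (blockEnd α ≤ k) (D k l ^ 2))) +
    64 * V := by
  set G3 : ℕ → ℕ → ℝ≥0∞ := fun α β => iv (IsFirstR S α β) (half ^ α * half ^ β *
      ∑ l ∈ Finset.range (blockEnd β), ∑' k, iv (blockEnd α ≤ k) (D k l ^ 2)) with hG3
  have hb : ∀ b, ∑' a, iv (B a b) (half ^ (2 * a) * half ^ (2 * b) *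
      (∑ k ∈ Finset.range (blockEnd a), ∑ l ∈ Finset.range (blockEnd b), D k l) ^ 2) ≤
    128 * A * (∑' a, iv (IsFirstL B a b)
      (half ^ b + ∑' c, iv (c < b ∧ ¬ S a c) (half ^ (b - c - 1)))) +
    32 * (half ^ b * ∑' β, iv (β ≤ b) (∑' α, iv (IsFirstL S α β) (half ^ α *
      ∑ k ∈ Finset.range (blockEnd α), ∑' l, iv (blockEnd β ≤ l) (D k l ^ 2)))) +
    32 * (∑' α, ∑' β, iv (β ≤ b) (half ^ (b - β) * G3 α β)) +
    32 * (half ^ b * V) := by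
    intro b
    by_cases hex : ∃ a, B a b
    · obtain ⟨a₁, h₁⟩ := hex
      -- The row of `B` starts at `a₀`, and that point lies in `S`, so the row estimate applies from
      -- there.
      obtain ⟨a₀, -, h₀⟩ := exists_isFirstL h₁
      refine le_trans (ENNReal.tsum_le_tsum fun a => ?_)
        ((tsum_row_le D hD hS hV (hBS _ _ h₀.1)).trans ?_)
      · refine iv_mono fun h => ⟨?_, le_rfl⟩
        by_contra hlt
        exact h₀.2 a (not_le.1 hlt) h
      · gcongr
        refine le_trans ?_ (ENNReal.le_tsum a₀)
        rw [iv_pos h₀]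
    · push Not at hex
      simp only [iv_neg (hex _), tsum_zero]
      exact zero_le
  refine (ENNReal.tsum_le_tsum hb).trans ?_
  rw [ENNReal.tsum_add, ENNReal.tsum_add, ENNReal.tsum_add, ENNReal.tsum_mul_left,
    ENNReal.tsum_mul_left, ENNReal.tsum_mul_left, ENNReal.tsum_mul_left, ENNReal.tsum_mul_right,
    tsum_half_pow]
  -- For a fixed corner the weights `half ^ (b - β)` over all rows `b ≥ β` add up to `2`.
  have h3 : ∑' b, ∑' α, ∑' β, iv (β ≤ b) (half ^ (b - β) * G3 α β) = 2 * ∑' α, ∑' β, G3 α β := by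
    rw [ENNReal.tsum_comm, ← ENNReal.tsum_mul_left]
    refine tsum_congr fun α => ?_
    rw [ENNReal.tsum_comm, ← ENNReal.tsum_mul_left]
    refine tsum_congr fun β => ?_
    rw [← tsum_half_pow_shift β, ← ENNReal.tsum_mul_right]
    exact tsum_congr fun b => by rw [mul_comm (iv (β ≤ b) _) (G3 α β), mul_iv (β ≤ b), mul_comm (G3 α β)]
  rw [h3]
  apply le_of_eq
  ring

/-- A monotone predicate has only boundedly many weighted jumps. -/
lemma tsum_jump_le {p : ℕ → Prop} (hp : ∀ m n, m ≤ n → p m → p n) :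
    ∑' b, ∑' c, iv (c < b ∧ p b ∧ ¬ p c) (half ^ (b - c - 1)) ≤ 4 := by
  classical
  by_cases hex : ∃ b, p b
  · set n₀ := Nat.find hex
    calc ∑' b, ∑' c, iv (c < b ∧ p b ∧ ¬ p c) (half ^ (b - c - 1))
        -- The predicate switches on once, at `n₀`, so `c < n₀ ≤ b` and the weight factors at `n₀`
        -- into two geometric weights.
        ≤ ∑' b, ∑' c, iv (n₀ ≤ b) (half ^ (b - n₀)) * iv (c < n₀) (half ^ (n₀ - c - 1)) := by
          refine ENNReal.tsum_le_tsum fun b => ENNReal.tsum_le_tsum fun c => iv_le_of ?_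
          rintro ⟨hcb, hb, hc⟩
          have h1 : n₀ ≤ b := Nat.find_min' hex hb
          have h2 : c < n₀ := by
            by_contra h
            exact hc (hp _ _ (not_lt.1 h) (Nat.find_spec hex))
          rw [iv_pos h1, iv_pos h2, ← pow_add]
          exact le_of_eq (by congr 1; omega)
      _ = 2 * ∑' c, iv (c < n₀) (half ^ (n₀ - c - 1)) := by
          simp_rw [ENNReal.tsum_mul_left, ENNReal.tsum_mul_right]
          rw [tsum_half_pow_shift]
      _ ≤ 2 * 2 := by gcongr; exact tsum_half_pow_below n₀
      _ = 4 := by norm_num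
  · push Not at hex
    have : ∀ b c, iv (c < b ∧ p b ∧ ¬ p c) (half ^ (b - c - 1)) = 0 := fun b c =>
      iv_neg (fun h => hex b h.2.1) _
    simp [this]

/-! ### Sets that are unions of dyadic rectangles of a fixed scale -/

lemma measurable_iv {X : Type*} [MeasurableSpace X] {P : X → Prop} {v : X → ℝ≥0∞}
    (hP : MeasurableSet {x | P x}) (hv : Measurable v) : Measurable fun x => iv (P x) (v x) :=
  Measurable.ite hP hv measurable_const

lemma lintegral_iv {X : Type*} [MeasurableSpace X] {μ : Measure X} {P : X → Prop}
    (hP : MeasurableSet {x | P x}) (v : X → ℝ≥0∞) :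
    ∫⁻ x, iv (P x) (v x) ∂μ = ∫⁻ x in {x | P x}, v x ∂μ := by
  rw [← lintegral_indicator hP]
  refine lintegral_congr fun x => ?_
  by_cases h : P x
  · rw [iv_pos h, indicator_of_mem (by exact h)]
  · rw [iv_neg h, indicator_of_notMem (by exact h)]

lemma lintegral_iv_const {X : Type*} [MeasurableSpace X] {μ : Measure X} {P : X → Prop}
    (hP : MeasurableSet {x | P x}) (v : ℝ≥0∞) :
    ∫⁻ x, iv (P x) v ∂μ = v * μ {x | P x} := by
  rw [lintegral_iv hP, setLIntegral_const]

/-- `U` is a union of dyadic rectangles of scale `k`. -/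
def Saturated (k : ℕ × ℕ) (U : Set Torus2) : Prop := ∀ x ∈ U, (rect k x).toSet ⊆ U

lemma Saturated.eq {k : ℕ × ℕ} {U : Set Torus2} (h : Saturated k U) :
    U = {x | (rect k x).toSet ⊆ U} :=
  Subset.antisymm h fun x hx => hx (mem_toSet_rect k x)

lemma measurableSet_rect_prop (k : ℕ × ℕ) (P : DyadicRect → Prop) :
    MeasurableSet {x | P (rect k x)} :=
  measurable_rect k (MeasurableSet.of_discrete (s := {R | P R}))

lemma measurable_comp_rect (k : ℕ × ℕ) (h : DyadicRect → ℝ≥0∞) :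
    Measurable fun x => h (rect k x) :=
  (Measurable.of_discrete (f := h)).comp (measurable_rect k)

lemma Saturated.measurableSet {k : ℕ × ℕ} {U : Set Torus2} (h : Saturated k U) :
    MeasurableSet U := by
  rw [h.eq]; exact measurableSet_rect_prop k fun R => R.toSet ⊆ U

lemma Saturated.setLIntegral_le {k : ℕ × ℕ} {U : Set Torus2} (hU : Saturated k U)
    (F G : Torus2 → ℝ≥0∞)
    (h : ∀ R : DyadicRect, R.scale = k → R.toSet ⊆ U →
      ∫⁻ x in R.toSet, F x ≤ ∫⁻ x in R.toSet, G x) :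
    ∫⁻ x in U, F x ≤ ∫⁻ x in U, G x := by
  rw [hU.eq]
  exact setLIntegral_le_of_rect k (fun R => R.toSet ⊆ U) F G h

/-! ### A dyadic weak type inequality -/

/-- The weak type `(1, 1)` inequality for the dyadic maximal function of an indicator function. -/
lemma volume_dyadic_enlargement_le {E : Set UnitAddCircle} (hE : MeasurableSet E) :
    volume {s | ∃ n, volume (idx n s).toSet ≤ 2 * volume (E ∩ (idx n s).toSet)} ≤ 2 * volume E := by
  classical
  set P : DyadicInterval → Prop := fun I => volume I.toSet ≤ 2 * volume (E ∩ I.toSet) with hP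
  -- A stopping time: `M n` consists of the points for which `n` is the first scale where `E` has
  -- density at least one half. These sets are disjoint, and `M n` is a union of intervals of length
  -- `2 ^ (-n)`.
  set M : ℕ → Set UnitAddCircle := fun n => {s | P (idx n s) ∧ ∀ m < n, ¬ P (idx m s)} with hM
  have hMeas : ∀ n, MeasurableSet (M n) := by
    intro n
    have hp : ∀ m, MeasurableSet {s | P (idx m s)} := fun m =>
      measurable_idx m (MeasurableSet.of_discrete (s := {I | P I}))
    refine (hp n).inter ?_
    have : {s | ∀ m < n, ¬ P (idx m s)} = ⋂ m, ⋂ (_ : m < n), {s | P (idx m s)}ᶜ := by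
      ext s; simp
    change MeasurableSet {s | ∀ m < n, ¬ P (idx m s)}
    rw [this]
    exact MeasurableSet.iInter fun m => MeasurableSet.iInter fun _ => (hp m).compl
  have hdisj : Pairwise (Function.onFun Disjoint M) := by
    intro m n hmn
    rw [Function.onFun, Set.disjoint_left]
    rintro s ⟨h1, h2⟩ ⟨h3, h4⟩
    rcases lt_or_gt_of_ne hmn with h | h
    · exact h4 m h h1
    · exact h2 n h h3
  have hn : ∀ n, volume (M n) ≤ 2 * volume (E ∩ M n) := by
    intro n
    have hsat : M n = {s | (idx n s).toSet ⊆ M n} := by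
      refine Subset.antisymm (fun s hs t ht => ?_) fun s hs => hs (mem_toSet_idx n s)
      rw [mem_toSet_idx_iff] at ht
      refine ⟨by rw [ht]; exact hs.1, fun m hm => ?_⟩
      rw [idx_eq_of_le hm.le ht]
      exact hs.2 m hm
    have key := setLIntegral_le_of_fiber (μ := volume) (measurable_idx n)
      (fun I => I.toSet ⊆ M n) (fun _ => 1) (E.indicator fun _ => 2) (fun I hI => by
        by_cases hk : I.1 = n
        · subst hk
          have e : idx I.1 ⁻¹' {I} = I.toSet := by ext s; exact mem_toSet_iff.symm
          rw [e, setLIntegral_one, setLIntegral_indicator hE, setLIntegral_const]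
          obtain ⟨s, hs⟩ := interval_nonempty I
          have := (hI hs).1
          rwa [mem_toSet_iff.1 hs] at this
        · have e : idx n ⁻¹' {I} = ∅ := by
            ext s
            simp only [mem_preimage, mem_singleton_iff, mem_empty_iff_false, iff_false]
            rintro rfl
            exact hk rfl
          rw [e]; simp)
    rw [← hsat, setLIntegral_one, setLIntegral_indicator hE, setLIntegral_const] at key
    exact key
  have hsub : {s | ∃ n, P (idx n s)} ⊆ ⋃ n, M n := by
    rintro s hs
    exact mem_iUnion.2 ⟨Nat.find hs, Nat.find_spec hs, fun m hm => Nat.find_min hs hm⟩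
  calc volume {s | ∃ n, P (idx n s)} ≤ volume (⋃ n, M n) := measure_mono hsub
    _ ≤ ∑' n, volume (M n) := measure_iUnion_le _
    _ ≤ ∑' n, 2 * volume (E ∩ M n) := ENNReal.tsum_le_tsum hn
    _ = 2 * volume (⋃ n, E ∩ M n) := by
        rw [ENNReal.tsum_mul_left, measure_iUnion
          (hdisj.mono fun m n h => h.mono inter_subset_right inter_subset_right)
          fun n => hE.inter (hMeas n)]
    _ ≤ 2 * volume E := by gcongr; exact iUnion_subset fun n => inter_subset_left

/-- The union of the dyadic intervals `I` with `I × K ⊆ Ω`. -/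
def slab (Ω : Set Torus2) (K : DyadicInterval) : Set UnitAddCircle :=
  {s | ∃ n, (idx n s).toSet ×ˢ K.toSet ⊆ Ω}

/-- The enlargement of `Ω` in the first variable. -/
def enlarge (Ω : Set Torus2) : Set Torus2 :=
  ⋃ R ∈ {R : DyadicRect | volume R.1.toSet ≤ 2 * volume (slab Ω R.2 ∩ R.1.toSet)}, R.toSet

lemma measurableSet_enlarge (Ω : Set Torus2) : MeasurableSet (enlarge Ω) :=
  MeasurableSet.biUnion (to_countable _) fun R _ => measurableSet_rect R

lemma toSet_subset_enlarge {Ω : Set Torus2} {R : DyadicRect}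
    (h : volume R.1.toSet ≤ 2 * volume (slab Ω R.2 ∩ R.1.toSet)) : R.toSet ⊆ enlarge Ω :=
  subset_biUnion_of_mem (u := fun R : DyadicRect => R.toSet) h

lemma subset_slab {Ω : Set Torus2} {R : DyadicRect} (h : R.toSet ⊆ Ω) : R.1.toSet ⊆ slab Ω R.2 :=
  fun s hs => ⟨R.1.1, by rw [mem_toSet_iff.1 hs]; exact h⟩

lemma subset_enlarge_of_subset {Ω : Set Torus2} {R : DyadicRect} (h : R.toSet ⊆ Ω) :
    R.toSet ⊆ enlarge Ω := by
  refine toSet_subset_enlarge ?_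
  rw [inter_eq_right.2 (subset_slab h), two_mul]
  exact le_add_self

/-- For fixed `t` and `K ∋ t`, the slab over `K` lies in the slice of `Ω` at height `t`. Hence the
slice of the enlargement lies in a superlevel set of the one-dimensional dyadic maximal function,
and Fubini applies. -/
lemma volume_enlarge_le {Ω : Set Torus2} (hΩ : MeasurableSet Ω) :
    volume (enlarge Ω) ≤ 2 * volume Ω := by
  have hslice : ∀ t, MeasurableSet ((fun s : UnitAddCircle => (s, t)) ⁻¹' Ω) := fun t =>
    measurable_prodMk_right hΩ
  rw [show (volume : Measure Torus2) = volume.prod volume from rfl,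
    Measure.prod_apply_symm (measurableSet_enlarge Ω), Measure.prod_apply_symm hΩ,
    ← lintegral_const_mul _ (measurable_measure_prodMk_right hΩ)]
  refine lintegral_mono fun t => ?_
  refine le_trans (measure_mono ?_) (volume_dyadic_enlargement_le (hslice t))
  intro s hs
  simp only [enlarge, mem_preimage, mem_iUnion, mem_ofPred_eq] at hs
  obtain ⟨R, hR, hs⟩ := hs
  obtain ⟨h1, h2⟩ : s ∈ R.1.toSet ∧ t ∈ R.2.toSet := hs
  refine ⟨R.1.1, ?_⟩
  rw [mem_toSet_iff.1 h1]
  refine hR.trans ?_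
  gcongr
  rintro u ⟨n, hn⟩
  exact hn ⟨mem_toSet_idx n u, h2⟩

/-! ### Admissible blocks of scales -/

/-- The dyadic rectangle around `x` at the end of the block `(a, b)` of scales is contained
in `Ω`. -/
def Inside (Ω : Set Torus2) (x : Torus2) (a b : ℕ) : Prop :=
  (rect (blockEnd a, blockEnd b) x).toSet ⊆ Ω

lemma Inside.mono {Ω : Set Torus2} {x : Torus2} {a a' b b' : ℕ} (ha : a ≤ a') (hb : b ≤ b')
    (h : Inside Ω x a b) : Inside Ω x a' b' :=
  (toSet_rect_subset (Prod.mk_le_mk.2 ⟨blockEnd_mono ha, blockEnd_mono hb⟩) x).trans h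

lemma Inside.mem {Ω : Set Torus2} {x : Torus2} {a b : ℕ} (h : Inside Ω x a b) : x ∈ Ω :=
  h (mem_toSet_rect _ x)

lemma inside_congr (Ω : Set Torus2) {x y : Torus2} {a a' b b' : ℕ} (ha : a' ≤ a) (hb : b' ≤ b)
    (h : y ∈ (rect (blockEnd a, blockEnd b) x).toSet) : Inside Ω y a' b' ↔ Inside Ω x a' b' := by
  unfold Inside
  rw [rect_eq_of_le (Prod.mk_le_mk.2 ⟨blockEnd_mono ha, blockEnd_mono hb⟩)
    (mem_toSet_rect_iff.1 h)]

lemma measurableSet_inside (Ω : Set Torus2) (a b : ℕ) : MeasurableSet {x | Inside Ω x a b} :=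
  measurableSet_rect_prop _ fun R => R.toSet ⊆ Ω

lemma saturated_isFirstL (Ω : Set Torus2) (a b : ℕ) :
    Saturated (blockEnd a, blockEnd b) {x | IsFirstL (Inside Ω x) a b} := by
  intro x hx y hy
  refine ⟨(inside_congr Ω le_rfl le_rfl hy).2 hx.1, fun a' ha' => ?_⟩
  rw [inside_congr Ω ha'.le le_rfl hy]
  exact hx.2 a' ha'

lemma saturated_isFirstR (Ω : Set Torus2) (a b : ℕ) :
    Saturated (blockEnd a, blockEnd b) {x | IsFirstR (Inside Ω x) a b} := by
  intro x hx y hy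
  refine ⟨(inside_congr Ω le_rfl le_rfl hy).2 hx.1, fun b' hb' => ?_⟩
  rw [inside_congr Ω le_rfl hb'.le hy]
  exact hx.2 b' hb'

lemma measurableSet_exists_inside (Ω : Set Torus2) (b : ℕ) :
    MeasurableSet {x | ∃ a, Inside Ω x a b} := by
  rw [ofPred_exists]
  exact MeasurableSet.iUnion fun a => measurableSet_inside Ω a b

/-- A row has at most one first point, so the events are mutually exclusive. -/
lemma tsum_iv_isFirstL_le (S : ℕ → ℕ → Prop) (b : ℕ) (v : ℝ≥0∞) :
    ∑' a, iv (IsFirstL S a b) v ≤ iv (∃ a, S a b) v := by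
  by_cases h : ∃ a, IsFirstL S a b
  · obtain ⟨a, ha⟩ := h
    rw [tsum_eq_single a fun a' ha' => iv_neg (fun h' => ha' (h'.unique ha)) _, iv_pos ha,
      iv_pos ⟨a, ha.1⟩]
  · push Not at h
    simp [iv_neg (h _)]

lemma tsum_iv_isFirstR_le (S : ℕ → ℕ → Prop) (a : ℕ) (v : ℝ≥0∞) :
    ∑' b, iv (IsFirstR S a b) v ≤ iv (∃ b, S a b) v := by
  by_cases h : ∃ b, IsFirstR S a b
  · obtain ⟨b, hb⟩ := h
    rw [tsum_eq_single b fun b' hb' => iv_neg (fun h' => hb' (h'.unique hb)) _, iv_pos hb,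
      iv_pos ⟨b, hb.1⟩]
  · push Not at h
    simp [iv_neg (h _)]

/-- A Journé type estimate. -/
lemma volume_isFirstL_diff_le (Ω : Set Torus2) {a b c : ℕ} (hc : c < b) :
    volume {x | IsFirstL (Inside Ω x) a b ∧ ¬ Inside (enlarge Ω) x a c} ≤
      2 * volume {x | IsFirstL (Inside Ω x) a b ∧ ¬ ∃ a', Inside Ω x a' c} := by
  set Z := {x | IsFirstL (Inside Ω x) a b ∧ ¬ Inside (enlarge Ω) x a c} with hZ
  set T := {x | ∃ a', Inside Ω x a' c} with hT
  have hTm : MeasurableSet T := measurableSet_exists_inside Ω c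
  have hsat : Saturated (blockEnd a, blockEnd b) Z := by
    intro x hx y hy
    refine ⟨saturated_isFirstL Ω a b x hx.1 hy, ?_⟩
    rw [inside_congr _ le_rfl hc.le hy]
    exact hx.2
  -- `Z` is a union of rectangles of scale `(blockEnd a, blockEnd b)`, so it suffices to show that
  -- in each of them at least half of the measure lies outside `T`.
  have key := hsat.setLIntegral_le (fun _ => 1) (Tᶜ.indicator fun _ => 2) (fun R hR hRZ => by
    rw [setLIntegral_one, setLIntegral_indicator hTm.compl, setLIntegral_const]
    obtain ⟨x, hx⟩ := rect_nonempty R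
    obtain ⟨-, hxZ⟩ := hRZ hx
    have hxI := mem_toSet_iff.1 hx.1
    set K := idx (blockEnd c) x.2
    have hRa : R.1.1 = blockEnd a := congrArg Prod.fst hR
    have hRb : R.2.1 = blockEnd b := congrArg Prod.snd hR
    -- If the slab filled more than half of `R.1`, then `R.1 × K` would be contained in the
    -- enlargement, contrary to the choice of `Z`.
    have hlt : 2 * volume (slab Ω K ∩ R.1.toSet) ≤ volume R.1.toSet := by
      by_contra hcon
      apply hxZ
      have := toSet_subset_enlarge (Ω := Ω) (R := (R.1, K)) (not_le.1 hcon).le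
      have e : rect (blockEnd a, blockEnd c) x = (R.1, K) := by
        simp only [rect, ← hRa, hxI]; rfl
      unfold Inside
      rwa [e]
    -- On `R` the second coordinate always lies in `K`, so membership in `T` puts the first
    -- coordinate into the slab over `K`.
    have hsub : R.toSet ∩ T ⊆ (slab Ω K ∩ R.1.toSet) ×ˢ R.2.toSet := by
      rintro y ⟨hy, a', ha'⟩
      refine ⟨⟨⟨blockEnd a', ?_⟩, hy.1⟩, hy.2⟩
      have : idx (blockEnd c) y.2 = K := by
        refine idx_eq_of_le (blockEnd_mono hc.le) ?_
        rw [← hRb, mem_toSet_iff.1 hy.2, mem_toSet_iff.1 hx.2]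
      rw [← this]
      exact ha'
    have h2 : 2 * volume (R.toSet ∩ T) ≤ volume R.toSet := by
      calc 2 * volume (R.toSet ∩ T)
          ≤ 2 * (volume (slab Ω K ∩ R.1.toSet) * volume R.2.toSet) := by
            gcongr; exact (measure_mono hsub).trans_eq (Measure.prod_prod _ _)
        _ = (2 * volume (slab Ω K ∩ R.1.toSet)) * volume R.2.toSet := by ring
        _ ≤ volume R.1.toSet * volume R.2.toSet := by gcongr
        _ = volume R.toSet := (volume_rect' R).symm
    have h3 : volume R.toSet + volume R.toSet ≤ volume R.toSet + 2 * volume (Tᶜ ∩ R.toSet) := by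
      calc volume R.toSet + volume R.toSet = 2 * volume R.toSet := (two_mul _).symm
        _ = 2 * volume (R.toSet ∩ T) + 2 * volume (Tᶜ ∩ R.toSet) := by
            rw [← mul_add, inter_comm Tᶜ, ← sdiff_eq, measure_inter_add_sdiff _ hTm]
        _ ≤ _ := by gcongr
    exact (ENNReal.add_le_add_iff_left (volume_rect_ne_top R)).1 h3)
  rw [setLIntegral_one, setLIntegral_indicator hTm.compl, setLIntegral_const] at key
  refine key.trans ?_
  gcongr
  rintro x ⟨hx1, hx2⟩
  exact ⟨hx2.1, hx1⟩

lemma measurableSet_isFirstL (Ω : Set Torus2) (a b : ℕ) :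
    MeasurableSet {x | IsFirstL (Inside Ω x) a b} := (saturated_isFirstL Ω a b).measurableSet

lemma measurableSet_isFirstR (Ω : Set Torus2) (a b : ℕ) :
    MeasurableSet {x | IsFirstR (Inside Ω x) a b} := (saturated_isFirstR Ω a b).measurableSet

/-- The weighted count of admissible blocks of scales. -/
lemma lintegral_block_count_le {Ω : Set Torus2} (hΩ : MeasurableSet Ω) :
    ∫⁻ x, ∑' b, ∑' a, iv (IsFirstL (Inside Ω x) a b)
      (half ^ b + ∑' c, iv (c < b ∧ ¬ Inside (enlarge Ω) x a c) (half ^ (b - c - 1))) ≤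
      10 * volume Ω := by
  have hm2 : ∀ a b c, MeasurableSet
      {x | IsFirstL (Inside Ω x) a b ∧ ¬ Inside (enlarge Ω) x a c} := fun a b c =>
    (measurableSet_isFirstL Ω a b).inter (measurableSet_inside _ a c).compl
  have hm3 : ∀ a b c, MeasurableSet
      {x | IsFirstL (Inside Ω x) a b ∧ ¬ ∃ a', Inside Ω x a' c} := fun a b c =>
    (measurableSet_isFirstL Ω a b).inter (measurableSet_exists_inside _ c).compl
  have hsplit : ∀ x, ∑' b, ∑' a, iv (IsFirstL (Inside Ω x) a b)
      (half ^ b + ∑' c, iv (c < b ∧ ¬ Inside (enlarge Ω) x a c) (half ^ (b - c - 1))) =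
      ∑' b, ∑' a, iv (IsFirstL (Inside Ω x) a b) (half ^ b) +
      ∑' b, ∑' a, ∑' c, iv (IsFirstL (Inside Ω x) a b ∧ ¬ Inside (enlarge Ω) x a c)
        (iv (c < b) (half ^ (b - c - 1))) := by
    intro x
    rw [← ENNReal.tsum_add]
    refine tsum_congr fun b => ?_
    rw [← ENNReal.tsum_add]
    refine tsum_congr fun a => ?_
    by_cases h : IsFirstL (Inside Ω x) a b
    · rw [iv_pos h, iv_pos h]
      congr 1
      refine tsum_congr fun c => ?_
      rw [iv_iv, ← and_comm]
      congr 1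
      simp [h]
    · rw [iv_neg h, iv_neg h]
      simp [iv_neg (fun h' : IsFirstL (Inside Ω x) a b ∧ _ => h h'.1)]
  simp_rw [hsplit]
  rw [lintegral_add_left]
  swap
  · exact Measurable.tsum fun b => Measurable.tsum fun a =>
      measurable_iv (measurableSet_isFirstL Ω a b) measurable_const
  have first : ∫⁻ x, ∑' b, ∑' a, iv (IsFirstL (Inside Ω x) a b) (half ^ b) ≤ 2 * volume Ω := by
    calc _ ≤ ∫⁻ x, iv (x ∈ Ω) 2 := by
          refine lintegral_mono fun x => ?_
          by_cases hx : x ∈ Ω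
          · rw [iv_pos hx, ← tsum_half_pow]
            exact ENNReal.tsum_le_tsum fun b => (tsum_iv_isFirstL_le _ _ _).trans (iv_le _ _)
          · have : ∀ a b, ¬ IsFirstL (Inside Ω x) a b := fun a b h => hx h.1.mem
            simp [iv_neg (this _ _)]
      _ = 2 * volume Ω := lintegral_iv_const hΩ 2
  have second : ∫⁻ x, ∑' b, ∑' a, ∑' c,
      iv (IsFirstL (Inside Ω x) a b ∧ ¬ Inside (enlarge Ω) x a c)
        (iv (c < b) (half ^ (b - c - 1))) ≤ 8 * volume Ω := by
    calc _ = ∑' b, ∑' a, ∑' c, iv (c < b) (half ^ (b - c - 1)) *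
          volume {x | IsFirstL (Inside Ω x) a b ∧ ¬ Inside (enlarge Ω) x a c} := by
          rw [lintegral_tsum fun b => (Measurable.tsum fun a => Measurable.tsum
            fun c => measurable_iv (hm2 a b c) measurable_const).aemeasurable]
          refine tsum_congr fun b => ?_
          rw [lintegral_tsum fun a => (Measurable.tsum
            fun c => measurable_iv (hm2 a b c) measurable_const).aemeasurable]
          refine tsum_congr fun a => ?_
          rw [lintegral_tsum fun c => (measurable_iv (hm2 a b c) measurable_const).aemeasurable]
          exact tsum_congr fun c => lintegral_iv_const (hm2 a b c) _
      -- After the Journé type estimate the condition on `c` no longer involves `a`. Summing over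
      -- the exclusive first points then leaves the jumps of the monotone predicate "row `b` is
      -- nonempty".
      _ ≤ ∑' b, ∑' a, ∑' c, (2 * iv (c < b) (half ^ (b - c - 1))) *
          volume {x | IsFirstL (Inside Ω x) a b ∧ ¬ ∃ a', Inside Ω x a' c} := by
          refine ENNReal.tsum_le_tsum fun b => ENNReal.tsum_le_tsum fun a =>
            ENNReal.tsum_le_tsum fun c => ?_
          by_cases h : c < b
          · rw [iv_pos h, mul_comm 2, mul_assoc]
            gcongr
            exact volume_isFirstL_diff_le Ω h
          · rw [iv_neg h, zero_mul]; exact zero_le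
      _ = ∫⁻ x, ∑' b, ∑' c, ∑' a, iv (IsFirstL (Inside Ω x) a b ∧ ¬ ∃ a', Inside Ω x a' c)
          (2 * iv (c < b) (half ^ (b - c - 1))) := by
          rw [lintegral_tsum fun b => (Measurable.tsum fun c => Measurable.tsum
            fun a => measurable_iv (hm3 a b c) measurable_const).aemeasurable]
          refine tsum_congr fun b => ?_
          rw [ENNReal.tsum_comm, lintegral_tsum fun c => (Measurable.tsum
            fun a => measurable_iv (hm3 a b c) measurable_const).aemeasurable]
          refine tsum_congr fun c => ?_
          rw [lintegral_tsum fun a => (measurable_iv (hm3 a b c) measurable_const).aemeasurable]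
          exact tsum_congr fun a => (lintegral_iv_const (hm3 a b c) _).symm
      _ ≤ ∫⁻ x, iv (x ∈ Ω) 8 := by
          refine lintegral_mono fun x => ?_
          by_cases hx : x ∈ Ω
          · rw [iv_pos hx]
            have hp : ∀ m n, m ≤ n → (∃ a, Inside Ω x a m) → ∃ a, Inside Ω x a n :=
              fun m n hmn ⟨a, ha⟩ => ⟨a, ha.mono le_rfl hmn⟩
            calc _ ≤ ∑' b, ∑' c, 2 * iv (c < b ∧ (∃ a, Inside Ω x a b) ∧ ¬ ∃ a, Inside Ω x a c)
                  (half ^ (b - c - 1)) := by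
                  refine ENNReal.tsum_le_tsum fun b => ENNReal.tsum_le_tsum fun c => ?_
                  by_cases h : c < b ∧ ¬ ∃ a, Inside Ω x a c
                  · refine le_trans ?_ ((tsum_iv_isFirstL_le (Inside Ω x) b
                      (2 * iv (c < b) (half ^ (b - c - 1)))).trans ?_)
                    · exact ENNReal.tsum_le_tsum fun a => iv_mono fun h' => ⟨h'.1, le_rfl⟩
                    · refine iv_le_of fun h' => ?_
                      rw [iv_pos h.1, iv_pos ⟨h.1, h', h.2⟩]
                  · have : ∀ a, iv (IsFirstL (Inside Ω x) a b ∧ ¬ ∃ a', Inside Ω x a' c)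
                        (2 * iv (c < b) (half ^ (b - c - 1))) = 0 := by
                      intro a
                      by_cases h' : c < b
                      · exact iv_neg (fun h'' => h ⟨h', h''.2⟩) _
                      · rw [iv_neg h', mul_zero]
                        exact le_antisymm (iv_le _ _) zero_le
                    simp only [this, tsum_zero]
                    exact zero_le
              _ ≤ 2 * 4 := by
                  simp_rw [ENNReal.tsum_mul_left]
                  gcongr
                  exact tsum_jump_le hp
              _ = 8 := by norm_num
          · have : ∀ a b, ¬ IsFirstL (Inside Ω x) a b := fun a b h => hx h.1.mem
            have h0 : ∀ a b c, iv (IsFirstL (Inside Ω x) a b ∧ ¬ ∃ a', Inside Ω x a' c)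
                (2 * iv (c < b) (half ^ (b - c - 1))) = 0 := fun a b c =>
              iv_neg (fun h => this a b h.1) _
            simp only [h0, tsum_zero]
            exact zero_le
      _ = 8 * volume Ω := lintegral_iv_const hΩ 8
  calc _ ≤ 2 * volume Ω + 8 * volume Ω := add_le_add first second
    _ = _ := by ring

/-! ### Carleson sequences -/

/-- `∑_{R ⊆ E} |R| g_R² ≤ A |E|` for all sets `E`. -/
def IsCarleson (g : DyadicRect → ℝ≥0∞) (A : ℝ≥0∞) : Prop :=
  ∀ E : Set Torus2, ∑' R : DyadicRect, iv (R.toSet ⊆ E) (volume R.toSet * g R ^ 2) ≤ A * volume E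

/-- Test the Carleson condition on the single rectangle `R` and cancel its measure. -/
lemma IsCarleson.sq_le {g : DyadicRect → ℝ≥0∞} {A : ℝ≥0∞} (hg : IsCarleson g A) (R : DyadicRect) :
    g R ^ 2 ≤ A := by
  have h := (ENNReal.le_tsum R).trans (hg R.toSet)
  rw [iv_pos subset_rfl, mul_comm] at h
  exact (ENNReal.mul_le_mul_iff_left (volume_rect_ne_zero R) (volume_rect_ne_top R)).1 h

lemma IsCarleson.lintegral_le {g : DyadicRect → ℝ≥0∞} {A : ℝ≥0∞} (hg : IsCarleson g A)
    (E : Set Torus2) :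
    ∫⁻ x, ∑' k, iv ((rect k x).toSet ⊆ E) (g (rect k x) ^ 2) ≤ A * volume E := by
  rw [lintegral_tsum_rect (fun R => iv (R.toSet ⊆ E) (g R ^ 2))]
  simp_rw [mul_iv]
  exact hg E

lemma setLIntegral_prod_comp_snd (I J : DyadicInterval) {H : UnitAddCircle → ℝ≥0∞}
    (hH : Measurable H) :
    ∫⁻ x : Torus2 in I.toSet ×ˢ J.toSet, H x.2 = volume I.toSet * ∫⁻ t in J.toSet, H t := by
  rw [show (volume : Measure Torus2) = volume.prod volume from rfl, ← Measure.prod_restrict]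
  have := lintegral_prod_mul (μ := volume.restrict I.toSet) (ν := volume.restrict J.toSet)
    (f := fun _ => (1 : ℝ≥0∞)) (g := H) aemeasurable_const hH.aemeasurable
  simpa using this

lemma setLIntegral_prod_comp_fst (I J : DyadicInterval) {H : UnitAddCircle → ℝ≥0∞}
    (hH : Measurable H) :
    ∫⁻ x : Torus2 in I.toSet ×ˢ J.toSet, H x.1 = volume J.toSet * ∫⁻ s in I.toSet, H s := by
  rw [show (volume : Measure Torus2) = volume.prod volume from rfl, ← Measure.prod_restrict]
  have := lintegral_prod_mul (μ := volume.restrict I.toSet) (ν := volume.restrict J.toSet)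
    (f := H) (g := fun _ => (1 : ℝ≥0∞)) hH.aemeasurable aemeasurable_const
  simpa [mul_comm] using this

lemma measurable_comp_idx (k : ℕ) (h : DyadicInterval → ℝ≥0∞) : Measurable fun t => h (idx k t) :=
  (Measurable.of_discrete (f := h)).comp (measurable_idx k)

/-- For a fixed first side `I` the sequence is a one-parameter Carleson sequence: test on the
rectangle `I × J`, keep only the subrectangles with first side `I`, and cancel `|I|`. -/
lemma IsCarleson.setLIntegral_snd_le {g : DyadicRect → ℝ≥0∞} {A : ℝ≥0∞} (hg : IsCarleson g A)
    (I J : DyadicInterval) :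
    ∫⁻ t in J.toSet, ∑' m, iv (J.1 ≤ m) (g (I, idx m t) ^ 2) ≤ A * volume J.toSet := by
  have hm : Measurable fun t => ∑' m, iv (J.1 ≤ m) (g (I, idx m t) ^ 2) :=
    Measurable.tsum fun m => measurable_iv (MeasurableSet.const _)
      (measurable_comp_idx m fun J' => g (I, J') ^ 2)
  have h1 := setLIntegral_prod_comp_snd I J hm
  have h2 : ∫⁻ x : Torus2 in I.toSet ×ˢ J.toSet, ∑' m, iv (J.1 ≤ m) (g (I, idx m x.2) ^ 2) ≤
      A * volume (DyadicRect.toSet (I, J)) := by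
    refine le_trans ?_ (hg.lintegral_le (DyadicRect.toSet (I, J)))
    refine (setLIntegral_mono' (measurableSet_rect (I, J)) fun x hx => ?_).trans
      (setLIntegral_le_lintegral _ _)
    have hinj : Function.Injective fun m : ℕ => ((I.1, m) : ℕ × ℕ) := fun _ _ h =>
      (Prod.mk.inj h).2
    refine le_trans (ENNReal.tsum_le_tsum fun m => ?_) (ENNReal.tsum_comp_le_tsum_of_injective hinj
      fun k => iv ((rect k x).toSet ⊆ DyadicRect.toSet (I, J)) (g (rect k x) ^ 2))
    refine iv_mono fun h => ?_
    have e : rect (I.1, m) x = (I, idx m x.2) := by simp only [rect, mem_toSet_iff.1 hx.1]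
    refine ⟨?_, by rw [e]⟩
    refine (toSet_rect_subset (k := (I.1, J.1)) (Prod.mk_le_mk.2 ⟨le_rfl, h⟩) x).trans ?_
    exact Eq.subset (congrArg DyadicRect.toSet (mem_rect_iff.1 hx))
  rw [h1, volume_rect', ← mul_assoc, mul_comm A, mul_assoc] at h2
  exact (ENNReal.mul_le_mul_iff_right (volume_interval_ne_zero I) (volume_interval_ne_top I)).1 h2

lemma IsCarleson.setLIntegral_fst_le {g : DyadicRect → ℝ≥0∞} {A : ℝ≥0∞} (hg : IsCarleson g A)
    (I J : DyadicInterval) :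
    ∫⁻ s in I.toSet, ∑' m, iv (I.1 ≤ m) (g (idx m s, J) ^ 2) ≤ A * volume I.toSet := by
  have hm : Measurable fun s => ∑' m, iv (I.1 ≤ m) (g (idx m s, J) ^ 2) :=
    Measurable.tsum fun m => measurable_iv (MeasurableSet.const _)
      (measurable_comp_idx m fun I' => g (I', J) ^ 2)
  have h1 := setLIntegral_prod_comp_fst I J hm
  have h2 : ∫⁻ x : Torus2 in I.toSet ×ˢ J.toSet, ∑' m, iv (I.1 ≤ m) (g (idx m x.1, J) ^ 2) ≤
      A * volume (DyadicRect.toSet (I, J)) := by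
    refine le_trans ?_ (hg.lintegral_le (DyadicRect.toSet (I, J)))
    refine (setLIntegral_mono' (measurableSet_rect (I, J)) fun x hx => ?_).trans
      (setLIntegral_le_lintegral _ _)
    have hinj : Function.Injective fun m : ℕ => ((m, J.1) : ℕ × ℕ) := fun _ _ h =>
      (Prod.mk.inj h).1
    refine le_trans (ENNReal.tsum_le_tsum fun m => ?_) (ENNReal.tsum_comp_le_tsum_of_injective hinj
      fun k => iv ((rect k x).toSet ⊆ DyadicRect.toSet (I, J)) (g (rect k x) ^ 2))
    refine iv_mono fun h => ?_
    have e : rect (m, J.1) x = (idx m x.1, J) := by simp only [rect, mem_toSet_iff.1 hx.2]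
    refine ⟨?_, by rw [e]⟩
    refine (toSet_rect_subset (k := (I.1, J.1)) (Prod.mk_le_mk.2 ⟨h, le_rfl⟩) x).trans ?_
    exact Eq.subset (congrArg DyadicRect.toSet (mem_rect_iff.1 hx))
  rw [h1, volume_rect', mul_comm (volume I.toSet), ← mul_assoc, mul_comm A, mul_assoc] at h2
  exact (ENNReal.mul_le_mul_iff_right (volume_interval_ne_zero J) (volume_interval_ne_top J)).1 h2

/-- Coarse in the first variable, fine in the second. On an atom `R` of scale `l` the coarse
interval is constant because `k < l.1`, so the integrand depends only on the second coordinate and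
the one-parameter estimate applies over `R.2`. -/
lemma IsCarleson.saturated_snd_le {g : DyadicRect → ℝ≥0∞} {A : ℝ≥0∞} (hg : IsCarleson g A)
    {l : ℕ × ℕ} {U : Set Torus2} (hU : Saturated l U) {k : ℕ} (hk : k < l.1) :
    ∫⁻ x in U, ∑' m, iv (l.2 ≤ m) (g (rect (k, m) x) ^ 2) ≤ A * volume U := by
  rw [← setLIntegral_const]
  refine hU.setLIntegral_le _ _ fun R hR _ => ?_
  obtain ⟨x, hx⟩ := rect_nonempty R
  have h1 : R.1.1 = l.1 := congrArg Prod.fst hR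
  have h2 : R.2.1 = l.2 := congrArg Prod.snd hR
  have e : ∀ y ∈ R.toSet, ∑' m, iv (l.2 ≤ m) (g (rect (k, m) y) ^ 2) =
      ∑' m, iv (R.2.1 ≤ m) (g (idx k x.1, idx m y.2) ^ 2) := by
    intro y hy
    have : idx k y.1 = idx k x.1 := by
      refine idx_eq_of_le (l := R.1.1) (by omega) ?_
      rw [mem_toSet_iff.1 hy.1, mem_toSet_iff.1 hx.1]
    simp only [rect, this, h2]
  rw [setLIntegral_congr_fun (measurableSet_rect R) e, setLIntegral_const]
  have hm : Measurable fun t => ∑' m, iv (R.2.1 ≤ m) (g (idx k x.1, idx m t) ^ 2) :=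
    Measurable.tsum fun m => measurable_iv (MeasurableSet.const _)
      (measurable_comp_idx m fun J' => g (idx k x.1, J') ^ 2)
  refine (setLIntegral_prod_comp_snd R.1 R.2 hm).trans_le ?_
  calc _ ≤ volume R.1.toSet * (A * volume R.2.toSet) := by
        gcongr; exact hg.setLIntegral_snd_le _ _
    _ = _ := by rw [volume_rect']; ring

lemma IsCarleson.saturated_fst_le {g : DyadicRect → ℝ≥0∞} {A : ℝ≥0∞} (hg : IsCarleson g A)
    {l : ℕ × ℕ} {U : Set Torus2} (hU : Saturated l U) {k : ℕ} (hk : k < l.2) :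
    ∫⁻ x in U, ∑' m, iv (l.1 ≤ m) (g (rect (m, k) x) ^ 2) ≤ A * volume U := by
  rw [← setLIntegral_const]
  refine hU.setLIntegral_le _ _ fun R hR _ => ?_
  obtain ⟨x, hx⟩ := rect_nonempty R
  have h1 : R.1.1 = l.1 := congrArg Prod.fst hR
  have h2 : R.2.1 = l.2 := congrArg Prod.snd hR
  have e : ∀ y ∈ R.toSet, ∑' m, iv (l.1 ≤ m) (g (rect (m, k) y) ^ 2) =
      ∑' m, iv (R.1.1 ≤ m) (g (idx m y.1, idx k x.2) ^ 2) := by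
    intro y hy
    have : idx k y.2 = idx k x.2 := by
      refine idx_eq_of_le (l := R.2.1) (by omega) ?_
      rw [mem_toSet_iff.1 hy.2, mem_toSet_iff.1 hx.2]
    simp only [rect, this, h1]
  rw [setLIntegral_congr_fun (measurableSet_rect R) e, setLIntegral_const]
  have hm : Measurable fun s => ∑' m, iv (R.1.1 ≤ m) (g (idx m s, idx k x.2) ^ 2) :=
    Measurable.tsum fun m => measurable_iv (MeasurableSet.const _)
      (measurable_comp_idx m fun I' => g (I', idx k x.2) ^ 2)
  refine (setLIntegral_prod_comp_fst R.1 R.2 hm).trans_le ?_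
  calc _ ≤ volume R.2.toSet * (A * volume R.1.toSet) := by
        gcongr; exact hg.setLIntegral_fst_le _ _
    _ = _ := by rw [volume_rect']; ring

/-! ### Carleson embedding by the layer cake formula -/

lemma volume_Ioi_ofReal_lt (F : ℝ≥0∞) : volume {t : ℝ | 0 < t ∧ ENNReal.ofReal t < F} = F := by
  induction F with
  | top =>
    have : {t : ℝ | 0 < t ∧ ENNReal.ofReal t < ∞} = Ioi 0 := by ext t; simp
    rw [this, Real.volume_Ioi]
  | coe r =>
    have : {t : ℝ | 0 < t ∧ ENNReal.ofReal t < (r : ℝ≥0∞)} = Ioo 0 (r : ℝ) := by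
      ext t
      simp only [mem_ofPred_eq, mem_Ioo, and_congr_right_iff]
      intro ht
      rw [← ENNReal.ofReal_coe_nnreal, ENNReal.ofReal_lt_ofReal_iff_of_nonneg ht.le]
    rw [this, Real.volume_Ioo]
    simp

/-- The Carleson embedding theorem. -/
lemma carleson_embedding (P : DyadicRect → Prop) (w F : DyadicRect → ℝ≥0∞) {C : ℝ≥0∞}
    (hw : ∀ E : Set Torus2, ∑' R : DyadicRect, iv (P R ∧ R.toSet ⊆ E) (w R) ≤ C * volume E)
    {G : Torus2 → ℝ≥0∞} (hG : Measurable G) (hFG : ∀ R, P R → ∀ x ∈ R.toSet, F R ≤ G x) :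
    ∑' R, iv (P R) (w R * F R) ≤ C * ∫⁻ x, G x := by
  have hmF : ∀ c : ℝ≥0∞, MeasurableSet {t : ℝ | 0 < t ∧ ENNReal.ofReal t < c} := fun c =>
    measurableSet_Ioi.inter (measurableSet_lt ENNReal.measurable_ofReal measurable_const)
  -- Write `F R` as the length of the set of levels `t` below it.
  have e : ∀ R, iv (P R) (w R * F R) =
      ∫⁻ t : ℝ, iv (0 < t ∧ ENNReal.ofReal t < F R) (iv (P R) (w R)) := by
    intro R
    rw [lintegral_iv_const (hmF _), volume_Ioi_ofReal_lt, mul_comm (iv (P R) (w R)) (F R), mul_iv,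
      mul_comm (F R)]
  have eG : ∫⁻ x, G x = ∫⁻ t : ℝ, volume {x | 0 < t ∧ ENNReal.ofReal t < G x} := by
    have hms : MeasurableSet {p : Torus2 × ℝ | 0 < p.2 ∧ ENNReal.ofReal p.2 < G p.1} :=
      (measurableSet_lt measurable_const measurable_snd).inter
        (measurableSet_lt (ENNReal.measurable_ofReal.comp measurable_snd) (hG.comp measurable_fst))
    have h1 := Measure.prod_apply (μ := (volume : Measure Torus2)) (ν := (volume : Measure ℝ)) hms
    have h2 := Measure.prod_apply_symm (μ := (volume : Measure Torus2)) (ν := (volume : Measure ℝ))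
      hms
    rw [h1] at h2
    calc ∫⁻ x, G x = ∫⁻ x, volume {t : ℝ | 0 < t ∧ ENNReal.ofReal t < G x} :=
          lintegral_congr fun x => (volume_Ioi_ofReal_lt _).symm
      _ = _ := h2
  simp_rw [e]
  rw [← lintegral_tsum fun R => (measurable_iv (hmF _) measurable_const).aemeasurable, eG]
  -- At level `t`, every rectangle with `F R > t` is contained in the level set `{G > t}`, on which
  -- the hypothesis is tested.
  have hmono : ∀ t : ℝ, ∑' R, iv (0 < t ∧ ENNReal.ofReal t < F R) (iv (P R) (w R)) ≤
      C * volume {x | 0 < t ∧ ENNReal.ofReal t < G x} := by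
    intro t
    refine le_trans (ENNReal.tsum_le_tsum fun R => ?_) (hw _)
    rw [iv_iv]
    refine iv_mono fun h => ⟨⟨h.2, fun x hx => ⟨h.1.1, h.1.2.trans_le (hFG R h.2 x hx)⟩⟩, le_rfl⟩
  calc _ ≤ ∫⁻ t : ℝ, C * volume {x | 0 < t ∧ ENNReal.ofReal t < G x} := lintegral_mono hmono
    _ = _ := by
      rw [lintegral_const_mul]
      have hms : MeasurableSet {p : ℝ × Torus2 | 0 < p.1 ∧ ENNReal.ofReal p.1 < G p.2} :=
        (measurableSet_lt measurable_const measurable_fst).inter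
          (measurableSet_lt (ENNReal.measurable_ofReal.comp measurable_fst) (hG.comp measurable_snd))
      exact measurable_measure_prodMk_left (ν := (volume : Measure Torus2)) hms

/-! ### Integration of the corner terms and the main estimate -/

lemma lintegral_sum_iv_isFirstL_le {g : DyadicRect → ℝ≥0∞} {A : ℝ≥0∞} (hg : IsCarleson g A)
    (Ω : Set Torus2) (α β : ℕ) :
    ∫⁻ x, iv (IsFirstL (Inside Ω x) α β) (half ^ α * ∑ k ∈ Finset.range (blockEnd α),
      ∑' l, iv (blockEnd β ≤ l) (g (rect (k, l) x) ^ 2)) ≤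
      2 * A * volume {x | IsFirstL (Inside Ω x) α β} := by
  have hm : ∀ k, Measurable fun x => ∑' l, iv (blockEnd β ≤ l) (g (rect (k, l) x) ^ 2) := fun k =>
    Measurable.tsum fun l => measurable_iv (MeasurableSet.const _)
      (measurable_comp_rect (k, l) fun R => g R ^ 2)
  rw [lintegral_iv (measurableSet_isFirstL Ω α β), lintegral_const_mul _
    (Finset.measurable_sum _ fun k _ => hm k), lintegral_finsetSum _ fun k _ => hm k]
  calc _ ≤ half ^ α * ∑ k ∈ Finset.range (blockEnd α),
        A * volume {x | IsFirstL (Inside Ω x) α β} := by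
        gcongr with k hk
        exact hg.saturated_snd_le (saturated_isFirstL Ω α β) (Finset.mem_range.1 hk)
    -- There are `blockEnd α = 2 * 2 ^ α` coarse scales, each contributing the same bound; the
    -- weight `half ^ α` cancels their number.
    _ = 2 * (half ^ α * 2 ^ α) * (A * volume {x | IsFirstL (Inside Ω x) α β}) := by
        rw [Finset.sum_const, Finset.card_range, nsmul_eq_mul, cast_blockEnd]; ring
    _ = _ := by rw [half_pow_mul_two_pow le_rfl, Nat.sub_self, pow_zero, mul_one, mul_assoc]

lemma lintegral_sum_iv_isFirstR_le {g : DyadicRect → ℝ≥0∞} {A : ℝ≥0∞} (hg : IsCarleson g A)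
    (Ω : Set Torus2) (α β : ℕ) :
    ∫⁻ x, iv (IsFirstR (Inside Ω x) α β) (half ^ α * half ^ β *
      ∑ l ∈ Finset.range (blockEnd β), ∑' k, iv (blockEnd α ≤ k) (g (rect (k, l) x) ^ 2)) ≤
      half ^ α * (2 * A * volume {x | IsFirstR (Inside Ω x) α β}) := by
  have hm : ∀ l, Measurable fun x => ∑' k, iv (blockEnd α ≤ k) (g (rect (k, l) x) ^ 2) := fun l =>
    Measurable.tsum fun k => measurable_iv (MeasurableSet.const _)
      (measurable_comp_rect (k, l) fun R => g R ^ 2)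
  rw [lintegral_iv (measurableSet_isFirstR Ω α β), lintegral_const_mul _
    (Finset.measurable_sum _ fun k _ => hm k), lintegral_finsetSum _ fun k _ => hm k]
  calc _ ≤ half ^ α * half ^ β * ∑ l ∈ Finset.range (blockEnd β),
        A * volume {x | IsFirstR (Inside Ω x) α β} := by
        gcongr with l hl
        exact hg.saturated_fst_le (saturated_isFirstR Ω α β) (Finset.mem_range.1 hl)
    _ = half ^ α * (2 * (half ^ β * 2 ^ β) * (A * volume {x | IsFirstR (Inside Ω x) α β})) := by
        rw [Finset.sum_const, Finset.card_range, nsmul_eq_mul, cast_blockEnd]; ring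
    _ = _ := by rw [half_pow_mul_two_pow le_rfl, Nat.sub_self, pow_zero, mul_one, mul_assoc 2]

lemma tsum_volume_isFirstL_le {Ω : Set Torus2} (hΩ : MeasurableSet Ω) (β : ℕ) :
    ∑' α, volume {x | IsFirstL (Inside Ω x) α β} ≤ volume Ω := by
  calc _ = ∫⁻ x, ∑' α, iv (IsFirstL (Inside Ω x) α β) 1 := by
        rw [lintegral_tsum fun α =>
          (measurable_iv (measurableSet_isFirstL Ω α β) measurable_const).aemeasurable]
        exact tsum_congr fun α => by
          rw [lintegral_iv_const (measurableSet_isFirstL Ω α β), one_mul]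
    _ ≤ ∫⁻ x, iv (x ∈ Ω) 1 := lintegral_mono fun x => (tsum_iv_isFirstL_le _ _ _).trans
        (iv_mono fun ⟨_, h⟩ => ⟨h.mem, le_rfl⟩)
    _ = volume Ω := by rw [lintegral_iv_const (by exact hΩ), one_mul]; rfl

lemma tsum_volume_isFirstR_le {Ω : Set Torus2} (hΩ : MeasurableSet Ω) (α : ℕ) :
    ∑' β, volume {x | IsFirstR (Inside Ω x) α β} ≤ volume Ω := by
  calc _ = ∫⁻ x, ∑' β, iv (IsFirstR (Inside Ω x) α β) 1 := by
        rw [lintegral_tsum fun β =>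
          (measurable_iv (measurableSet_isFirstR Ω α β) measurable_const).aemeasurable]
        exact tsum_congr fun β => by
          rw [lintegral_iv_const (measurableSet_isFirstR Ω α β), one_mul]
    _ ≤ ∫⁻ x, iv (x ∈ Ω) 1 := lintegral_mono fun x => (tsum_iv_isFirstR_le _ _ _).trans
        (iv_mono fun ⟨_, h⟩ => ⟨h.mem, le_rfl⟩)
    _ = volume Ω := by rw [lintegral_iv_const (by exact hΩ), one_mul]; rfl

/-- For each `β` the sets of left corners are disjoint, so they cost `2 A |Ω|`. The sum over `β ≤ b`
costs `b + 1`, which `half ^ b` absorbs with total `4`. -/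
lemma lintegral_left_corner_le {g : DyadicRect → ℝ≥0∞} {A : ℝ≥0∞} (hg : IsCarleson g A)
    {Ω : Set Torus2} (hΩ : MeasurableSet Ω) :
    ∫⁻ x, ∑' b, half ^ b * ∑' β, iv (β ≤ b) (∑' α, iv (IsFirstL (Inside Ω x) α β) (half ^ α *
      ∑ k ∈ Finset.range (blockEnd α), ∑' l, iv (blockEnd β ≤ l) (g (rect (k, l) x) ^ 2))) ≤
      8 * A * volume Ω := by
  have hm1 : ∀ α β, Measurable fun x => iv (IsFirstL (Inside Ω x) α β) (half ^ α *
      ∑ k ∈ Finset.range (blockEnd α), ∑' l, iv (blockEnd β ≤ l) (g (rect (k, l) x) ^ 2)) :=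
    fun α β => measurable_iv (measurableSet_isFirstL Ω α β) (measurable_const.mul
      (Finset.measurable_sum _ fun k _ => Measurable.tsum fun l =>
        measurable_iv (MeasurableSet.const _) (measurable_comp_rect (k, l) fun R => g R ^ 2)))
  have hm2 : ∀ β b, Measurable fun x => iv (β ≤ b) (∑' α, iv (IsFirstL (Inside Ω x) α β)
      (half ^ α * ∑ k ∈ Finset.range (blockEnd α),
        ∑' l, iv (blockEnd β ≤ l) (g (rect (k, l) x) ^ 2))) := fun β b =>
    measurable_iv (MeasurableSet.const _) (Measurable.tsum fun α => hm1 α β)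
  rw [lintegral_tsum fun b => ((Measurable.tsum fun β => hm2 β b).const_mul _).aemeasurable]
  have hβ : ∀ β b, ∫⁻ x, iv (β ≤ b) (∑' α, iv (IsFirstL (Inside Ω x) α β)
      (half ^ α * ∑ k ∈ Finset.range (blockEnd α),
        ∑' l, iv (blockEnd β ≤ l) (g (rect (k, l) x) ^ 2))) ≤ iv (β ≤ b) (2 * A * volume Ω) := by
    intro β b
    by_cases h : β ≤ b
    · simp only [iv_pos h]
      rw [lintegral_tsum fun α => (hm1 α β).aemeasurable]
      calc _ ≤ ∑' α, 2 * A * volume {x | IsFirstL (Inside Ω x) α β} :=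
            ENNReal.tsum_le_tsum fun α => lintegral_sum_iv_isFirstL_le hg Ω α β
        _ ≤ _ := by
            rw [ENNReal.tsum_mul_left]
            gcongr
            exact tsum_volume_isFirstL_le hΩ β
    · simp [iv_neg h]
  calc _ ≤ ∑' b : ℕ, half ^ b * (((b : ℝ≥0∞) + 1) * (2 * A * volume Ω)) := by
        refine ENNReal.tsum_le_tsum fun b => ?_
        rw [lintegral_const_mul _ (Measurable.tsum fun β => hm2 β b),
          lintegral_tsum fun β => (hm2 β b).aemeasurable]
        gcongr
        calc _ ≤ ∑' β, iv (β ≤ b) (2 * A * volume Ω) := ENNReal.tsum_le_tsum fun β => hβ β b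
          _ = ∑ β ∈ Finset.range (b + 1), 2 * A * volume Ω := by
              rw [tsum_eq_sum (s := Finset.range (b + 1))
                fun β h => iv_neg (by simpa [Nat.lt_succ_iff] using h) _]
              exact Finset.sum_congr rfl fun β h => iv_pos (by simpa [Nat.lt_succ_iff] using h) _
          _ = _ := by simp
    _ = (∑' b : ℕ, half ^ b * ((b : ℝ≥0∞) + 1)) * (2 * A * volume Ω) := by
        rw [← ENNReal.tsum_mul_right]
        exact tsum_congr fun b => by ring
    _ ≤ 4 * (2 * A * volume Ω) := by gcongr; exact tsum_half_pow_succ_mul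
    _ = _ := by ring

/-- Here the weight `half ^ β` pays for the number of coarse scales, so `half ^ α` remains to sum
over the columns. -/
lemma lintegral_right_corner_le {g : DyadicRect → ℝ≥0∞} {A : ℝ≥0∞} (hg : IsCarleson g A)
    {Ω : Set Torus2} (hΩ : MeasurableSet Ω) :
    ∫⁻ x, ∑' α, ∑' β, iv (IsFirstR (Inside Ω x) α β) (half ^ α * half ^ β *
      ∑ l ∈ Finset.range (blockEnd β), ∑' k, iv (blockEnd α ≤ k) (g (rect (k, l) x) ^ 2)) ≤
      4 * A * volume Ω := by
  have hm1 : ∀ α β, Measurable fun x => iv (IsFirstR (Inside Ω x) α β) (half ^ α * half ^ β *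
      ∑ l ∈ Finset.range (blockEnd β), ∑' k, iv (blockEnd α ≤ k) (g (rect (k, l) x) ^ 2)) :=
    fun α β => measurable_iv (measurableSet_isFirstR Ω α β) (measurable_const.mul
      (Finset.measurable_sum _ fun l _ => Measurable.tsum fun k =>
        measurable_iv (MeasurableSet.const _) (measurable_comp_rect (k, l) fun R => g R ^ 2)))
  rw [lintegral_tsum fun α => (Measurable.tsum fun β => hm1 α β).aemeasurable]
  calc _ ≤ ∑' α : ℕ, half ^ α * (2 * A * volume Ω) := by
        refine ENNReal.tsum_le_tsum fun α => ?_
        rw [lintegral_tsum fun β => (hm1 α β).aemeasurable]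
        calc _ ≤ ∑' β, half ^ α * (2 * A * volume {x | IsFirstR (Inside Ω x) α β}) :=
              ENNReal.tsum_le_tsum fun β => lintegral_sum_iv_isFirstR_le hg Ω α β
          _ ≤ _ := by
              rw [ENNReal.tsum_mul_left, ENNReal.tsum_mul_left]
              gcongr
              exact tsum_volume_isFirstR_le hΩ α
    _ = 4 * A * volume Ω := by rw [ENNReal.tsum_mul_right, tsum_half_pow]; ring

/-- The summation lemma is applied at each `x` with the blocks admissible for `Ω` and for its
enlargement; the four resulting terms are integrated separately. The constant comes from `1280 + 512
+ 512 + 128 = 2432`, rounded up to `50 ^ 2`. -/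
lemma lintegral_weighted_sums_le {g : DyadicRect → ℝ≥0∞} {A : ℝ≥0∞} (hg : IsCarleson g A)
    {Ω : Set Torus2} (hΩ : MeasurableSet Ω) :
    ∫⁻ x, ∑' b, ∑' a, iv (Inside Ω x a b) (half ^ (2 * a) * half ^ (2 * b) *
      (∑ k ∈ Finset.range (blockEnd a), ∑ l ∈ Finset.range (blockEnd b), g (rect (k, l) x)) ^ 2) ≤
      2500 * (A * volume Ω) := by
  set Ω' := enlarge Ω with hΩ'
  have hΩ'm : MeasurableSet Ω' := measurableSet_enlarge Ω
  set V : Torus2 → ℝ≥0∞ := fun x => ∑' k, iv ((rect k x).toSet ⊆ Ω') (g (rect k x) ^ 2) with hV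
  have hpt := fun x => tsum_upset_le (fun k l => g (rect (k, l) x)) (A := A) (V := V x)
    (fun k l => hg.sq_le _) (B := Inside Ω x) (S := Inside Ω' x)
    (fun a b h => subset_enlarge_of_subset h) (fun a a' b ha h => h.mono ha le_rfl)
    -- Beyond a point of the up-set every rectangle through `x` lies in the enlargement, so the far
    -- piece is bounded by `V x`.
    (fun α β h => by
      simp only [hV]
      rw [ENNReal.tsum_prod']
      refine ENNReal.tsum_le_tsum fun k => ENNReal.tsum_le_tsum fun l => ?_
      rw [iv_iv]
      exact iv_mono fun h' => ⟨(toSet_rect_subset (Prod.mk_le_mk.2 h') x).trans h, le_rfl⟩)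
  refine (lintegral_mono hpt).trans ?_
  have hmV : Measurable V := Measurable.tsum fun k =>
    measurable_comp_rect k fun R => iv (R.toSet ⊆ Ω') (g R ^ 2)
  have hmR : Measurable fun x => ∑' α, ∑' β, iv (IsFirstR (Inside Ω' x) α β)
      (half ^ α * half ^ β * ∑ l ∈ Finset.range (blockEnd β),
        ∑' k, iv (blockEnd α ≤ k) (g (rect (k, l) x) ^ 2)) :=
    Measurable.tsum fun α => Measurable.tsum fun β => measurable_iv (measurableSet_isFirstR Ω' α β)
      (measurable_const.mul (Finset.measurable_sum _ fun l _ => Measurable.tsum fun k =>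
        measurable_iv (MeasurableSet.const _) (measurable_comp_rect (k, l) fun R => g R ^ 2)))
  have hmL : Measurable fun x => ∑' b, half ^ b * ∑' β, iv (β ≤ b) (∑' α,
      iv (IsFirstL (Inside Ω' x) α β) (half ^ α *
        ∑ k ∈ Finset.range (blockEnd α), ∑' l, iv (blockEnd β ≤ l) (g (rect (k, l) x) ^ 2))) :=
    Measurable.tsum fun b => by
      refine Measurable.const_mul ?_ _
      refine Measurable.tsum fun β => ?_
      refine measurable_iv (MeasurableSet.const _) ?_
      refine Measurable.tsum fun α => ?_
      refine measurable_iv (measurableSet_isFirstL Ω' α β) ?_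
      exact measurable_const.mul (Finset.measurable_sum _ fun k _ => Measurable.tsum fun l =>
        measurable_iv (MeasurableSet.const _) (measurable_comp_rect (k, l) fun R => g R ^ 2))
  have hvol : volume Ω' ≤ 2 * volume Ω := volume_enlarge_le hΩ
  have hmB : Measurable fun x => ∑' b, ∑' a, iv (IsFirstL (Inside Ω x) a b)
      (half ^ b + ∑' c, iv (c < b ∧ ¬ Inside Ω' x a c) (half ^ (b - c - 1))) :=
    Measurable.tsum fun b => Measurable.tsum fun a => measurable_iv (measurableSet_isFirstL Ω a b)
      (measurable_const.add (Measurable.tsum fun c => measurable_iv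
        ((MeasurableSet.const _).inter (measurableSet_inside Ω' a c).compl) measurable_const))
  rw [lintegral_add_right _ (hmV.const_mul _), lintegral_add_right _ (hmR.const_mul _),
    lintegral_add_right _ (hmL.const_mul _), lintegral_const_mul _ hmV, lintegral_const_mul _ hmR,
    lintegral_const_mul _ hmL, lintegral_const_mul _ hmB]
  calc _ ≤ 128 * A * (10 * volume Ω) + 32 * (8 * A * volume Ω') + 64 * (4 * A * volume Ω') +
        64 * (A * volume Ω') := by
        gcongr
        · exact lintegral_block_count_le hΩ
        · exact lintegral_left_corner_le hg hΩ'm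
        · exact lintegral_right_corner_le hg hΩ'm
        · exact hg.lintegral_le Ω'
    _ ≤ 128 * A * (10 * volume Ω) + 32 * (8 * A * (2 * volume Ω)) +
        64 * (4 * A * (2 * volume Ω)) + 64 * (A * (2 * volume Ω)) := by gcongr
    _ = 2432 * (A * volume Ω) := by ring
    _ ≤ _ := by gcongr; norm_num

/-- The main estimate: a logarithmic Carleson sequence `w` times the squares of sums of a Carleson
sequence over all larger rectangles is a Carleson sequence. -/
theorem tsum_mul_sq_sum_le {g w m : DyadicRect → ℝ≥0∞} {A W : ℝ≥0∞} (hg : IsCarleson g A)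
    (hw : ∀ (a b : ℕ) (E : Set Torus2),
      ∑' R : DyadicRect, iv ((2 ^ a ≤ R.1.1 ∧ 2 ^ b ≤ R.2.1) ∧ R.toSet ⊆ E) (w R) ≤
        W * (half ^ (2 * a) * half ^ (2 * b)) * volume E)
    (hm : ∀ R : DyadicRect, ∀ x ∈ R.toSet,
      m R ≤ ∑ k ∈ Finset.range R.1.1, ∑ l ∈ Finset.range R.2.1, g (rect (k, l) x))
    {Ω : Set Torus2} (hΩ : MeasurableSet Ω) :
    ∑' R : DyadicRect, iv ((1 ≤ R.1.1 ∧ 1 ≤ R.2.1) ∧ R.toSet ⊆ Ω) (w R * m R ^ 2) ≤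
      2500 * (W * A * volume Ω) := by
  set P : ℕ → ℕ → DyadicRect → Prop := fun a b R =>
    ((2 ^ a ≤ R.1.1 ∧ R.1.1 < 2 ^ (a + 1)) ∧ (2 ^ b ≤ R.2.1 ∧ R.2.1 < 2 ^ (b + 1))) ∧ R.toSet ⊆ Ω
    with hP
  set G : ℕ → ℕ → Torus2 → ℝ≥0∞ := fun a b x => iv (Inside Ω x a b)
    ((∑ k ∈ Finset.range (blockEnd a), ∑ l ∈ Finset.range (blockEnd b), g (rect (k, l) x)) ^ 2)
    with hG
  have hGm : ∀ a b, Measurable (G a b) := fun a b => measurable_iv (measurableSet_inside Ω a b)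
    ((Finset.measurable_sum _ fun k _ => Finset.measurable_sum _ fun l _ =>
      measurable_comp_rect (k, l) g).pow_const 2)
  have hblock : ∀ a b, ∑' R, iv (P a b R) (w R * m R ^ 2) ≤
      W * (half ^ (2 * a) * half ^ (2 * b)) * ∫⁻ x, G a b x := by
    intro a b
    refine carleson_embedding (P a b) w (fun R => m R ^ 2) (fun E => ?_) (hGm a b) ?_
    · refine le_trans (ENNReal.tsum_le_tsum fun R => iv_mono fun h => ⟨?_, le_rfl⟩) (hw a b E)
      exact ⟨⟨h.1.1.1.1, h.1.1.2.1⟩, h.2⟩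
    · rintro R ⟨⟨⟨-, h1⟩, -, h2⟩, hR⟩ x hx
      -- The scales of `R` are smaller than the block ends, so the rectangle around `x` at the end
      -- of the block lies in `R`, hence in `Ω`.
      have hin : Inside Ω x a b := by
        refine (toSet_rect_subset (k := R.scale) (Prod.mk_le_mk.2 ⟨h1.le, h2.le⟩) x).trans ?_
        rw [mem_rect_iff.1 hx]
        exact hR
      simp only [hG]
      rw [iv_pos hin]
      gcongr
      calc m R ≤ ∑ k ∈ Finset.range R.1.1, ∑ l ∈ Finset.range R.2.1, g (rect (k, l) x) := hm R x hx
        _ ≤ ∑ k ∈ Finset.range R.1.1, ∑ l ∈ Finset.range (blockEnd b), g (rect (k, l) x) :=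
            Finset.sum_le_sum fun k _ =>
              Finset.sum_le_sum_of_subset (Finset.range_subset_range.2 h2.le)
        _ ≤ _ := Finset.sum_le_sum_of_subset (Finset.range_subset_range.2 h1.le)
  calc _ ≤ ∑' R, ∑' b, ∑' a, iv (P a b R) (w R * m R ^ 2) := by
        refine ENNReal.tsum_le_tsum fun R => iv_le_of fun h => ?_
        -- The block of `R` is given by the binary logarithms of its two scales, which are positive
        -- here; scale `0` belongs to no block.
        refine le_trans ?_ (ENNReal.le_tsum (Nat.log 2 R.2.1))
        refine le_trans ?_ (ENNReal.le_tsum (Nat.log 2 R.1.1))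
        rw [iv_pos]
        exact ⟨⟨⟨Nat.pow_log_le_self 2 (by omega), Nat.lt_pow_succ_log_self (by norm_num) _⟩,
          ⟨Nat.pow_log_le_self 2 (by omega), Nat.lt_pow_succ_log_self (by norm_num) _⟩⟩, h.2⟩
    _ = ∑' b, ∑' a, ∑' R, iv (P a b R) (w R * m R ^ 2) := by
        rw [ENNReal.tsum_comm]
        exact tsum_congr fun b => ENNReal.tsum_comm
    _ ≤ ∑' b, ∑' a, W * (half ^ (2 * a) * half ^ (2 * b)) * ∫⁻ x, G a b x :=
        ENNReal.tsum_le_tsum fun b => ENNReal.tsum_le_tsum fun a => hblock a b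
    _ = W * ∫⁻ x, ∑' b, ∑' a, iv (Inside Ω x a b) (half ^ (2 * a) * half ^ (2 * b) *
        (∑ k ∈ Finset.range (blockEnd a),
          ∑ l ∈ Finset.range (blockEnd b), g (rect (k, l) x)) ^ 2) := by
        simp_rw [← mul_iv]
        rw [lintegral_tsum fun b => (Measurable.tsum fun a =>
          (hGm a b).const_mul _).aemeasurable, ← ENNReal.tsum_mul_left]
        refine tsum_congr fun b => ?_
        rw [lintegral_tsum fun a => ((hGm a b).const_mul _).aemeasurable, ← ENNReal.tsum_mul_left]
        refine tsum_congr fun a => ?_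
        rw [lintegral_const_mul _ (hGm a b), mul_assoc W]
    _ ≤ W * (2500 * (A * volume Ω)) := by gcongr; exact lintegral_weighted_sums_le hg hΩ
    _ = _ := by ring

/-! ### Haar functions -/

lemma mem_left_iff {I : DyadicInterval} {s : UnitAddCircle} :
    s ∈ I.left ↔ ⌊coord s * 2 ^ (I.1 + 1)⌋₊ = 2 * I.2.val := by
  rw [← mem_arc_iff]
  unfold DyadicInterval.left
  have e1 : (I.2.val : ℝ) / 2 ^ I.1 = ((2 * I.2.val : ℕ) : ℝ) / 2 ^ (I.1 + 1) := by
    push_cast; rw [pow_succ]; field_simp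
  have e2 : ((I.2.val : ℝ) + 1 / 2) / 2 ^ I.1 = (((2 * I.2.val : ℕ) : ℝ) + 1) / 2 ^ (I.1 + 1) := by
    push_cast; rw [pow_succ]; field_simp
  rw [e1, e2]

lemma mem_right_iff {I : DyadicInterval} {s : UnitAddCircle} :
    s ∈ I.right ↔ ⌊coord s * 2 ^ (I.1 + 1)⌋₊ = 2 * I.2.val + 1 := by
  rw [← mem_arc_iff]
  unfold DyadicInterval.right
  have e1 : ((I.2.val : ℝ) + 1 / 2) / 2 ^ I.1 = ((2 * I.2.val + 1 : ℕ) : ℝ) / 2 ^ (I.1 + 1) := by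
    push_cast; rw [pow_succ]; field_simp
  have e2 : ((I.2.val : ℝ) + 1) / 2 ^ I.1 =
      (((2 * I.2.val + 1 : ℕ) : ℝ) + 1) / 2 ^ (I.1 + 1) := by
    push_cast; rw [pow_succ]; field_simp; ring
  rw [e1, e2]

lemma mem_toSet_iff_floor_succ {I : DyadicInterval} {s : UnitAddCircle} :
    s ∈ I.toSet ↔ ⌊coord s * 2 ^ (I.1 + 1)⌋₊ / 2 = I.2.val := by
  unfold DyadicInterval.toSet
  have h1 := Nat.floor_div_natCast (coord s * 2 ^ (I.1 + 1)) 2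
  have h2 : coord s * 2 ^ (I.1 + 1) / ((2 : ℕ) : ℝ) = coord s * 2 ^ I.1 := by
    push_cast; rw [pow_succ]; field_simp
  rw [mem_arc_iff, ← h1, h2]

lemma mem_toSet_iff_left_or_right {I : DyadicInterval} {s : UnitAddCircle} :
    s ∈ I.toSet ↔ s ∈ I.left ∨ s ∈ I.right := by
  rw [mem_toSet_iff_floor_succ, mem_left_iff, mem_right_iff]
  omega

lemma notMem_left_of_mem_right {I : DyadicInterval} {s : UnitAddCircle} (h : s ∈ I.right) :
    s ∉ I.left := by
  rw [mem_right_iff] at h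
  rw [mem_left_iff]
  omega

lemma haar1_of_mem_right {I : DyadicInterval} {s : UnitAddCircle} (h : s ∈ I.right) :
    haar1 I s = Real.sqrt (2 ^ I.1) := by
  simp [haar1, h, notMem_left_of_mem_right h]

lemma haar1_of_mem_left {I : DyadicInterval} {s : UnitAddCircle} (h : s ∈ I.left) :
    haar1 I s = -Real.sqrt (2 ^ I.1) := by
  have h' : s ∉ I.right := fun hr => notMem_left_of_mem_right hr h
  simp [haar1, h, h']

lemma haar1_of_notMem {I : DyadicInterval} {s : UnitAddCircle} (h : s ∉ I.toSet) :
    haar1 I s = 0 := by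
  rw [mem_toSet_iff_left_or_right, not_or] at h
  simp [haar1, h.1, h.2]

/-- The product is the difference of the averaging kernels at scales `k + 1` and `k`: `2 ^ k` on the
half that contains `x`, `-2 ^ k` on the other. Consequently sums over `k` telescope. -/
lemma haar1_mul_haar1 (k : ℕ) (x s : UnitAddCircle) [Decidable (idx k s = idx k x)]
    [Decidable (idx (k + 1) s = idx (k + 1) x)] :
    haar1 (idx k x) x * haar1 (idx k x) s =
      (if idx (k + 1) s = idx (k + 1) x then (2 : ℝ) ^ (k + 1) else 0) -
        (if idx k s = idx k x then (2 : ℝ) ^ k else 0) := by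
  have hx := mem_toSet_idx k x
  have hsq : Real.sqrt (2 ^ k) * Real.sqrt (2 ^ k) = (2 : ℝ) ^ k :=
    Real.mul_self_sqrt (by positivity)
  by_cases hs : s ∈ (idx k x).toSet
  · rw [if_pos (mem_toSet_idx_iff.1 hs)]
    rw [mem_toSet_iff_left_or_right] at hx hs
    rcases hx with hx | hx <;> rcases hs with hs | hs
    · rw [haar1_of_mem_left hx, haar1_of_mem_left hs]
      rw [mem_left_iff] at hx hs
      have e : idx (k + 1) s = idx (k + 1) x := idx_eq_idx_iff.2 (hs.trans hx.symm)
      rw [if_pos e, idx_fst, pow_succ]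
      linarith
    · rw [haar1_of_mem_left hx, haar1_of_mem_right hs]
      rw [mem_left_iff] at hx
      rw [mem_right_iff] at hs
      rw [if_neg (fun h => ?_), idx_fst]
      · linarith
      · have := idx_eq_idx_iff.1 h
        simp only [idx_fst] at hx hs
        omega
    · rw [haar1_of_mem_right hx, haar1_of_mem_left hs]
      rw [mem_right_iff] at hx
      rw [mem_left_iff] at hs
      rw [if_neg (fun h => ?_), idx_fst]
      · linarith
      · have := idx_eq_idx_iff.1 h
        simp only [idx_fst] at hx hs
        omega
    · rw [haar1_of_mem_right hx, haar1_of_mem_right hs]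
      rw [mem_right_iff] at hx hs
      have e : idx (k + 1) s = idx (k + 1) x := idx_eq_idx_iff.2 (hs.trans hx.symm)
      rw [if_pos e, idx_fst, pow_succ]
      linarith
  · rw [haar1_of_notMem hs, mul_zero, if_neg (fun h => hs ?_), if_neg (fun h => hs ?_), sub_zero]
    · exact mem_toSet_idx_iff.2 h
    · exact mem_toSet_idx_iff.2 (idx_eq_of_le (Nat.le_succ k) h)

/-- The averaging kernel of a dyadic interval in terms of Haar functions. -/
lemma one_add_sum_haar1 (j : ℕ) (x s : UnitAddCircle) [Decidable (idx j s = idx j x)] :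
    1 + ∑ k ∈ Finset.range j, haar1 (idx k x) x * haar1 (idx k x) s =
      if idx j s = idx j x then (2 : ℝ) ^ j else 0 := by
  classical
  rw [Finset.sum_congr rfl fun k _ => haar1_mul_haar1 k x s,
    Finset.sum_range_sub (fun k => if idx k s = idx k x then (2 : ℝ) ^ k else 0)]
  have h0 : idx 0 s = idx 0 x := by
    rw [idx_eq_idx_iff]
    have h1 := floor_coord_lt 0 s
    have h2 := floor_coord_lt 0 x
    simp only [pow_zero] at h1 h2 ⊢
    omega
  rw [if_pos h0, pow_zero, add_sub_cancel]
  congr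

lemma haar1_sq {I : DyadicInterval} {s : UnitAddCircle} (h : s ∈ I.toSet) :
    haar1 I s ^ 2 = 2 ^ I.1 := by
  rcases mem_toSet_iff_left_or_right.1 h with h | h
  · rw [haar1_of_mem_left h, neg_sq, Real.sq_sqrt (by positivity)]
  · rw [haar1_of_mem_right h, Real.sq_sqrt (by positivity)]

lemma haar1_eq_of_idx_eq {I : DyadicInterval} {s t : UnitAddCircle}
    (h : idx (I.1 + 1) s = idx (I.1 + 1) t) : haar1 I s = haar1 I t := by
  rw [idx_eq_idx_iff] at h
  unfold haar1
  congr 2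
  · by_cases hs : s ∈ I.right
    · have ht : t ∈ I.right := by rw [mem_right_iff] at hs ⊢; omega
      simp [hs, ht]
    · have ht : t ∉ I.right := by rw [mem_right_iff] at hs ⊢; omega
      simp [hs, ht]
  · by_cases hs : s ∈ I.left
    · have ht : t ∈ I.left := by rw [mem_left_iff] at hs ⊢; omega
      simp [hs, ht]
    · have ht : t ∉ I.left := by rw [mem_left_iff] at hs ⊢; omega
      simp [hs, ht]

lemma measureReal_left (I : DyadicInterval) :
    volume.real I.left = volume.real I.right := by
  have h2 : (0 : ℝ) < 2 ^ I.1 := by positivity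
  have h1 : ((I.2.val : ℝ) + 1) ≤ 2 ^ I.1 := by exact_mod_cast I.2.2
  unfold DyadicInterval.left DyadicInterval.right Measure.real
  rw [volume_arc (by positivity) (by rw [div_le_one h2]; linarith),
    volume_arc (by positivity) (by rw [div_le_one h2]; exact h1)]
  congr 2
  rw [← sub_div, ← sub_div]
  congr 1
  ring

lemma integral_haar1 (I : DyadicInterval) : ∫ s, haar1 I s = 0 := by
  unfold haar1
  have hr : MeasurableSet I.right := measurableSet_arc _ _
  have hl : MeasurableSet I.left := measurableSet_arc _ _
  have ir : Integrable (I.right.indicator (1 : UnitAddCircle → ℝ)) :=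
    (integrable_const (1 : ℝ)).indicator hr
  have il : Integrable (I.left.indicator (1 : UnitAddCircle → ℝ)) :=
    (integrable_const (1 : ℝ)).indicator hl
  rw [integral_const_mul, integral_sub ir il]
  rw [integral_indicator_one hr, integral_indicator_one hl, measureReal_left, sub_self, mul_zero]

lemma measureReal_interval (I : DyadicInterval) : volume.real I.toSet = (2 ^ I.1)⁻¹ := by
  rw [Measure.real, volume_toSet_interval]
  simp

lemma integral_haar1_mul_self (I : DyadicInterval) : ∫ s, haar1 I s * haar1 I s = 1 := by
  have : (fun s => haar1 I s * haar1 I s) = I.toSet.indicator fun _ => (2 : ℝ) ^ I.1 := by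
    ext s
    by_cases h : s ∈ I.toSet
    · rw [indicator_of_mem h, ← sq, haar1_sq h]
    · rw [indicator_of_notMem h, haar1_of_notMem h, mul_zero]
  rw [this, integral_indicator (measurableSet_toSet I), setIntegral_const, measureReal_interval,
    smul_eq_mul, inv_mul_cancel₀ (by positivity)]

/-- If `J` is strictly shorter, `haar1 I` is constant on `J` and `haar1 J` has mean zero; at equal
lengths the supports are disjoint. -/
lemma integral_haar1_mul_of_le {I J : DyadicInterval} (h : I ≠ J) (hle : I.1 ≤ J.1) :
    ∫ s, haar1 I s * haar1 J s = 0 := by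
  obtain ⟨x, hx⟩ := interval_nonempty J
  rcases hle.lt_or_eq with hlt | heq
  · have : (fun s => haar1 I s * haar1 J s) = fun s => haar1 I x * haar1 J s := by
      ext s
      by_cases hs : s ∈ J.toSet
      · congr 1
        refine haar1_eq_of_idx_eq (idx_eq_of_le (l := J.1) hlt ?_)
        rw [mem_toSet_iff.1 hs, mem_toSet_iff.1 hx]
      · rw [haar1_of_notMem hs, mul_zero, mul_zero]
    rw [this, integral_const_mul, integral_haar1, mul_zero]
  · have : (fun s => haar1 I s * haar1 J s) = fun _ => 0 := by
      ext s
      by_cases hs : s ∈ J.toSet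
      · have : s ∉ I.toSet := fun hI => h (by
          rw [← mem_toSet_iff.1 hs, ← mem_toSet_iff.1 hI, heq])
        rw [haar1_of_notMem this, zero_mul]
      · rw [haar1_of_notMem hs, mul_zero]
    rw [this, integral_zero]

lemma integral_haar1_mul (I J : DyadicInterval) [Decidable (I = J)] :
    ∫ s, haar1 I s * haar1 J s = if I = J then 1 else 0 := by
  by_cases h : I = J
  · subst h
    rw [if_pos rfl, integral_haar1_mul_self]
  · rw [if_neg h]
    rcases le_total I.1 J.1 with hle | hle
    · exact integral_haar1_mul_of_le h hle
    · simp_rw [mul_comm (haar1 I _)]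
      exact integral_haar1_mul_of_le (Ne.symm h) hle

variable {𝕜 : Type*} [RCLike 𝕜]

lemma coef_eq_integral (f : L2T 𝕜) (R : DyadicRect) : coef f R = ∫ p, haarFun 𝕜 R p * f p := by
  unfold coef
  rw [L2.inner_def]
  refine integral_congr_ae ?_
  filter_upwards [(memLp_haarFun 𝕜 R).coeFn_toLp] with p hp
  rw [haar, hp]
  simp [haarFun, RCLike.inner_apply, mul_comm]

lemma orthonormal_haar : Orthonormal 𝕜 (haar 𝕜) := by
  classical
  rw [orthonormal_iff_ite]
  intro R R'
  have h : inner 𝕜 (haar 𝕜 R) (haar 𝕜 R') = coef (haar 𝕜 R') R := rfl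
  rw [h, coef_eq_integral]
  have e : (fun p => haarFun 𝕜 R p * haar 𝕜 R' p) =ᵐ[volume] fun p =>
      (((haar1 R.1 p.1 * haar1 R'.1 p.1) * (haar1 R.2 p.2 * haar1 R'.2 p.2) : ℝ) : 𝕜) := by
    filter_upwards [(memLp_haarFun 𝕜 R').coeFn_toLp] with p hp
    rw [haar, hp]
    simp only [haarFun]
    push_cast
    ring
  rw [integral_congr_ae e, integral_ofReal,
    show (volume : Measure Torus2) = volume.prod volume from rfl,
    integral_prod_mul (fun s => haar1 R.1 s * haar1 R'.1 s) (fun t => haar1 R.2 t * haar1 R'.2 t),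
    integral_haar1_mul, integral_haar1_mul]
  by_cases h1 : R.1 = R'.1 <;> by_cases h2 : R.2 = R'.2 <;> simp [h1, h2, Prod.ext_iff]

/-! ### Functions with vanishing integrals in each variable -/

lemma integrable_L2T (f : L2T 𝕜) : Integrable f (volume : Measure Torus2) :=
  (Lp.memLp f).integrable (by norm_num)

lemma integrable_bdd_mul {u : Torus2 → ℝ} (hu : Measurable u) {C : ℝ} (hC : ∀ p, |u p| ≤ C)
    (f : L2T 𝕜) : Integrable (fun p => ((u p : ℝ) : 𝕜) * f p) (volume : Measure Torus2) :=
  (integrable_L2T f).bdd_mul (c := C) (RCLike.measurable_ofReal.comp hu).aestronglyMeasurable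
    (Filter.Eventually.of_forall fun p => by
      simp only [RCLike.norm_ofReal]; exact hC p)

lemma integral_torus (g : Torus2 → 𝕜) (hg : Integrable g) : ∫ p, g p = ∫ s, ∫ t, g (s, t) :=
  integral_prod g hg

lemma integral_torus_symm (g : Torus2 → 𝕜) (hg : Integrable g) :
    ∫ p, g p = ∫ t, ∫ s, g (s, t) :=
  integral_prod_symm g hg

lemma setIntegral_torus_left (g : Torus2 → 𝕜) (hg : Integrable g) (A : Set UnitAddCircle) :
    ∫ p in A ×ˢ univ, g p = ∫ s in A, ∫ t, g (s, t) := by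
  have := setIntegral_prod (μ := (volume : Measure UnitAddCircle))
    (ν := (volume : Measure UnitAddCircle)) g (s := A) (t := univ) (Integrable.integrableOn hg)
  rw [Measure.restrict_univ] at this
  exact this

lemma setIntegral_torus_right (g : Torus2 → 𝕜) (hg : Integrable g) (A : Set UnitAddCircle) :
    ∫ p in univ ×ˢ A, g p = ∫ t in A, ∫ s, g (s, t) := by
  have h : (volume : Measure Torus2).restrict (univ ×ˢ A) = volume.prod (volume.restrict A) := by
    rw [Measure.volume_eq_prod, ← Measure.prod_restrict, Measure.restrict_univ]
  rw [h]
  refine integral_prod_symm g ?_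
  rw [← h]
  exact hg.integrableOn

lemma MemL20.integral_fst {f : L2T 𝕜} (hf : MemL20 f) {u : UnitAddCircle → ℝ} (hu : Measurable u)
    {C : ℝ} (hC : ∀ s, |u s| ≤ C) : ∫ p : Torus2, ((u p.1 : ℝ) : 𝕜) * f p = 0 := by
  have hint := integrable_bdd_mul (hu.comp measurable_fst) (fun p => hC p.1) f
  rw [integral_torus (fun p : Torus2 => ((u p.1 : ℝ) : 𝕜) * f p) hint]
  have : (fun s => ∫ t, ((u s : ℝ) : 𝕜) * f (s, t)) =ᵐ[volume] fun _ => (0 : 𝕜) := by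
    filter_upwards [hf.1] with s hs
    rw [integral_const_mul, hs, mul_zero]
  exact (integral_congr_ae this).trans (integral_zero _ _)

lemma MemL20.integral_snd {f : L2T 𝕜} (hf : MemL20 f) {u : UnitAddCircle → ℝ} (hu : Measurable u)
    {C : ℝ} (hC : ∀ s, |u s| ≤ C) : ∫ p : Torus2, ((u p.2 : ℝ) : 𝕜) * f p = 0 := by
  have hint := integrable_bdd_mul (hu.comp measurable_snd) (fun p => hC p.2) f
  rw [integral_torus_symm (fun p : Torus2 => ((u p.2 : ℝ) : 𝕜) * f p) hint]
  have : (fun t => ∫ s, ((u t : ℝ) : 𝕜) * f (s, t)) =ᵐ[volume] fun _ => (0 : 𝕜) := by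
    filter_upwards [hf.2] with s hs
    rw [integral_const_mul, hs, mul_zero]
  exact (integral_congr_ae this).trans (integral_zero _ _)

lemma haarFun_rect_mul (k : ℕ × ℕ) (x p : Torus2) :
    haarFun 𝕜 (rect k x) x * haarFun 𝕜 (rect k x) p =
      (((haar1 (idx k.1 x.1) x.1 * haar1 (idx k.1 x.1) p.1) *
        (haar1 (idx k.2 x.2) x.2 * haar1 (idx k.2 x.2) p.2) : ℝ) : 𝕜) := by
  simp only [haarFun, rect]
  push_cast
  ring

/-- The mean of `f` over a rectangle in terms of the Haar coefficients of `f`. -/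
lemma MemL20.mean_eq {f : L2T 𝕜} (hf : MemL20 f) {R : DyadicRect} {x : Torus2} (hx : x ∈ R.toSet) :
    mean f R = ∑ k ∈ Finset.range R.1.1, ∑ l ∈ Finset.range R.2.1,
      haarFun 𝕜 (rect (k, l) x) x * coef f (rect (k, l) x) := by
  classical
  obtain ⟨h1, h2⟩ := hx
  set u : UnitAddCircle → ℝ := fun s =>
    ∑ k ∈ Finset.range R.1.1, haar1 (idx k x.1) x.1 * haar1 (idx k x.1) s with hu
  set v : UnitAddCircle → ℝ := fun t =>
    ∑ l ∈ Finset.range R.2.1, haar1 (idx l x.2) x.2 * haar1 (idx l x.2) t with hv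
  have kernel : ∀ (I : DyadicInterval) (y s : UnitAddCircle), y ∈ I.toSet →
      1 + ∑ k ∈ Finset.range I.1, haar1 (idx k y) y * haar1 (idx k y) s =
        I.toSet.indicator (fun _ => (2 : ℝ) ^ I.1) s := by
    intro I y s hy
    rw [one_add_sum_haar1, indicator_apply]
    refine if_congr ?_ rfl rfl
    rw [mem_toSet_iff.1 hy, mem_toSet_iff]
  have hum : Measurable u := Finset.measurable_sum _ fun k _ => (measurable_haar1 _).const_mul _
  have hvm : Measurable v := Finset.measurable_sum _ fun k _ => (measurable_haar1 _).const_mul _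
  have bound : ∀ (n : ℕ) (y s : UnitAddCircle),
      |∑ k ∈ Finset.range n, haar1 (idx k y) y * haar1 (idx k y) s| ≤
        ∑ k ∈ Finset.range n, Real.sqrt (2 ^ k) * Real.sqrt (2 ^ k) := by
    intro n y s
    refine (Finset.abs_sum_le_sum_abs _ _).trans (Finset.sum_le_sum fun k _ => ?_)
    rw [abs_mul]
    exact mul_le_mul (abs_haar1_le _ _) (abs_haar1_le _ _) (abs_nonneg _) (Real.sqrt_nonneg _)
  -- The averaging kernel is `(1 + u)(1 + v) = (1 + u) + v + u v`. The first two terms depend on one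
  -- variable only and are annihilated by `f`; only the product Haar terms survive.
  have i1 : ∫ p : Torus2, ((1 + u p.1 : ℝ) : 𝕜) * f p = 0 := by
    refine hf.integral_fst (u := fun s => 1 + u s) (measurable_const.add hum)
      (C := 1 + ∑ k ∈ Finset.range R.1.1, Real.sqrt (2 ^ k) * Real.sqrt (2 ^ k)) fun s => ?_
    exact (abs_add_le _ _).trans (by rw [abs_one]; gcongr; exact bound _ _ _)
  have i2 : ∫ p : Torus2, ((v p.2 : ℝ) : 𝕜) * f p = 0 :=
    hf.integral_snd hvm fun s => bound _ _ _
  have n1 : Integrable (fun p : Torus2 => ((1 + u p.1 : ℝ) : 𝕜) * f p) := by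
    refine integrable_bdd_mul (u := fun p => 1 + u p.1)
      (measurable_const.add (hum.comp measurable_fst))
      (C := 1 + ∑ k ∈ Finset.range R.1.1, Real.sqrt (2 ^ k) * Real.sqrt (2 ^ k)) (fun p => ?_) f
    exact (abs_add_le _ _).trans (by rw [abs_one]; gcongr; exact bound _ _ _)
  have n2 : Integrable (fun p : Torus2 => ((v p.2 : ℝ) : 𝕜) * f p) :=
    integrable_bdd_mul (u := fun p => v p.2) (hvm.comp measurable_snd) (fun p => bound _ _ _) f
  have n3 : ∀ R' : DyadicRect, Integrable (fun p : Torus2 => haarFun 𝕜 R' p * f p) := by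
    intro R'
    refine integrable_bdd_mul (u := fun p => haar1 R'.1 p.1 * haar1 R'.2 p.2)
      (((measurable_haar1 _).comp measurable_fst).mul ((measurable_haar1 _).comp measurable_snd))
      (C := Real.sqrt (2 ^ R'.1.1) * Real.sqrt (2 ^ R'.2.1)) (fun p => ?_) f
    rw [abs_mul]
    exact mul_le_mul (abs_haar1_le _ _) (abs_haar1_le _ _) (abs_nonneg _) (Real.sqrt_nonneg _)
  have n4 : ∀ k l, Integrable (fun p : Torus2 => haarFun 𝕜 (rect (k, l) x) x *
      (haarFun 𝕜 (rect (k, l) x) p * f p)) := fun k l => (n3 _).const_mul _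
  have hvol : (volume.real R.toSet)⁻¹ = 2 ^ R.1.1 * 2 ^ R.2.1 := by
    rw [Measure.real, volume_rect, ENNReal.toReal_inv, inv_inv, ← pow_add]
    simp
  have step : mean f R = ∫ p : Torus2, (((1 + u p.1) * (1 + v p.2) : ℝ) : 𝕜) * f p := by
    unfold mean
    rw [setAverage_eq, hvol, ← integral_indicator (measurableSet_rect R), RCLike.real_smul_eq_coe_mul,
      ← integral_const_mul]
    refine integral_congr_ae (Filter.Eventually.of_forall fun p => ?_)
    simp only [hu, hv]
    rw [kernel R.1 x.1 p.1 h1, kernel R.2 x.2 p.2 h2]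
    by_cases hp : p ∈ R.toSet
    · rw [indicator_of_mem hp, indicator_of_mem hp.1, indicator_of_mem hp.2]
    · rw [indicator_of_notMem hp]
      have : p.1 ∉ R.1.toSet ∨ p.2 ∉ R.2.toSet := by
        by_contra h
        push Not at h
        exact hp h
      rcases this with h | h <;> rw [indicator_of_notMem h] <;> simp
  rw [step]
  have expand : ∀ p : Torus2, (((1 + u p.1) * (1 + v p.2) : ℝ) : 𝕜) * f p =
      (((1 + u p.1 : ℝ) : 𝕜) * f p + ((v p.2 : ℝ) : 𝕜) * f p) +
      ∑ k ∈ Finset.range R.1.1, ∑ l ∈ Finset.range R.2.1, haarFun 𝕜 (rect (k, l) x) x *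
        (haarFun 𝕜 (rect (k, l) x) p * f p) := by
    intro p
    have : ∑ k ∈ Finset.range R.1.1, ∑ l ∈ Finset.range R.2.1, haarFun 𝕜 (rect (k, l) x) x *
        (haarFun 𝕜 (rect (k, l) x) p * f p) = ((u p.1 * v p.2 : ℝ) : 𝕜) * f p := by
      simp_rw [← mul_assoc, haarFun_rect_mul]
      rw [hu, hv, Finset.sum_mul_sum]
      push_cast
      rw [Finset.sum_mul]
      exact Finset.sum_congr rfl fun k _ => (Finset.sum_mul _ _ _).symm
    rw [this]
    push_cast
    ring
  simp_rw [expand]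
  have n12 : Integrable (fun p : Torus2 => ((1 + u p.1 : ℝ) : 𝕜) * f p + ((v p.2 : ℝ) : 𝕜) * f p) :=
    n1.add n2
  rw [integral_add n12 (integrable_finsetSum _ fun k _ => integrable_finsetSum _
    fun l _ => n4 k l), integral_add n1 n2, i1, i2, zero_add, zero_add,
    integral_finsetSum _ fun k _ => integrable_finsetSum _ fun l _ => n4 k l]
  refine Finset.sum_congr rfl fun k _ => ?_
  rw [integral_finsetSum _ fun l _ => n4 k l]
  refine Finset.sum_congr rfl fun l _ => ?_
  rw [integral_const_mul, coef_eq_integral]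

lemma setIntegral_haar_left (A : Set UnitAddCircle) (R : DyadicRect) :
    ∫ p in A ×ˢ univ, haar 𝕜 R p = 0 := by
  have e : ∫ p in A ×ˢ univ, haar 𝕜 R p = ∫ p in A ×ˢ univ, haarFun 𝕜 R p :=
    integral_congr_ae (ae_restrict_of_ae (memLp_haarFun 𝕜 R).coeFn_toLp)
  rw [e, show (volume : Measure Torus2) = volume.prod volume from rfl]
  unfold haarFun
  simp_rw [RCLike.ofReal_mul]
  rw [setIntegral_prod_mul (fun s => ((haar1 R.1 s : ℝ) : 𝕜)) (fun t => ((haar1 R.2 t : ℝ) : 𝕜)),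
    setIntegral_univ, integral_ofReal (f := haar1 R.2), integral_haar1, RCLike.ofReal_zero,
    mul_zero]

lemma setIntegral_haar_right (A : Set UnitAddCircle) (R : DyadicRect) :
    ∫ p in univ ×ˢ A, haar 𝕜 R p = 0 := by
  have e : ∫ p in univ ×ˢ A, haar 𝕜 R p = ∫ p in univ ×ˢ A, haarFun 𝕜 R p :=
    integral_congr_ae (ae_restrict_of_ae (memLp_haarFun 𝕜 R).coeFn_toLp)
  rw [e, show (volume : Measure Torus2) = volume.prod volume from rfl]
  unfold haarFun
  simp_rw [RCLike.ofReal_mul]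
  rw [setIntegral_prod_mul (fun s => ((haar1 R.1 s : ℝ) : 𝕜)) (fun t => ((haar1 R.2 t : ℝ) : 𝕜)),
    setIntegral_univ, integral_ofReal, integral_haar1, RCLike.ofReal_zero, zero_mul]

/-- Integration over `E` is the pairing with an indicator function, a continuous functional on `L²`,
so it can be applied term by term. -/
lemma setIntegral_eq_zero_of_hasSum {c : DyadicRect → 𝕜} {f : L2T 𝕜}
    (h : HasSum (fun R => c R • haar 𝕜 R) f) {E : Set Torus2} (hE : MeasurableSet E)
    (h0 : ∀ R, ∫ p in E, haar 𝕜 R p = 0) : ∫ p in E, f p = 0 := by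
  have hE' : (volume : Measure Torus2) E ≠ ∞ := measure_ne_top _ _
  rw [← L2.inner_indicatorConstLp_one (𝕜 := 𝕜) hE hE' f]
  have h1 := h.mapL (innerSL 𝕜 (indicatorConstLp 2 hE hE' (1 : 𝕜)))
  have h2 : ∀ R, innerSL 𝕜 (indicatorConstLp 2 hE hE' (1 : 𝕜)) (c R • haar 𝕜 R) = 0 := by
    intro R
    rw [innerSL_apply_apply, inner_smul_right, L2.inner_indicatorConstLp_one (𝕜 := 𝕜) hE hE', h0,
      mul_zero]
  simp only [h2] at h1
  exact (hasSum_zero.unique h1).symm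

/-- Haar series without averaging terms have vanishing integrals in each variable. -/
lemma memL20_of_hasSum {c : DyadicRect → 𝕜} {f : L2T 𝕜}
    (h : HasSum (fun R => c R • haar 𝕜 R) f) : MemL20 f := by
  have hint := integrable_L2T f
  constructor
  · refine (Integrable.integral_prod_left (μ := (volume : Measure UnitAddCircle))
      (ν := (volume : Measure UnitAddCircle)) hint).ae_eq_zero_of_forall_setIntegral_eq_zero
      fun A hA _ => ?_
    rw [← setIntegral_torus_left f hint]
    exact setIntegral_eq_zero_of_hasSum h (hA.prod MeasurableSet.univ)
      fun R => setIntegral_haar_left A R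
  · refine (Integrable.integral_prod_right (μ := (volume : Measure UnitAddCircle))
      (ν := (volume : Measure UnitAddCircle)) hint).ae_eq_zero_of_forall_setIntegral_eq_zero
      fun A hA _ => ?_
    rw [← setIntegral_torus_right f hint]
    exact setIntegral_eq_zero_of_hasSum h (MeasurableSet.univ.prod hA)
      fun R => setIntegral_haar_right A R

/-! ### Haar coefficients of series -/

lemma coef_of_hasSum {c : DyadicRect → 𝕜} {f : L2T 𝕜}
    (h : HasSum (fun R => c R • haar 𝕜 R) f) (R : DyadicRect) : coef f R = c R := by
  classical
  have h1 := h.mapL (innerSL 𝕜 (haar 𝕜 R))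
  have h2 : ∀ R', innerSL 𝕜 (haar 𝕜 R) (c R' • haar 𝕜 R') = if R' = R then c R else 0 := by
    intro R'
    rw [innerSL_apply_apply, inner_smul_right, orthonormal_iff_ite.1 orthonormal_haar R R']
    by_cases hR : R = R'
    · subst hR; simp
    · rw [if_neg hR, if_neg (Ne.symm hR), mul_zero]
  simp only [h2] at h1
  have h3 : HasSum (fun R' => if R' = R then c R else 0) (c R) := hasSum_ite_eq R (c R)
  exact h1.unique h3

lemma summable_haar_series {c : DyadicRect → 𝕜} (hc : Summable fun R => ‖c R‖ ^ 2) :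
    Summable fun R => c R • haar 𝕜 R := by
  have := ((orthonormal_haar (𝕜 := 𝕜)).orthogonalFamily.summable_iff_norm_sq_summable c).2 hc
  simpa [LinearIsometry.toSpanSingleton_apply] using this

lemma summable_coef_sq (f : L2T 𝕜) : Summable fun R => ‖coef f R‖ ^ 2 :=
  (orthonormal_haar (𝕜 := 𝕜)).inner_products_summable f

/-! ### The dyadic product BMO norm -/

/-- The sum of the squares of the Haar coefficients over the rectangles contained in `E`. -/
def energy (f : L2T 𝕜) (E : Set Torus2) : ℝ≥0∞ :=
  ∑' R : DyadicRect, iv (R.toSet ⊆ E) (‖coef f R‖ₑ ^ 2)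

lemma tsum_subtype_eq_energy (f : L2T 𝕜) (E : Set Torus2) :
    ∑' R : {R : DyadicRect // DyadicRect.toSet R ⊆ E}, ‖coef f R.1‖ₑ ^ 2 = energy f E := by
  rw [energy, ← tsum_subtype_eq_of_support_subset (s := {R : DyadicRect | R.toSet ⊆ E})]
  · exact tsum_congr fun R => (iv_pos R.2 _).symm
  · intro R hR
    by_contra h
    exact hR (iv_neg h _)

/-- Removes the root and the quotient. Null open sets are harmless: every dyadic rectangle has
positive measure, so their energy is `0`. -/
lemma bmoNorm_le_iff {f : L2T 𝕜} {C : ℝ≥0∞} :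
    bmoNorm f ≤ C ↔ ∀ Ω : Set Torus2, IsOpen Ω → energy f Ω ≤ C ^ 2 * volume Ω := by
  unfold bmoNorm
  rw [one_div, ENNReal.rpow_inv_le_iff (by norm_num), iSup₂_le_iff]
  have e2 : C ^ (2 : ℝ) = C ^ 2 := by exact_mod_cast ENNReal.rpow_natCast C 2
  simp only [tsum_subtype_eq_energy, e2]
  refine forall₂_congr fun Ω _ => ?_
  by_cases h0 : volume Ω = 0
  · have : energy f Ω = 0 := by
      rw [energy, ENNReal.tsum_eq_zero]
      intro R
      refine iv_neg (fun h => volume_rect_ne_zero R ?_) _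
      exact measure_mono_null h h0
    simp [this]
  · rw [ENNReal.inv_mul_le_iff h0 (measure_ne_top _ _), mul_comm]

lemma energy_mono (f : L2T 𝕜) {E F : Set Torus2} (h : E ⊆ F) : energy f E ≤ energy f F :=
  ENNReal.tsum_le_tsum fun _ => iv_mono fun h' => ⟨h'.trans h, le_rfl⟩

/-- Outer regularity extends the bound from open sets to all sets. This is needed because dyadic
rectangles, the enlargement and level sets need not be open. -/
lemma energy_le_of_bmoNorm_le {f : L2T 𝕜} {C : ℝ≥0∞} (hC : C ≠ ∞) (h : bmoNorm f ≤ C)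
    (E : Set Torus2) : energy f E ≤ C ^ 2 * volume E := by
  rw [bmoNorm_le_iff] at h
  -- Multiplication by `C ^ 2` commutes with the infimum only for a nonzero finite factor; for `C =
  -- 0` all the energy on the torus vanishes.
  rcases eq_or_ne C 0 with rfl | h0
  · refine (energy_mono f (subset_univ E)).trans ((h univ isOpen_univ).trans ?_)
    simp
  · rw [E.measure_eq_iInf_isOpen]
    have h1 : C ^ 2 ≠ 0 := pow_ne_zero 2 h0
    have h2 : C ^ 2 ≠ ∞ := ENNReal.pow_ne_top hC
    simp only [ENNReal.mul_iInf_of_ne h1 h2]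
    exact le_iInf fun U => le_iInf fun hEU => le_iInf fun hU =>
      (energy_mono f hEU).trans (h U hU)

/-! ### The projections `Q j` -/

/-- Dyadic rectangles sorted by their scale. -/
def rectEquiv : (Σ k : ℕ × ℕ, Fin (2 ^ k.1) × Fin (2 ^ k.2)) ≃ DyadicRect where
  toFun x := (⟨x.1.1, x.2.1⟩, ⟨x.1.2, x.2.2⟩)
  invFun R := ⟨(R.1.1, R.2.1), (R.1.2, R.2.2)⟩
  left_inv _ := rfl
  right_inv _ := rfl

open Classical in
-- The Haar series converges unconditionally by orthogonality, so it may be regrouped by scale into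
-- the finite blocks `martDiff`.
lemma hasSum_Q (j : ℕ × ℕ) (f : L2T 𝕜) :
    HasSum (fun R : DyadicRect => (if j ≤ R.scale then coef f R else 0) • haar 𝕜 R) (Q j f) := by
  set c : DyadicRect → 𝕜 := fun R => if j ≤ R.scale then coef f R else 0 with hc
  have hsum : Summable fun R => ‖c R‖ ^ 2 := by
    refine Summable.of_nonneg_of_le (fun R => by positivity) (fun R => ?_) (summable_coef_sq f)
    by_cases h : j ≤ R.scale
    · simp [hc, h]
    · simp [hc, h]
  obtain ⟨F, hF⟩ := summable_haar_series hsum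
  have h1 := (rectEquiv.hasSum_iff.2 hF).sigma fun k => hasSum_fintype _
  have h2 : (fun k : ℕ × ℕ => ∑ m : Fin (2 ^ k.1) × Fin (2 ^ k.2),
      ((fun R => c R • haar 𝕜 R) ∘ rectEquiv) ⟨k, m⟩) =
      {k : ℕ × ℕ | j ≤ k}.indicator fun k => martDiff k f := by
    ext1 k
    by_cases h : j ≤ k
    · rw [indicator_of_mem (by exact h), martDiff]
      refine Finset.sum_congr rfl fun m _ => ?_
      have : j ≤ (rectEquiv ⟨k, m⟩).scale := h
      simp only [Function.comp, hc, if_pos this]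
      rfl
    · rw [indicator_of_notMem (by exact h)]
      refine Finset.sum_eq_zero fun m _ => ?_
      have : ¬ j ≤ (rectEquiv ⟨k, m⟩).scale := h
      simp only [Function.comp, hc, if_neg this, zero_smul]
  rw [h2, ← hasSum_subtype_iff_indicator] at h1
  have h3 : Q j f = F := h1.tsum_eq
  rw [h3]
  exact hF

open Classical in
lemma coef_Q (j : ℕ × ℕ) (f : L2T 𝕜) (R : DyadicRect) :
    coef (Q j f) R = if j ≤ R.scale then coef f R else 0 :=
  coef_of_hasSum (c := fun R => if j ≤ R.scale then coef f R else 0) (hasSum_Q j f) R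

lemma energy_Q (j : ℕ × ℕ) (f : L2T 𝕜) (E : Set Torus2) :
    energy (Q j f) E = ∑' R : DyadicRect, iv (j ≤ R.scale ∧ R.toSet ⊆ E) (‖coef f R‖ₑ ^ 2) := by
  classical
  refine tsum_congr fun R => ?_
  rw [coef_Q, and_comm, ← iv_iv]
  by_cases h : j ≤ R.scale
  · rw [if_pos h, iv_pos h]
  · rw [if_neg h, iv_neg h]; simp

lemma bmoNorm_congr {f g : L2T 𝕜} (h : ∀ R, coef f R = coef g R) : bmoNorm f = bmoNorm g := by
  simp only [bmoNorm, h]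

lemma lmoBound_congr {f g : L2T 𝕜} (h : ∀ R, coef f R = coef g R) {C : ℝ≥0} :
    LMOBound f C ↔ LMOBound g C := by
  classical
  unfold LMOBound
  refine forall_congr' fun j => ?_
  rw [bmoNorm_congr (f := Q j f) (g := Q j g) fun R => by rw [coef_Q, coef_Q, h]]

lemma LMOBound.Q_one {φ : L2T 𝕜} {C : ℝ≥0} (h : LMOBound φ C) : LMOBound (Q (1, 1) φ) C := by
  intro j
  rw [bmoNorm_le_iff]
  intro Ω hΩ
  refine le_trans ?_ (bmoNorm_le_iff.1 (h j) Ω hΩ)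
  rw [energy_Q, energy_Q]
  refine ENNReal.tsum_le_tsum fun R => iv_mono fun h' => ⟨h', ?_⟩
  classical
  rw [coef_Q]
  by_cases h1 : (1, 1) ≤ R.scale
  · rw [if_pos h1]
  · rw [if_neg h1]; simp

/-! ### The paraproduct -/

lemma coef_paraproduct {φ f : L2T 𝕜} (h : Summable (paraTerm φ f)) (R : DyadicRect) :
    coef (paraproduct φ f) R = coef φ R * mean f R :=
  coef_of_hasSum (c := fun R => coef φ R * mean f R) h.hasSum R

/-- No dyadic interval is longer than the whole circle, so the sum for the mean is empty. This is
why the coefficients removed by `Q (1, 1)` play no role. -/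
lemma MemL20.mean_eq_zero {f : L2T 𝕜} (hf : MemL20 f) {R : DyadicRect}
    (hR : ¬ (1 ≤ R.1.1 ∧ 1 ≤ R.2.1)) : mean f R = 0 := by
  obtain ⟨x, hx⟩ := rect_nonempty R
  rw [hf.mean_eq hx]
  rcases Nat.eq_zero_or_pos R.1.1 with h | h
  · rw [h, Finset.range_zero, Finset.sum_empty]
  · have : R.2.1 = 0 := by omega
    rw [this]
    simp

/-- The coefficient of `f` at `R` divided by `|R|^{1/2}`. -/
def normCoef (f : L2T 𝕜) (R : DyadicRect) : ℝ≥0∞ :=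
  ENNReal.ofReal (Real.sqrt (2 ^ R.1.1) * Real.sqrt (2 ^ R.2.1)) * ‖coef f R‖ₑ

lemma volume_mul_normCoef_sq (f : L2T 𝕜) (R : DyadicRect) :
    volume R.toSet * normCoef f R ^ 2 = ‖coef f R‖ₑ ^ 2 := by
  have h : ENNReal.ofReal (Real.sqrt (2 ^ R.1.1) * Real.sqrt (2 ^ R.2.1)) ^ 2 =
      2 ^ (R.1.1 + R.2.1) := by
    rw [← ENNReal.ofReal_pow (by positivity), mul_pow, Real.sq_sqrt (by positivity),
      Real.sq_sqrt (by positivity), ← pow_add, ENNReal.ofReal_pow (by norm_num)]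
    simp
  rw [normCoef, mul_pow, h, volume_rect, ← mul_assoc, ENNReal.inv_mul_cancel (by simp) (by simp),
    one_mul]

lemma enorm_haarFun_le (R : DyadicRect) (x : Torus2) :
    ‖haarFun 𝕜 R x‖ₑ ≤ ENNReal.ofReal (Real.sqrt (2 ^ R.1.1) * Real.sqrt (2 ^ R.2.1)) := by
  rw [← ofReal_norm]
  refine ENNReal.ofReal_le_ofReal ?_
  rw [haarFun, RCLike.norm_ofReal, abs_mul]
  exact mul_le_mul (abs_haar1_le _ _) (abs_haar1_le _ _) (abs_nonneg _) (Real.sqrt_nonneg _)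

lemma MemL20.enorm_mean_le {f : L2T 𝕜} (hf : MemL20 f) {R : DyadicRect} {x : Torus2}
    (hx : x ∈ R.toSet) :
    ‖mean f R‖ₑ ≤ ∑ k ∈ Finset.range R.1.1, ∑ l ∈ Finset.range R.2.1,
      normCoef f (rect (k, l) x) := by
  rw [hf.mean_eq hx]
  refine (enorm_sum_le _ _).trans (Finset.sum_le_sum fun k _ => ?_)
  refine (enorm_sum_le _ _).trans (Finset.sum_le_sum fun l _ => ?_)
  rw [enorm_mul, normCoef]
  gcongr
  exact enorm_haarFun_le _ _

lemma isCarleson_normCoef {f : L2T 𝕜} (hf : bmoNorm f < ∞) :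
    IsCarleson (normCoef f) (bmoNorm f ^ 2) := by
  intro E
  simp_rw [volume_mul_normCoef_sq]
  exact energy_le_of_bmoNorm_le hf.ne le_rfl E

/-- The LMO condition at `j = (2 ^ a, 2 ^ b)`; the logarithmic decay becomes geometric in the block
index. -/
lemma LMOBound.carleson {φ : L2T 𝕜} {C : ℝ≥0} (h : LMOBound φ C) (a b : ℕ) (E : Set Torus2) :
    ∑' R : DyadicRect, iv ((2 ^ a ≤ R.1.1 ∧ 2 ^ b ≤ R.2.1) ∧ R.toSet ⊆ E) (‖coef φ R‖ₑ ^ 2) ≤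
      C ^ 2 * (half ^ (2 * a) * half ^ (2 * b)) * volume E := by
  have hpow : ∀ n : ℕ, (2 : ℝ≥0∞) ^ n ≤ (((2 ^ n : ℕ) : ℝ≥0∞) + 1) := fun n => by
    push_cast; exact le_self_add
  have hle : bmoNorm (Q (2 ^ a, 2 ^ b) φ) ≤ C * (half ^ a * half ^ b) := by
    refine (h (2 ^ a, 2 ^ b)).trans ?_
    gcongr
    rw [half, ← ENNReal.inv_pow, ← ENNReal.inv_pow,
      ← ENNReal.mul_inv (Or.inl (by simp)) (Or.inl (by simp)), ENNReal.inv_le_inv]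
    exact mul_le_mul' (hpow a) (hpow b)
  have hfin : (C : ℝ≥0∞) * (half ^ a * half ^ b) ≠ ∞ := by
    have : half ≠ ∞ := by simp [half]
    exact ENNReal.mul_ne_top ENNReal.coe_ne_top
      (ENNReal.mul_ne_top (ENNReal.pow_ne_top this) (ENNReal.pow_ne_top this))
  have := energy_le_of_bmoNorm_le hfin hle E
  rw [energy_Q] at this
  refine this.trans_eq ?_
  ring

lemma tsum_paraproduct_coef_le {φ f : L2T 𝕜} {C : ℝ≥0} (h : LMOBound (Q (1, 1) φ) C)
    (hf : MemBMO f) {Ω : Set Torus2} (hΩ : MeasurableSet Ω) :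
    ∑' R : DyadicRect, iv (R.toSet ⊆ Ω) (‖coef φ R * mean f R‖ₑ ^ 2) ≤
      (50 * C * bmoNorm f) ^ 2 * volume Ω := by
  classical
  -- The main estimate with `W = C ^ 2` and `A = ‖f‖²`; its constant `2500` is the square of `50`.
  refine le_trans (ENNReal.tsum_le_tsum fun R => ?_)
    ((tsum_mul_sq_sum_le (isCarleson_normCoef hf.2) h.carleson
      (m := fun R => ‖mean f R‖ₑ) (fun R x hx => hf.1.enorm_mean_le hx) hΩ).trans_eq (by ring))
  by_cases h1 : 1 ≤ R.1.1 ∧ 1 ≤ R.2.1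
  · refine iv_mono fun h' => ⟨⟨h1, h'⟩, ?_⟩
    have h2 : (1, 1) ≤ R.scale := h1
    rw [coef_Q, if_pos h2, enorm_mul, mul_pow]
  · rw [hf.1.mean_eq_zero h1]
    simp [iv]

lemma summable_sq_of_tsum_enorm_ne_top {c : DyadicRect → 𝕜} (h : ∑' R, ‖c R‖ₑ ^ 2 ≠ ∞) :
    Summable fun R => ‖c R‖ ^ 2 := by
  have := ENNReal.summable_toReal h
  simpa using this

/-- A symbol whose part `Q (1, 1) φ` is in `LMO` defines a bounded paraproduct. -/
theorem paraproductBound_of_lmoBound {φ : L2T 𝕜} {C : ℝ≥0} (h : LMOBound (Q (1, 1) φ) C) :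
    ParaproductBound φ (50 * C) := by
  intro f hf
  -- The estimate on the whole torus makes the coefficients square summable, which is unconditional
  -- convergence in `L²`.
  have hs : Summable (paraTerm φ f) := by
    refine summable_haar_series (c := fun R => coef φ R * mean f R)
      (summable_sq_of_tsum_enorm_ne_top ?_)
    have := tsum_paraproduct_coef_le h hf MeasurableSet.univ
    simp only [iv_pos (subset_univ _)] at this
    refine ne_top_of_le_ne_top ?_ this
    exact ENNReal.mul_ne_top (ENNReal.pow_ne_top (ENNReal.mul_ne_top
      (ENNReal.mul_ne_top (by simp) ENNReal.coe_ne_top) hf.2.ne)) (measure_ne_top _ _)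
  have hb : bmoNorm (paraproduct φ f) ≤ 50 * C * bmoNorm f := by
    rw [bmoNorm_le_iff]
    intro Ω hΩ
    simp only [energy, coef_paraproduct hs]
    exact tsum_paraproduct_coef_le h hf hΩ.measurableSet
  refine ⟨hs, ⟨memL20_of_hasSum (c := fun R => coef φ R * mean f R) hs.hasSum, ?_⟩, ?_⟩
  · refine hb.trans_lt ?_
    exact (ENNReal.mul_ne_top (ENNReal.mul_ne_top (by simp) ENNReal.coe_ne_top) hf.2.ne).lt_top
  · simpa using hb

/-! ### Test functions -/

lemma two_mul_volume_idx_diff (k : ℕ) (s : UnitAddCircle) :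
    2 * volume ((idx k s).toSet \ (idx (k + 1) s).toSet) = volume (idx k s).toSet := by
  have hsub := toSet_idx_subset (Nat.le_succ k) s
  have h1 : volume (idx k s).toSet = 2 * volume (idx (k + 1) s).toSet := by
    rw [volume_toSet_interval, volume_toSet_interval, idx_fst, idx_fst, pow_succ, mul_comm,
      ENNReal.mul_inv (Or.inl (by simp)) (Or.inl (by simp)), mul_assoc,
      ENNReal.inv_mul_cancel (by simp) (by simp), mul_one]
  have h2 := measure_sdiff_add_inter (μ := volume) (idx k s).toSet
    (measurableSet_toSet (idx (k + 1) s))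
  rw [inter_eq_right.2 hsub, h1, two_mul,
    ENNReal.add_left_inj (volume_interval_ne_top _)] at h2
  rw [h2, h1]

/-- The points that lie in `rect k x`, but in neither coordinate in the next smaller interval. -/
def corner (x : Torus2) (k : ℕ × ℕ) : Set Torus2 :=
  ((idx k.1 x.1).toSet \ (idx (k.1 + 1) x.1).toSet) ×ˢ
    ((idx k.2 x.2).toSet \ (idx (k.2 + 1) x.2).toSet)

lemma four_mul_volume_corner (x : Torus2) (k : ℕ × ℕ) :
    4 * volume (corner x k) = volume (rect k x).toSet := by
  rw [volume_rect', show volume (corner x k) = _ from Measure.prod_prod _ _]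
  simp only [rect]
  rw [← two_mul_volume_idx_diff k.1, ← two_mul_volume_idx_diff k.2]
  ring

lemma measurableSet_corner (x : Torus2) (k : ℕ × ℕ) : MeasurableSet (corner x k) :=
  ((measurableSet_toSet _).diff (measurableSet_toSet _)).prod
    ((measurableSet_toSet _).diff (measurableSet_toSet _))

lemma corner_subset (x : Torus2) (k : ℕ × ℕ) : corner x k ⊆ (rect k x).toSet :=
  prod_mono sdiff_subset sdiff_subset

lemma eq_of_mem_idx_diff {s t : UnitAddCircle} {k l : ℕ}
    (hk : t ∈ (idx k s).toSet \ (idx (k + 1) s).toSet)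
    (hl : t ∈ (idx l s).toSet \ (idx (l + 1) s).toSet) : k = l := by
  rcases lt_trichotomy k l with h | h | h
  · exact absurd (toSet_idx_subset h s hl.1) hk.2
  · exact h
  · exact absurd (toSet_idx_subset h s hk.1) hl.2

/-- The rectangles through `x` overlap, but their corners away from `x` are pairwise disjoint and
carry a quarter of the measure each. -/
lemma tsum_volume_rect_le (x : Torus2) (E : Set Torus2) :
    ∑' k, iv ((rect k x).toSet ⊆ E) (volume (rect k x).toSet) ≤ 4 * volume E := by
  have hd : Pairwise (Function.onFun Disjoint (corner x)) := by
    intro k l hkl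
    rw [Function.onFun, Set.disjoint_left]
    intro y hy hy'
    exact hkl (Prod.ext (eq_of_mem_idx_diff hy.1 hy'.1) (eq_of_mem_idx_diff hy.2 hy'.2))
  have hd' : Pairwise (Function.onFun Disjoint
      fun k : {k // (rect k x).toSet ⊆ E} => corner x k.1) :=
    fun k l hkl => hd fun h => hkl (Subtype.ext h)
  calc ∑' k, iv ((rect k x).toSet ⊆ E) (volume (rect k x).toSet)
      = ∑' k : {k // (rect k x).toSet ⊆ E}, volume (rect k.1 x).toSet := by
        rw [← tsum_subtype_eq_of_support_subset (s := {k | (rect k x).toSet ⊆ E})]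
        · exact tsum_congr fun k => iv_pos k.2 _
        · intro k hk
          by_contra h
          exact hk (iv_neg h _)
    _ = 4 * volume (⋃ k : {k // (rect k x).toSet ⊆ E}, corner x k.1) := by
        rw [measure_iUnion hd' fun k => measurableSet_corner x k.1, ← ENNReal.tsum_mul_left]
        exact tsum_congr fun k => (four_mul_volume_corner x k.1).symm
    _ ≤ 4 * volume E := by
        gcongr
        exact iUnion_subset fun k => (corner_subset x k.1).trans k.2

lemma haarFun_mul_self {R : DyadicRect} {x : Torus2} (hx : x ∈ R.toSet) :
    haarFun 𝕜 R x * haarFun 𝕜 R x = ((2 ^ (R.1.1 + R.2.1) : ℝ) : 𝕜) := by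
  rw [haarFun, ← RCLike.ofReal_mul]
  congr 1
  rw [pow_add, ← haar1_sq hx.1, ← haar1_sq hx.2]
  ring

open Classical in
/-- The Haar coefficients of the test function at `x`, of order `j`. -/
def testCoef (𝕜 : Type*) [RCLike 𝕜] (j : ℕ × ℕ) (x : Torus2) (R : DyadicRect) : 𝕜 :=
  if (R.1.1 < j.1 ∧ R.2.1 < j.2) ∧ x ∈ R.toSet then
    (((2 ^ (R.1.1 + R.2.1))⁻¹ : ℝ) : 𝕜) * haarFun 𝕜 R x else 0

lemma enorm_testCoef_sq_le (j : ℕ × ℕ) (x : Torus2) (R : DyadicRect) :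
    ‖testCoef 𝕜 j x R‖ₑ ^ 2 ≤ volume R.toSet := by
  unfold testCoef
  split_ifs with h
  · have h2 : (2 : ℝ) ^ (R.1.1 + R.2.1) ≠ 0 := by positivity
    have e : ((((2 ^ (R.1.1 + R.2.1))⁻¹ : ℝ) : 𝕜) * haarFun 𝕜 R x) ^ 2 =
        (((2 ^ (R.1.1 + R.2.1))⁻¹ : ℝ) : 𝕜) := by
      rw [mul_pow, sq (haarFun 𝕜 R x), haarFun_mul_self h.2, ← RCLike.ofReal_pow,
        ← RCLike.ofReal_mul]
      congr 1
      field_simp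
    rw [← enorm_pow, e, ← ofReal_norm, RCLike.norm_ofReal, abs_of_nonneg (by positivity),
      ENNReal.ofReal_inv_of_pos (by positivity), ENNReal.ofReal_pow (by norm_num), volume_rect]
    simp
  · simp

lemma testCoef_eq_zero_of_notMem_range {j : ℕ × ℕ} {x : Torus2} {R : DyadicRect}
    (hR : R ∉ range fun k => rect k x) : testCoef 𝕜 j x R = 0 := by
  refine if_neg fun h => hR ⟨R.scale, mem_rect_iff.1 h.2⟩

lemma exists_testFunction (𝕜 : Type*) [RCLike 𝕜] (j : ℕ × ℕ) (x : Torus2) :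
    ∃ f : L2T 𝕜, MemL20 f ∧ ∀ R, coef f R = testCoef 𝕜 j x R := by
  have hfin : (Function.support fun R => testCoef 𝕜 j x R • haar 𝕜 R).Finite := by
    refine ((Finset.range j.1 ×ˢ Finset.range j.2).finite_toSet.image fun k => rect k x).subset ?_
    intro R hR
    have hne : testCoef 𝕜 j x R ≠ 0 := fun h => hR (by simp [h])
    have h : (R.1.1 < j.1 ∧ R.2.1 < j.2) ∧ x ∈ R.toSet := by
      by_contra hc
      exact hne (if_neg hc)
    exact ⟨R.scale, by simpa [DyadicRect.scale] using h.1, mem_rect_iff.1 h.2⟩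
  obtain ⟨f, hf⟩ := summable_of_hasFiniteSupport (L := .unconditional _) hfin
  exact ⟨f, memL20_of_hasSum hf, coef_of_hasSum hf⟩

/-- A nonzero coefficient has square `|R|² |R|^{-1} = |R|` and sits at a rectangle through `x`; the
bound `4 |Ω|` for the sum of these measures gives the norm `2`. -/
lemma bmoNorm_testFunction_le {j : ℕ × ℕ} {x : Torus2} {f : L2T 𝕜}
    (hf : ∀ R, coef f R = testCoef 𝕜 j x R) : bmoNorm f ≤ 2 := by
  rw [bmoNorm_le_iff]
  intro Ω _
  have hinj : Function.Injective (fun k => rect k x) := fun k l h => by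
    have := congrArg DyadicRect.scale h
    simpa using this
  calc energy f Ω = ∑' k, iv ((rect k x).toSet ⊆ Ω) (‖coef f (rect k x)‖ₑ ^ 2) := by
        rw [energy, hinj.tsum_eq (f := fun R : DyadicRect => iv (R.toSet ⊆ Ω) (‖coef f R‖ₑ ^ 2))]
        intro R hR
        by_contra h
        refine hR ?_
        change iv _ (‖coef f R‖ₑ ^ 2) = 0
        rw [hf, testCoef_eq_zero_of_notMem_range h]
        simp [iv]
    _ ≤ ∑' k, iv ((rect k x).toSet ⊆ Ω) (volume (rect k x).toSet) := by
        refine ENNReal.tsum_le_tsum fun k => iv_mono fun h => ⟨h, ?_⟩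
        rw [hf]
        exact enorm_testCoef_sq_le j x _
    _ ≤ 4 * volume Ω := tsum_volume_rect_le x Ω
    _ = _ := by norm_num

lemma haarFun_rect_congr {j k : ℕ × ℕ} {x y : Torus2} (h1 : k.1 < j.1) (h2 : k.2 < j.2)
    (hy : y ∈ (rect j x).toSet) : haarFun 𝕜 (rect k x) y = haarFun 𝕜 (rect k x) x := by
  have e1 : haar1 (rect k x).1 y.1 = haar1 (rect k x).1 x.1 :=
    haar1_eq_of_idx_eq (idx_eq_of_le (l := j.1) h1 (mem_toSet_idx_iff.1 hy.1))
  have e2 : haar1 (rect k x).2 y.2 = haar1 (rect k x).2 x.2 :=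
    haar1_eq_of_idx_eq (idx_eq_of_le (l := j.2) h2 (mem_toSet_idx_iff.1 hy.2))
  rw [haarFun, haarFun, e1, e2]

/-- On the rectangle of scale `j` around `x` every coarser Haar function is constant, so each of the
`j₁ j₂` terms equals `|S| h_S(x)² = 1`. -/
lemma mean_testFunction {j : ℕ × ℕ} {x : Torus2} {f : L2T 𝕜} (hf0 : MemL20 f)
    (hf : ∀ R, coef f R = testCoef 𝕜 j x R) {R : DyadicRect} (hj : j ≤ R.scale)
    (hR : R.toSet ⊆ (rect j x).toSet) : mean f R = (j.1 : 𝕜) * (j.2 : 𝕜) := by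
  obtain ⟨y, hy⟩ := rect_nonempty R
  have hyx := hR hy
  rw [hf0.mean_eq hy]
  have hterm : ∀ k l, haarFun 𝕜 (rect (k, l) y) y * coef f (rect (k, l) y) =
      if k < j.1 ∧ l < j.2 then 1 else 0 := by
    intro k l
    rw [hf, testCoef]
    by_cases h : k < j.1 ∧ l < j.2
    · have e : rect (k, l) y = rect (k, l) x :=
        rect_eq_of_le (Prod.mk_le_mk.2 ⟨h.1.le, h.2.le⟩) (mem_toSet_rect_iff.1 hyx)
      rw [if_pos h, e, if_pos ⟨h, mem_toSet_rect _ _⟩, haarFun_rect_congr h.1 h.2 hyx,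
        mul_left_comm, haarFun_mul_self (mem_toSet_rect _ _), ← RCLike.ofReal_mul,
        inv_mul_cancel₀ (by positivity), RCLike.ofReal_one]
    · rw [if_neg h, if_neg fun h' => h h'.1, mul_zero]
  simp_rw [hterm]
  have hsum : ∀ k, ∑ l ∈ Finset.range R.2.1, (if k < j.1 ∧ l < j.2 then (1 : 𝕜) else 0) =
      if k < j.1 then (j.2 : 𝕜) else 0 := by
    intro k
    by_cases hk : k < j.1
    · simp only [hk, true_and, if_true]
      rw [Finset.sum_ite, Finset.sum_const_zero, add_zero, Finset.sum_const]
      have : (Finset.range R.2.1).filter (fun l => l < j.2) = Finset.range j.2 := by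
        ext l
        have := hj.2
        simp only [Finset.mem_filter, Finset.mem_range, DyadicRect.scale] at this ⊢
        omega
      rw [this, Finset.card_range, nsmul_eq_mul, mul_one]
    · simp [hk]
  simp_rw [hsum]
  rw [Finset.sum_ite, Finset.sum_const_zero, add_zero, Finset.sum_const]
  have : (Finset.range R.1.1).filter (fun k => k < j.1) = Finset.range j.1 := by
    ext l
    have := hj.1
    simp only [Finset.mem_filter, Finset.mem_range, DyadicRect.scale] at this ⊢
    omega
  rw [this, Finset.card_range, nsmul_eq_mul]

/-! ### Necessity -/

/-- Inside `rect j x` the paraproduct of the test function has coefficients `j₁ j₂ φ_R`; its norm is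
at most `2 C`. -/
lemma local_energy_le {φ : L2T 𝕜} {C : ℝ≥0} (h : ParaproductBound φ C) (j : ℕ × ℕ) (x : Torus2)
    (Ω : Set Torus2) :
    (∑' R : DyadicRect, iv (j ≤ R.scale ∧ R.toSet ⊆ Ω ∩ (rect j x).toSet) (‖coef φ R‖ₑ ^ 2)) *
      ((j.1 : ℝ≥0∞) * j.2) ^ 2 ≤ (2 * C) ^ 2 * volume (Ω ∩ (rect j x).toSet) := by
  obtain ⟨f, hf0, hf⟩ := exists_testFunction 𝕜 j x
  have hb := bmoNorm_testFunction_le hf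
  obtain ⟨hs, -, hle⟩ := h f ⟨hf0, hb.trans_lt (by simp)⟩
  have hle' : bmoNorm (paraproduct φ f) ≤ 2 * C := hle.trans (by rw [mul_comm 2]; gcongr)
  refine le_trans ?_ (energy_le_of_bmoNorm_le (by finiteness) hle' _)
  rw [← ENNReal.tsum_mul_right]
  refine ENNReal.tsum_le_tsum fun R => ?_
  rw [mul_comm, mul_iv]
  refine iv_mono fun hR => ⟨hR.2, le_of_eq ?_⟩
  rw [coef_paraproduct hs, mean_testFunction hf0 hf hR.1 (hR.2.trans inter_subset_right),
    enorm_mul, enorm_mul]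
  have hn : ∀ n : ℕ, ‖(n : 𝕜)‖ₑ = n := fun n => by
    rw [← ofReal_norm, RCLike.norm_natCast]; simp
  rw [hn, hn]
  ring

/-- A rectangle of scale at least `j` lies in one of the disjoint rectangles of scale `j`, so the
local estimates add up. -/
lemma energy_mul_sq_le {φ : L2T 𝕜} {C : ℝ≥0} (h : ParaproductBound φ C) (j : ℕ × ℕ)
    {Ω : Set Torus2} (hΩ : MeasurableSet Ω) :
    (∑' R : DyadicRect, iv (j ≤ R.scale ∧ R.toSet ⊆ Ω) (‖coef φ R‖ₑ ^ 2)) *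
      ((j.1 : ℝ≥0∞) * j.2) ^ 2 ≤ (2 * C) ^ 2 * volume Ω := by
  have hS : ∀ S : {S : DyadicRect // S.scale = j}, ∃ x, rect j x = S.1 := by
    rintro ⟨S, rfl⟩
    obtain ⟨x, hx⟩ := rect_nonempty S
    exact ⟨x, mem_rect_iff.1 hx⟩
  have hd : Pairwise (Function.onFun Disjoint
      fun S : {S : DyadicRect // S.scale = j} => Ω ∩ S.1.toSet) := by
    intro S S' hne
    rw [Function.onFun, Set.disjoint_left]
    rintro y ⟨-, hy⟩ ⟨-, hy'⟩
    refine hne (Subtype.ext ?_)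
    rw [← mem_rect_iff.1 hy, ← mem_rect_iff.1 hy', S.2, S'.2]
  calc _ ≤ (∑' S : {S : DyadicRect // S.scale = j}, ∑' R : DyadicRect,
        iv (j ≤ R.scale ∧ R.toSet ⊆ Ω ∩ S.1.toSet) (‖coef φ R‖ₑ ^ 2)) *
        ((j.1 : ℝ≥0∞) * j.2) ^ 2 := by
        rw [ENNReal.tsum_comm]
        gcongr with R
        refine iv_le_of fun hR => ?_
        obtain ⟨x, hx⟩ := rect_nonempty R
        have hsub : R.toSet ⊆ (rect j x).toSet := by
          conv_lhs => rw [← mem_rect_iff.1 hx]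
          exact toSet_rect_subset hR.1 x
        refine le_trans ?_ (ENNReal.le_tsum ⟨rect j x, rfl⟩)
        rw [iv_pos ⟨hR.1, subset_inter hR.2 hsub⟩]
    _ = ∑' S : {S : DyadicRect // S.scale = j}, (∑' R : DyadicRect,
        iv (j ≤ R.scale ∧ R.toSet ⊆ Ω ∩ S.1.toSet) (‖coef φ R‖ₑ ^ 2)) *
        ((j.1 : ℝ≥0∞) * j.2) ^ 2 := ENNReal.tsum_mul_right.symm
    _ ≤ ∑' S : {S : DyadicRect // S.scale = j}, (2 * C) ^ 2 * volume (Ω ∩ S.1.toSet) := by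
        refine ENNReal.tsum_le_tsum fun S => ?_
        obtain ⟨x, hx⟩ := hS S
        rw [← hx]
        exact local_energy_le h j x Ω
    _ = (2 * C) ^ 2 * volume (⋃ S : {S : DyadicRect // S.scale = j}, Ω ∩ S.1.toSet) := by
        rw [ENNReal.tsum_mul_left, measure_iUnion hd fun S => hΩ.inter (measurableSet_rect S.1)]
    _ ≤ _ := by
        gcongr
        exact iUnion_subset fun S => inter_subset_left

/-- If the paraproduct with symbol `φ` is bounded, then `Q (1, 1) φ` is in `LMO`. -/
theorem lmoBound_of_paraproductBound {φ : L2T 𝕜} {C : ℝ≥0} (h : ParaproductBound φ C) :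
    LMOBound (Q (1, 1) φ) (8 * C) := by
  classical
  intro j
  rw [bmoNorm_le_iff]
  intro Ω hΩ
  -- The test function is trivial if `j.1 = 0` or `j.2 = 0`, but `Q (1, 1)` has removed scale `0`.
  -- Replacing `j` by `j'` loses nothing, and `n + 1 ≤ 2 max n 1` in each variable turns the
  -- constant `2` into `8`.
  set j' : ℕ × ℕ := (max j.1 1, max j.2 1) with hj'
  set M : ℝ≥0∞ := ((j.1 : ℝ≥0∞) + 1) * ((j.2 : ℝ≥0∞) + 1) with hM
  have hM0 : M ≠ 0 := by simp [hM]
  have hMt : M ≠ ∞ := by rw [hM]; finiteness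
  set X := ∑' R : DyadicRect, iv (j' ≤ R.scale ∧ R.toSet ⊆ Ω) (‖coef φ R‖ₑ ^ 2) with hX
  have hEX : energy (Q j (Q (1, 1) φ)) Ω ≤ X := by
    rw [energy_Q]
    refine ENNReal.tsum_le_tsum fun R => ?_
    rw [coef_Q]
    by_cases h1 : (1, 1) ≤ R.scale
    · rw [if_pos h1]
      exact iv_mono fun h' => ⟨⟨⟨max_le h'.1.1 h1.1, max_le h'.1.2 h1.2⟩, h'.2⟩, le_rfl⟩
    · rw [if_neg h1]
      simp [iv]
  have key : X * ((j'.1 : ℝ≥0∞) * j'.2) ^ 2 ≤ (2 * C) ^ 2 * volume Ω :=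
    energy_mul_sq_le h j' hΩ.measurableSet
  have hMj : M ≤ 4 * ((j'.1 : ℝ≥0∞) * j'.2) := by
    have h1 : ∀ n : ℕ, (n : ℝ≥0∞) + 1 ≤ 2 * ((max n 1 : ℕ) : ℝ≥0∞) := by
      intro n
      have : n + 1 ≤ 2 * max n 1 := by omega
      exact_mod_cast this
    calc M ≤ (2 * (j'.1 : ℝ≥0∞)) * (2 * (j'.2 : ℝ≥0∞)) := mul_le_mul' (h1 j.1) (h1 j.2)
      _ = _ := by ring
  have hXM : X * M ^ 2 ≤ (8 * C) ^ 2 * volume Ω := by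
    calc X * M ^ 2 ≤ X * (4 * ((j'.1 : ℝ≥0∞) * j'.2)) ^ 2 := by gcongr
      _ = 16 * (X * ((j'.1 : ℝ≥0∞) * j'.2) ^ 2) := by ring
      _ ≤ 16 * ((2 * C) ^ 2 * volume Ω) := by gcongr
      _ = _ := by ring
  calc energy (Q j (Q (1, 1) φ)) Ω ≤ X := hEX
    _ = X * M ^ 2 * M⁻¹ ^ 2 := by
        rw [mul_assoc, ← mul_pow, ENNReal.mul_inv_cancel hM0 hMt, one_pow, mul_one]
    _ ≤ (8 * C) ^ 2 * volume Ω * M⁻¹ ^ 2 := by gcongr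
    _ = _ := by push_cast; ring

/-! ### Norm comparison -/

lemma lmoNorm_Q_one_le_mul (φ : L2T 𝕜) : lmoNorm (Q (1, 1) φ) ≤ 8 * paraproductNorm φ := by
  unfold paraproductNorm
  rw [ENNReal.mul_iInf_of_ne (by simp) (by simp)]
  refine le_iInf fun C => ?_
  rw [ENNReal.mul_iInf_of_ne (by simp) (by simp)]
  refine le_iInf fun h => ?_
  exact (iInf₂_le (8 * C) (lmoBound_of_paraproductBound h)).trans (by push_cast; rfl)

lemma paraproductNorm_le_mul (φ : L2T 𝕜) :
    paraproductNorm φ ≤ 50 * lmoNorm (Q (1, 1) φ) := by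
  unfold lmoNorm
  rw [ENNReal.mul_iInf_of_ne (by simp) (by simp)]
  refine le_iInf fun C => ?_
  rw [ENNReal.mul_iInf_of_ne (by simp) (by simp)]
  refine le_iInf fun h => ?_
  exact (iInf₂_le (50 * C) (paraproductBound_of_lmoBound h)).trans (by push_cast; rfl)

lemma memLMO_Q_one_iff (φ : L2T 𝕜) : MemLMO (Q (1, 1) φ) ↔ ParaproductBounded φ :=
  ⟨fun ⟨_, h⟩ => ⟨_, paraproductBound_of_lmoBound h⟩,
    fun ⟨_, h⟩ => ⟨_, lmoBound_of_paraproductBound h⟩⟩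

lemma lmoNorm_Q_one_le (φ : L2T 𝕜) : lmoNorm (Q (1, 1) φ) ≤ lmoNorm φ :=
  le_iInf fun C => le_iInf fun h => iInf₂_le C h.Q_one

lemma inv_eight_mul_lmoNorm_le (φ : L2T 𝕜) :
    ((8⁻¹ : ℝ≥0) : ℝ≥0∞) * lmoNorm (Q (1, 1) φ) ≤ paraproductNorm φ := by
  calc ((8⁻¹ : ℝ≥0) : ℝ≥0∞) * lmoNorm (Q (1, 1) φ)
      ≤ ((8⁻¹ : ℝ≥0) : ℝ≥0∞) * (8 * paraproductNorm φ) := by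
        gcongr; exact lmoNorm_Q_one_le_mul φ
    _ = paraproductNorm φ := by
        rw [← mul_assoc, ENNReal.coe_inv (by norm_num)]
        push_cast
        rw [ENNReal.inv_mul_cancel (by simp) (by simp), one_mul]

lemma coef_Q_one_of_vanishing {φ : L2T 𝕜}
    (h : ∀ R : DyadicRect, R.1.1 = 0 ∨ R.2.1 = 0 → coef φ R = 0) (R : DyadicRect) :
    coef (Q (1, 1) φ) R = coef φ R := by
  classical
  rw [coef_Q]
  split_ifs with h1
  · rfl
  · refine (h R ?_).symm
    by_contra hcon
    push Not at hcon
    exact h1 ⟨Nat.one_le_iff_ne_zero.2 hcon.1, Nat.one_le_iff_ne_zero.2 hcon.2⟩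

end DyadicBMO

end

theorem theorem2p1 (𝕜 : Type*) [RCLike 𝕜] :
    ∃ c C : ℝ≥0, 0 < c ∧ 0 < C ∧ ∀ φ : DyadicBMO.L2T 𝕜,
      -- the characterization, for every symbol in `L²`
      ((DyadicBMO.MemLMO (DyadicBMO.Q (1, 1) φ) ↔ DyadicBMO.ParaproductBounded φ) ∧
        c * DyadicBMO.lmoNorm (DyadicBMO.Q (1, 1) φ) ≤ DyadicBMO.paraproductNorm φ ∧
        DyadicBMO.paraproductNorm φ ≤ C * DyadicBMO.lmoNorm (DyadicBMO.Q (1, 1) φ)) ∧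
      -- in particular, `LMO^d` symbols give bounded paraproducts
      ((DyadicBMO.MemLMO φ → DyadicBMO.ParaproductBounded φ) ∧
        DyadicBMO.paraproductNorm φ ≤ C * DyadicBMO.lmoNorm φ) ∧
      -- and the converse holds as well if `φ_{I × J} = 0` whenever `I = 𝕋` or `J = 𝕋`
      ((∀ R : DyadicBMO.DyadicRect, R.1.1 = 0 ∨ R.2.1 = 0 → DyadicBMO.coef φ R = 0) →
        (DyadicBMO.MemLMO φ ↔ DyadicBMO.ParaproductBounded φ) ∧
        c * DyadicBMO.lmoNorm φ ≤ DyadicBMO.paraproductNorm φ ∧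
        DyadicBMO.paraproductNorm φ ≤ C * DyadicBMO.lmoNorm φ) := by
  refine ⟨8⁻¹, 50, by norm_num, by norm_num, fun φ => ?_⟩
  have hiff := DyadicBMO.memLMO_Q_one_iff φ
  have hlow := DyadicBMO.inv_eight_mul_lmoNorm_le φ
  have hup : DyadicBMO.paraproductNorm φ ≤
      ((50 : ℝ≥0) : ℝ≥0∞) * DyadicBMO.lmoNorm (DyadicBMO.Q (1, 1) φ) :=
    DyadicBMO.paraproductNorm_le_mul φ
  refine ⟨⟨hiff, hlow, hup⟩, ⟨fun ⟨C, hC⟩ => hiff.1 ⟨C, hC.Q_one⟩, hup.trans ?_⟩, fun h0 => ?_⟩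
  · gcongr
    exact DyadicBMO.lmoNorm_Q_one_le φ
  · have hb : ∀ C, DyadicBMO.LMOBound (DyadicBMO.Q (1, 1) φ) C ↔ DyadicBMO.LMOBound φ C :=
      fun C => DyadicBMO.lmoBound_congr (DyadicBMO.coef_Q_one_of_vanishing h0)
    have hm : DyadicBMO.MemLMO (DyadicBMO.Q (1, 1) φ) ↔ DyadicBMO.MemLMO φ := exists_congr hb
    have hn : DyadicBMO.lmoNorm (DyadicBMO.Q (1, 1) φ) = DyadicBMO.lmoNorm φ := by
      simp only [DyadicBMO.lmoNorm, hb]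
    rw [← hm, ← hn]
    exact ⟨hiff, hlow, hup⟩
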